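/- Let $T>0$, let $\Omega=D([0,T];\mathbb R)$ be the space of real càdlàg paths with the Borel $\sigma$-algebra of the Skorokhod topology, the canonical process $X$ and its raw filtration $\mathbb F$. Let $\mu\le_c\nu$ be finite measures on $\mathbb R$ with finite first moments, in convex order and irreducible: with $u_\mu(x)=\int|x-y|\,\mu(dy)$, the set $I=\{u_\mu<u_\nu\}$ is connected and $\mu(I)=\mu(\mathbb R)$. Let $J$ be the union of $I$ and those endpoints of $I$ that are atoms of $\nu$. Let $\mathcal M(\mu,\nu)$ be the set of finite measures $P$ on $\Omega$ with $P\circ X_0^{-1}=\mu$ and $P\circ X_T^{-1}=\nu$ under which $X$ is a martingale. *Generalized integral.* For $\chi:J\to\mathbb R$ concave, put $(\mu-\nu)(\chi)=\frac12\int_I(u_\mu-u_\nu)\,d\chi''+\int_{J\setminus I}|\Delta\chi|\,d(\nu-\mu)\in[0,\infty]$, where $\chi''$ is the second derivative measure on $I$ and $\Delta\chi$ denotes the jumps of $\chi$ at the endpoints of $I$. For Borel $\varphi,\psi:J\to[-\infty,\infty]$, $\chi$ is a concave moderator if $\varphi-\chi\in L^1(\mu)$ and $\psi+\chi\in L^1(\nu)$,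 and then $\mu(\varphi)+\nu(\psi):=\mu(\varphi-\chi)+\nu(\psi+\chi)+(\mu-\nu)(\chi)$, which does not depend on the moderator. $L^c(\mu,\nu)$ is the set of pairs of Borel functions $(\varphi,\psi)$ that have a concave moderator with $(\mu-\nu)(\chi)<\infty$. *Averaging processes and strategies.* An averaging process is a nonnegative, nondecreasing, càdlàg, $\mathbb F$-adapted process $A$ on $\Omega$ with $A_T\equiv1$; $dA$ is regarded as a probability measure on $[0,T]$ with mass $A_0$ at $0$. Let $\hat\Omega$ be the product of $\Omega$ and the set of nonnegative nondecreasing càdlàg functions $a$ on $[0,T]$ with $a(T)=1$, with canonical process $(X,A)$ and its raw filtration $\hat{\mathbb F}$. For a process $Z$ on $\hat\Omega$ and an averaging process $A$ put $Z^A_t(\omega)=Z_t(\omega,A(\omega))$. Let $\Omega_{\mu,\nu}$ be the set of $\omega\in\Omega$ with $\omega_0\in I$, $\omega_t\in J$ for $t\in(0,T]$, such that $\omega_u=\omega_{t-}$ for all $u\ge t$ whenever $t\in(0,T]$ and $\omega_{t-}\in\partial J$, and $\omega_u=\omega_t$ for all $u\ge t$ whenever $\omega_t\in\partial J$. A semi-static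 trading strategy is a triple $(\varphi,\psi,H)$ with $(\varphi,\psi)\in L^c(\mu,\nu)$ and $H=(h,Y)$ a pair of $\hat{\mathbb F}$-adapted processes such that for every averaging process $A$: $h^A$ and $Y^A$ are $\mathbb F$-adapted, $Y^A$ is càdlàg of finite variation, and $t\mapsto(X_T-X_t)h^A_t$ is $dY^A$-integrable on $(0,T]$ for each path in $\Omega_{\mu,\nu}$; then put $$H^A\diamond X_T=(X_T-X_0)h^A_0+\int_{(0,T]}(X_T-X_t)h^A_t\,dY^A_t .$$ It is a semi-static superhedge for $f$ and a set $\mathcal A$ of averaging processes if for every $A\in\mathcal A$ $$f\Big(\int_{[0,T]}X_t\,dA_t\Big)\le\varphi(X_0)+\psi(X_T)+H^A\diamond X_T\quad\text{on }\Omega_{\mu,\nu},$$ and for every $P\in\mathcal M(\mu,\nu)$ the expectation below is well defined and $$E_P\big[\varphi(X_0)+\psi(X_T)+H^A\diamond X_T\big]\le\mu(\varphi)+\nu(\psi).$$ **Proposition.** Let $f:\mathbb R\to[0,\infty]$ be Borel and let $(\varphi,\psi)\in L^c(\mu,\nu)$ with $\varphi:J\to[-\infty,\infty]$ concave, $\psi:J\to[-\infty,\infty]$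 convex and $\varphi+\psi\ge f$ on $J$. Let $\varphi':I\to\mathbb R$ be any superderivative of $\varphi$ and $\psi':I\to\mathbb R$ any subderivative of $\psi$, i.e. Borel functions with $\varphi(x)-\varphi(x_0)\le\varphi'(x_0)(x-x_0)$ and $\psi(x)-\psi(x_0)\ge\psi'(x_0)(x-x_0)$ for all $x_0\in I$, $x\in J$, extended by $\varphi'=\psi'=0$ to $\mathbb R\setminus I$. Define on $\hat\Omega$ $$h_0=\varphi'(X_0)(1-A_0)-\psi'(X_0)A_0,\qquad h_t=-\varphi'(X_0)-\psi'(X_t),\quad t\in(0,T],$$ and $H=(h,A)$. Then $(\varphi,\psi,H)$ is a semi-static superhedge for $f$ and every set $\mathcal A$ of averaging processes. -/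

import Mathlib

open MeasureTheory ProbabilityTheory Filter Set Topology
open scoped ENNReal

namespace SemiStatic

noncomputable section

/-! ## Convex order, irreducible pairs and their domain -/

/-- `μ ≤_c ν` for measures with finite first moment. A real convex function `g` has an affine
minorant, so `μ(g) ≤ ν(g)` in `(-∞, ∞]` is void when `ν(g) = ∞`, and otherwise says that `g` is
`μ`-integrable with `∫ g dμ ≤ ∫ g dν`. -/
def ConvexOrder (μ ν : Measure ℝ) : Prop :=
  Integrable (fun x : ℝ => x) μ ∧ Integrable (fun x : ℝ => x) ν ∧
    ∀ g : ℝ → ℝ, ConvexOn ℝ univ g → Integrable g ν → Integrable g μ ∧ ∫ x, g x ∂μ ≤ ∫ x, g x ∂ν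

/-- The potential function `u_μ(x) = ∫ |x - y| μ(dy)`. -/
def potential (μ : Measure ℝ) (x : ℝ) : ℝ := ∫ y, |x - y| ∂μ

/-- `I = {u_μ < u_ν}`. -/
def domI (μ ν : Measure ℝ) : Set ℝ := {x | potential μ x < potential ν x}

/-- `J` is `I` together with those endpoints of `I` that are atoms of `ν`. -/
def domJ (μ ν : Measure ℝ) : Set ℝ := domI μ ν ∪ {x | x ∈ frontier (domI μ ν) ∧ ν {x} ≠ 0}

/-- The pair `μ ≤_c ν` is irreducible. -/
structure IsIrreducible (μ ν : Measure ℝ) : Prop where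
  convexOrder : ConvexOrder μ ν
  preconnected : IsPreconnected (domI μ ν)
  concentrated : μ (domI μ ν) = μ univ

/-! ## The generalized integral `θ₁(φ) + θ₂(ψ)`

Functions on `J` are represented by functions on `ℝ` whose values outside `J` are never used. -/

theorem compactIccSpace_of_ordConnected {I : Set ℝ} (hI : I.OrdConnected) :
    CompactIccSpace I := by
  refine ⟨fun {a b} => ?_⟩
  rw [Subtype.isCompact_iff]
  have : (Subtype.val '' Icc a b : Set ℝ) = Icc (a : ℝ) b := by
    ext x
    constructor
    · rintro ⟨y, hy, rfl⟩
      exact hy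
    · intro hx
      exact ⟨⟨x, hI.out a.2 b.2 hx⟩, hx, rfl⟩
  rw [this]
  exact isCompact_Icc

open Classical in
/-- The second derivative measure, on the open interval `I`, of a function `g` that is convex on
`I`: the Lebesgue–Stieltjes measure on `I` of the right derivative of `g`.
(For convex `g` the condition of the `if` holds.) -/
def secondDerivMeasure (I : Set ℝ) (g : ℝ → ℝ) : Measure I :=
  if h : I.OrdConnected ∧ Monotone (fun x : I => derivWithin g (Ioi (x : ℝ)) (x : ℝ)) then
    haveI : I.OrdConnected := h.1
    haveI : CompactIccSpace I := compactIccSpace_of_ordConnected h.1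
    h.2.stieltjesFunction.measure
  else 0

/-- The jump `Δχ(b) = χ(b) - lim_{x → b, x ∈ I} χ(x)` at an endpoint `b` of `I`. -/
def jumpAt (I : Set ℝ) (χ : ℝ → ℝ) (b : ℝ) : ℝ := χ b - limUnder (𝓝[I] b) χ

/-- `(θ₁ - θ₂)(χ) = ½ ∫_I (u_θ₁ - u_θ₂) dχ'' + ∫_{J \ I} |Δχ| d(θ₂ - θ₁)` for `χ` concave on `J`.
The first integral is written as the integral of `u_θ₂ - u_θ₁ ≥ 0` against `-χ'' ≥ 0`. -/
def concaveIntegral (I J : Set ℝ) (θ₁ θ₂ : Measure ℝ) (χ : ℝ → ℝ) : ℝ≥0∞ :=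
  2⁻¹ * (∫⁻ x : I, ENNReal.ofReal (potential θ₂ x - potential θ₁ x)
      ∂(secondDerivMeasure I (fun x => -χ x)))
    + ((∫⁻ x in J \ I, ENNReal.ofReal |jumpAt I χ x| ∂θ₂)
      - ∫⁻ x in J \ I, ENNReal.ofReal |jumpAt I χ x| ∂θ₁)

/-- The extended real function `g` on `J` belongs to `L¹(θ)`. -/
def IsL1On (J : Set ℝ) (θ : Measure ℝ) (g : ℝ → EReal) : Prop :=
  (∀ᵐ x ∂(θ.restrict J), g x ≠ ⊤ ∧ g x ≠ ⊥) ∧ IntegrableOn (fun x => (g x).toReal) J θ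

/-- `χ : J → ℝ` is a concave moderator for `(φ, ψ)` with respect to `θ₁ ≤_c θ₂`. -/
structure IsConcaveModerator (J : Set ℝ) (θ₁ θ₂ : Measure ℝ) (φ ψ : ℝ → EReal) (χ : ℝ → ℝ) :
    Prop where
  concave : ConcaveOn ℝ J χ
  left : IsL1On J θ₁ (fun x => φ x - (χ x : EReal))
  right : IsL1On J θ₂ (fun x => ψ x + (χ x : EReal))

/-- The value `θ₁(φ - χ) + θ₂(ψ + χ) + (θ₁ - θ₂)(χ) ∈ (-∞, ∞]`. -/
def moderatedValue (I J : Set ℝ) (θ₁ θ₂ : Measure ℝ) (φ ψ : ℝ → EReal) (χ : ℝ → ℝ) : EReal :=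
  (((∫ x in J, (φ x - (χ x : EReal)).toReal ∂θ₁)
      + ∫ x in J, (ψ x + (χ x : EReal)).toReal ∂θ₂ : ℝ) : EReal)
    + (concaveIntegral I J θ₁ θ₂ χ : EReal)

/-- The generalized integral `θ₁(φ) + θ₂(ψ)`: the value computed with a concave moderator. All
concave moderators give the same value; the infimum merely avoids choosing one. -/
def generalizedIntegral (I J : Set ℝ) (θ₁ θ₂ : Measure ℝ) (φ ψ : ℝ → EReal) : EReal :=
  ⨅ (χ : ℝ → ℝ) (_ : IsConcaveModerator J θ₁ θ₂ φ ψ χ), moderatedValue I J θ₁ θ₂ φ ψ χ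

/-- `(φ, ψ) ∈ L^c(θ₁, θ₂)`. -/
structure IsLc (I J : Set ℝ) (θ₁ θ₂ : Measure ℝ) (φ ψ : ℝ → EReal) : Prop where
  measurable_left : Measurable (J.domRestrict φ)
  measurable_right : Measurable (J.domRestrict ψ)
  exists_moderator : ∃ χ : ℝ → ℝ, IsConcaveModerator J θ₁ θ₂ φ ψ χ ∧
    concaveIntegral I J θ₁ θ₂ χ < ⊤

/-! ## The auxiliary dual problem, sub- and superderivatives -/

/-- Convexity of an extended real function on `J` (convex epigraph). -/
def IsConvexEReal (J : Set ℝ) (ψ : ℝ → EReal) : Prop :=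
  Convex ℝ {p : ℝ × ℝ | p.1 ∈ J ∧ ψ p.1 ≤ (p.2 : EReal)}

/-- Concavity of an extended real function on `J` (convex hypograph). -/
def IsConcaveEReal (J : Set ℝ) (φ : ℝ → EReal) : Prop :=
  Convex ℝ {p : ℝ × ℝ | p.1 ∈ J ∧ (p.2 : EReal) ≤ φ p.1}

/-- `(φ, ψ)` is feasible for the auxiliary dual problem with payoff function `f`. (A sum `∞ - ∞`
counts as `-∞`, so it is excluded by the last condition if `f > -∞`.) -/
structure IsAuxDualFeasible (μ ν : Measure ℝ) (f : ℝ → EReal) (φ ψ : ℝ → EReal) : Prop where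
  mem_Lc : IsLc (domI μ ν) (domJ μ ν) μ ν φ ψ
  concave : IsConcaveEReal (domJ μ ν) φ
  convex : IsConvexEReal (domJ μ ν) ψ
  le : ∀ x ∈ domJ μ ν, f x ≤ φ x + ψ x

/-- `ψ'` (its restriction to `I`) is a subderivative of `ψ : J → ℝ`. -/
structure IsSubderivative (I J : Set ℝ) (ψ : ℝ → EReal) (ψ' : ℝ → ℝ) : Prop where
  measurable : Measurable (I.domRestrict ψ')
  le : ∀ x₀ ∈ I, ∀ x ∈ J, ψ x₀ + ((ψ' x₀ * (x - x₀) : ℝ) : EReal) ≤ ψ x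

/-- `φ'` (its restriction to `I`) is a superderivative of `φ : J → ℝ`. -/
structure IsSuperderivative (I J : Set ℝ) (φ : ℝ → EReal) (φ' : ℝ → ℝ) : Prop where
  measurable : Measurable (I.domRestrict φ')
  le : ∀ x₀ ∈ I, ∀ x ∈ J, φ x ≤ φ x₀ + ((φ' x₀ * (x - x₀) : ℝ) : EReal)

/-! ## Càdlàg paths on `[0, T]`, the Skorokhod topology, martingale couplings -/

/-- `y : [0, T] → ℝ` is right-continuous with left limits. -/
structure IsCadlag {T : ℝ} (y : Icc (0 : ℝ) T → ℝ) : Prop where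
  right_continuous : ∀ t, ContinuousWithinAt y (Ici t) t
  left_limits : ∀ t, ∃ l, Tendsto y (𝓝[<] t) (𝓝 l)

/-- The path space `Ω = D([0, T]; ℝ)`. -/
structure CadlagPath (T : ℝ) where
  toFun : Icc (0 : ℝ) T → ℝ
  cadlag : IsCadlag toFun

instance (T : ℝ) : CoeFun (CadlagPath T) (fun _ => Icc (0 : ℝ) T → ℝ) := ⟨CadlagPath.toFun⟩

/-- Some increasing time change of `[0, T]` moves times by less than `ε` and makes the two paths
differ by less than `ε`. -/
def SkorokhodClose {T : ℝ} (ε : ℝ) (ω ω' : CadlagPath T) : Prop :=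
  ∃ l : Icc (0 : ℝ) T ≃o Icc (0 : ℝ) T,
    ∀ t, |((l t : Icc (0 : ℝ) T) : ℝ) - (t : ℝ)| < ε ∧ |ω t - ω' (l t)| < ε

/-- The Skorokhod (J1) topology. -/
instance (T : ℝ) : TopologicalSpace (CadlagPath T) where
  IsOpen U := ∀ ω ∈ U, ∃ ε > 0, ∀ ω', SkorokhodClose ε ω ω' → ω' ∈ U
  isOpen_univ := fun _ _ => ⟨1, one_pos, fun _ _ => mem_univ _⟩
  isOpen_inter := by
    rintro U V hU hV ω ⟨h1, h2⟩
    obtain ⟨e1, he1, H1⟩ := hU ω h1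
    obtain ⟨e2, he2, H2⟩ := hV ω h2
    refine ⟨min e1 e2, lt_min he1 he2, ?_⟩
    rintro ω' ⟨l, hl⟩
    exact ⟨H1 ω' ⟨l, fun t => ⟨(hl t).1.trans_le (min_le_left _ _),
        (hl t).2.trans_le (min_le_left _ _)⟩⟩,
      H2 ω' ⟨l, fun t => ⟨(hl t).1.trans_le (min_le_right _ _),
        (hl t).2.trans_le (min_le_right _ _)⟩⟩⟩
  isOpen_sUnion := by
    rintro S hS ω ⟨U, hU, hω⟩
    obtain ⟨e, he, H⟩ := hS U hU ω hω
    exact ⟨e, he, fun ω' h' => ⟨U, hU, H ω' h'⟩⟩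

instance (T : ℝ) : MeasurableSpace (CadlagPath T) := borel _

instance (T : ℝ) : BorelSpace (CadlagPath T) := ⟨rfl⟩

theorem isOpen_iff_skorokhod {T : ℝ} {U : Set (CadlagPath T)} :
    IsOpen U ↔ ∀ ω ∈ U, ∃ ε > 0, ∀ ω', SkorokhodClose ε ω ω' → ω' ∈ U := Iff.rfl

/-- The coordinate maps are Borel measurable, as needed for the canonical filtration. -/
theorem measurable_eval {T : ℝ} (t : Icc (0 : ℝ) T) :
    Measurable (fun ω : CadlagPath T => ω t) := by
  by_cases ht : IsTop t
  · apply measurable_of_Ioi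
    intro a
    apply IsOpen.measurableSet
    rw [isOpen_iff_skorokhod]
    intro ω (hω : a < ω t)
    refine ⟨ω t - a, sub_pos.2 hω, ?_⟩
    rintro ω' ⟨l, hl⟩
    have hlt : l t = t := by
      apply le_antisymm (ht _)
      have := l.monotone (ht (l.symm t))
      simpa using this
    have h2 := (hl t).2
    rw [hlt] at h2
    have := (abs_lt.1 h2).2
    change a < ω' t
    linarith
  · have ht' : ∃ u, t < u := by
      unfold IsTop at ht
      push Not at ht
      exact ht
    obtain ⟨u, hu⟩ := ht'
    obtain ⟨v, -, hv, hvt⟩ := exists_seq_strictAnti_tendsto' hu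
    have hopen : ∀ (w : Icc (0 : ℝ) T) (a : ℝ),
        IsOpen {ω : CadlagPath T | ∃ s, t < s ∧ s < w ∧ a < ω s} := by
      intro w a
      rw [isOpen_iff_skorokhod]
      rintro ω ⟨s, hts, hsw, hs⟩
      have h1 : (0 : ℝ) < (s : ℝ) - t := sub_pos.2 hts
      have h2 : (0 : ℝ) < (w : ℝ) - s := sub_pos.2 hsw
      refine ⟨min (min ((s : ℝ) - t) ((w : ℝ) - s)) (ω s - a),
        lt_min (lt_min h1 h2) (sub_pos.2 hs), ?_⟩
      rintro ω' ⟨l, hl⟩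
      obtain ⟨ha, hb⟩ := hl s
      rw [lt_min_iff, lt_min_iff] at ha hb
      refine ⟨l s, ?_, ?_, ?_⟩
      · have := (abs_lt.1 ha.1.1).1
        have h3 : (t : ℝ) < (l s : Icc (0 : ℝ) T) := by linarith
        exact h3
      · have := (abs_lt.1 ha.1.2).2
        have h3 : ((l s : Icc (0 : ℝ) T) : ℝ) < w := by linarith
        exact h3
      · have := (abs_lt.1 hb.2).2
        linarith
    apply measurable_of_Ici
    intro a
    have key : (fun ω : CadlagPath T => ω t) ⁻¹' Ici a =
        ⋂ (n : ℕ) (m : ℕ), {ω : CadlagPath T | ∃ s, t < s ∧ s < v n ∧ a - 1 / ((m : ℝ) + 1) < ω s} := by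
      ext ω
      simp only [mem_preimage, mem_Ici, mem_iInter, mem_ofPred_eq]
      have hrc : Tendsto ω (𝓝[>] t) (𝓝 (ω t)) :=
        (ω.cadlag.right_continuous t).mono Ioi_subset_Ici_self
      constructor
      · intro h n m
        have hm : (0 : ℝ) < 1 / ((m : ℝ) + 1) := by positivity
        have h1 : ∀ᶠ s in 𝓝[>] t, a - 1 / ((m : ℝ) + 1) < ω s :=
          hrc.eventually (lt_mem_nhds (by linarith))
        have h2 : ∀ᶠ s in 𝓝[>] t, s ∈ Ioo t (v n) := Ioo_mem_nhdsGT (hv n).1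
        have : (𝓝[>] t).NeBot := nhdsGT_neBot_of_exists_gt ⟨u, hu⟩
        obtain ⟨s, hs1, hs2⟩ := (h1.and h2).exists
        exact ⟨s, hs2.1, hs2.2, hs1⟩
      · intro h
        have h1 : ∀ m : ℕ, a - 1 / ((m : ℝ) + 1) ≤ ω t := by
          intro m
          choose s hs1 hs2 hs3 using fun n => h n m
          have hst : Tendsto s atTop (𝓝[>] t) :=
            tendsto_nhdsWithin_iff.2 ⟨tendsto_of_tendsto_of_tendsto_of_le_of_le
              tendsto_const_nhds hvt (fun n => (hs1 n).le) (fun n => (hs2 n).le),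
              Eventually.of_forall hs1⟩
          exact ge_of_tendsto' (hrc.comp hst) (fun n => (hs3 n).le)
        have h2 : Tendsto (fun m : ℕ => a - 1 / ((m : ℝ) + 1)) atTop (𝓝 (a - 0)) :=
          tendsto_const_nhds.sub tendsto_one_div_add_atTop_nhds_zero_nat
        rw [sub_zero] at h2
        exact le_of_tendsto' h2 h1
    rw [key]
    exact MeasurableSet.iInter fun n => MeasurableSet.iInter fun m => (hopen _ _).measurableSet

/-- The raw filtration generated by the canonical process on `Ω`. -/
def pathFiltration (T : ℝ) :
    Filtration (Icc (0 : ℝ) T) (inferInstance : MeasurableSpace (CadlagPath T)) :=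
  Filtration.natural (fun t (ω : CadlagPath T) => ω t)
    (fun t => (measurable_eval t).stronglyMeasurable)

/-- `P ∈ M(μ, ν)`: a finite measure on `Ω` with marginals `μ` at time `0` and `ν` at time `T` under
which the canonical process is a martingale. -/
structure IsMartingaleCoupling {T : ℝ} [Fact (0 ≤ T)] (μ ν : Measure ℝ)
    (P : Measure (CadlagPath T)) : Prop where
  finite : IsFiniteMeasure P
  map_zero : P.map (fun ω => ω ⊥) = μ
  map_top : P.map (fun ω => ω ⊤) = ν
  martingale : Martingale (fun t (ω : CadlagPath T) => ω t) (pathFiltration T) P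

/-- The relevant paths `Ω_{μ,ν}`: start in `I`, evolve in `J`, and are captured at `∂J`. -/
def relevantPaths {T : ℝ} [Fact (0 ≤ T)] (μ ν : Measure ℝ) : Set (CadlagPath T) :=
  {ω | ω ⊥ ∈ domI μ ν ∧ (∀ t, ⊥ < t → ω t ∈ domJ μ ν) ∧
    (∀ t, ⊥ < t → Function.leftLim ω t ∈ frontier (domJ μ ν) →
      ∀ u, t ≤ u → ω u = Function.leftLim ω t) ∧
    (∀ t, ω t ∈ frontier (domJ μ ν) → ∀ u, t ≤ u → ω u = ω t)}

/-! ## Averaging processes -/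

/-- Nonnegative nondecreasing càdlàg functions `a` on `[0, T]` with `a(T) = 1`. -/
structure AveragingPath (T : ℝ) [Fact (0 ≤ T)] where
  toFun : Icc (0 : ℝ) T → ℝ
  cadlag : IsCadlag toFun
  nonneg : ∀ t, 0 ≤ toFun t
  mono : Monotone toFun
  top_eq_one : toFun ⊤ = 1

instance (T : ℝ) [Fact (0 ≤ T)] : CoeFun (AveragingPath T) (fun _ => Icc (0 : ℝ) T → ℝ) :=
  ⟨AveragingPath.toFun⟩

/-- Averaging processes: adapted processes on `Ω` with paths as above. -/
structure AveragingProcess (T : ℝ) [Fact (0 ≤ T)] where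
  path : CadlagPath T → AveragingPath T
  adapted : Adapted (pathFiltration T) (fun t (ω : CadlagPath T) => path ω t)

/-- The enlarged path space `Ω̂`, with canonical process `(X, A) = (x.1, x.2)`. -/
abbrev HatPath (T : ℝ) [Fact (0 ≤ T)] : Type := CadlagPath T × AveragingPath T

/-- The raw filtration generated by the canonical process on `Ω̂`. -/
@[reducible] def hatFiltration (T : ℝ) [Fact (0 ≤ T)] (t : Icc (0 : ℝ) T) : MeasurableSpace (HatPath T) :=
  ⨆ s ≤ t, (MeasurableSpace.comap (fun x : HatPath T => x.1 s) inferInstance ⊔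
    MeasurableSpace.comap (fun x : HatPath T => x.2 s) inferInstance)

/-- `Z^A_t(ω) = Z_t(ω, A(ω))`. -/
def pullback {T : ℝ} [Fact (0 ≤ T)] (Z : Icc (0 : ℝ) T → HatPath T → ℝ) (A : AveragingProcess T) :
    Icc (0 : ℝ) T → CadlagPath T → ℝ :=
  fun t ω => Z t (ω, A.path ω)

/-! ## Pathwise integration -/

open Classical in
/-- The Lebesgue–Stieltjes measure `dy` on `(0, T]` of a càdlàg function `y` of finite variation,
viewed as a signed measure on `[0, T]`; it has no mass at `0`. -/
def stieltjesMeasure {T : ℝ} [Fact (0 ≤ T)] (y : Icc (0 : ℝ) T → ℝ) :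
    SignedMeasure (Icc (0 : ℝ) T) :=
  if h : BoundedVariationOn y univ then h.vectorMeasure else 0

/-- `∫_{[0,T]} X_t dA_t` along the path `ω`; the mass of `dA` at `0` is `A_0`. -/
def average {T : ℝ} [Fact (0 ≤ T)] (ω : CadlagPath T) (a : AveragingPath T) : ℝ :=
  ω ⊥ * a ⊥ + ∫ᵛ t, ω t ∂•(stieltjesMeasure a)

/-- `(h, Y) ∈ L(Ω')`. -/
structure IsIntegrand {T : ℝ} [Fact (0 ≤ T)] (S : Set (CadlagPath T))
    (h Y : Icc (0 : ℝ) T → CadlagPath T → ℝ) : Prop where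
  adapted_h : Adapted (pathFiltration T) h
  adapted_Y : Adapted (pathFiltration T) Y
  cadlag : ∀ ω, IsCadlag (fun t => Y t ω)
  finite_variation : ∀ ω, BoundedVariationOn (fun t => Y t ω) univ
  integrable : ∀ ω ∈ S,
    (stieltjesMeasure (fun t => Y t ω)).Integrable (fun t => (ω ⊤ - ω t) * h t ω)

/-- `(h, Y) ⋄ X_T = (X_T - X_0) h_0 + ∫_{(0,T]} (X_T - X_t) h_t dY_t`. -/
def gains {T : ℝ} [Fact (0 ≤ T)] (h Y : Icc (0 : ℝ) T → CadlagPath T → ℝ) (ω : CadlagPath T) : ℝ :=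
  (ω ⊤ - ω ⊥) * h ⊥ ω + ∫ᵛ t, (ω ⊤ - ω t) * h t ω ∂•(stieltjesMeasure (fun t => Y t ω))

/-! ## Semi-static superhedges -/

/-- `(φ, ψ, (h, Y))` is a semi-static trading strategy. -/
structure IsSemiStaticStrategy {T : ℝ} [Fact (0 ≤ T)] (μ ν : Measure ℝ) (φ ψ : ℝ → EReal)
    (h Y : Icc (0 : ℝ) T → HatPath T → ℝ) : Prop where
  mem_Lc : IsLc (domI μ ν) (domJ μ ν) μ ν φ ψ
  adapted_h : ∀ t, Measurable[hatFiltration T t] (h t)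
  adapted_Y : ∀ t, Measurable[hatFiltration T t] (Y t)
  integrand : ∀ A : AveragingProcess T,
    IsIntegrand (relevantPaths μ ν) (pullback h A) (pullback Y A)

/-- The terminal portfolio value `φ(X_0) + ψ(X_T) + H^A ⋄ X_T`. -/
def portfolioValue {T : ℝ} [Fact (0 ≤ T)] (φ ψ : ℝ → EReal)
    (h Y : Icc (0 : ℝ) T → HatPath T → ℝ) (A : AveragingProcess T) (ω : CadlagPath T) : EReal :=
  φ (ω ⊥) + ψ (ω ⊤) + (gains (pullback h A) (pullback Y A) ω : EReal)

/-- `E_P[g] ≤ c`, where the expectation is well defined in `(-∞, ∞]`: `g` is `P`-a.e. equal to a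
measurable function and has `P`-integrable negative part. -/
def ExpectationLE {Ω : Type*} [MeasurableSpace Ω] (P : Measure Ω) (g : Ω → EReal) (c : EReal) :
    Prop :=
  AEMeasurable g P ∧ ∫⁻ ω, (-g ω).toENNReal ∂P ≠ ⊤ ∧
    ((∫⁻ ω, (g ω).toENNReal ∂P : ℝ≥0∞) : EReal) - ((∫⁻ ω, (-g ω).toENNReal ∂P : ℝ≥0∞) : EReal) ≤ c

/-- `(φ, ψ, (h, Y))` is a semi-static superhedge for the payoff function `f` and the set `𝒜` of
averaging processes. -/
structure IsSemiStaticSuperhedge {T : ℝ} [Fact (0 ≤ T)] (μ ν : Measure ℝ) (f : ℝ → EReal)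
    (𝒜 : Set (AveragingProcess T)) (φ ψ : ℝ → EReal)
    (h Y : Icc (0 : ℝ) T → HatPath T → ℝ) : Prop where
  strategy : IsSemiStaticStrategy μ ν φ ψ h Y
  superhedge : ∀ A ∈ 𝒜, ∀ ω ∈ relevantPaths (T := T) μ ν,
    f (average ω (A.path ω)) ≤ portfolioValue φ ψ h Y A ω
  admissible : ∀ A ∈ 𝒜, ∀ P : Measure (CadlagPath T), IsMartingaleCoupling μ ν P →
    ExpectationLE P (portfolioValue φ ψ h Y A)
      (generalizedIntegral (domI μ ν) (domJ μ ν) μ ν φ ψ)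

/-- The process `h_0 = φ'(X_0)(1 - A_0) - ψ'(X_0) A_0`, `h_t = -φ'(X_0) - ψ'(X_t)` for
`t ∈ (0, T]`, where `φ'` and `ψ'` are set to `0` outside `I`. -/
def dynamicPart {T : ℝ} [Fact (0 ≤ T)] (I : Set ℝ) (φ' ψ' : ℝ → ℝ) (t : Icc (0 : ℝ) T)
    (x : HatPath T) : ℝ :=
  if t = ⊥ then I.indicator φ' (x.1 ⊥) * (1 - x.2 ⊥) - I.indicator ψ' (x.1 ⊥) * x.2 ⊥
  else -I.indicator φ' (x.1 ⊥) - I.indicator ψ' (x.1 t)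

end

end SemiStatic

/-! Superhedging is pathwise. On a relevant path the gains equal `φ'(X_0)(X_T - X_0)` plus the
`dA`-average of `(X_T - X_t)(-φ'(X_0) - ψ'(X_t))`; the special form of `h_0` accounts for the mass
of `dA` at time `0` (`gains_dynamicPart`). The subgradient inequality for `ψ` at `X_t` shows that
the portfolio dominates the `dA`-average of `φ(X_0) + φ'(X_0)(X_t - X_0) + ψ(X_t)`. Jensen's
inequality for `ψ` and the supporting line of `φ` at `X_0` then bound this below by `(φ + ψ)(m) ≥
f(m)`, where `m` is the average of the path (`add_average_le`). The slope `ψ'` may explode at the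
boundary of `J`, but capture at the boundary keeps `ψ'(X_t)(X_T - X_t)` bounded along each relevant
path (`exists_abs_indicator_mul_le`), so the integrals exist.

The expectation bound rests on positivity and Fatou's lemma, because the gains need not be
integrable. Put `B = φ(X_0) + ψ(X_T) + φ'(X_0)(X_T - X_0)`. Since `f ≥ 0`, both `B` and `B` plus the
gains from any single date are nonnegative. Truncated trading rates have zero expected gains, even
when averaged against the adapted random measure `dA` (`AveragingProcess.integral_cutoff`), so
removing the truncation gives `E[portfolio] ≤ E[B]` (`lintegral_realPortfolio_le`).

It remains to bound `E[B]` by the moderated value for every concave moderator `χ`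
(`lintegral_baseValue_le`). Here `B` splits into the integrable static part `(φ - χ)(X_0) + (ψ +
χ)(X_T)`, the gap between `χ` and its tangent at `X_0`, and a function of `X_0` times `X_T - X_0`.
By Taylor's formula with respect to `-χ''`, and because the Taylor kernel has expectation `½ (u_ν -
u_μ)`, the expected gap is at most `(μ - ν)(χ)` (`lintegral_gap_le`).

Both arguments need only relevant paths, which carry every martingale coupling: a nonnegative càdlàg
martingale is absorbed at zero, and this is applied to the distances of `X` from the endpoints of
`I` (`ae_mem_relevantPaths`). -/

set_option linter.unusedSectionVars false

namespace SemiStatic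

noncomputable section

section

/-! ### Càdlàg functions on `[0, T]` -/

variable {T : ℝ}

/-- The time `t` rounded up to the next multiple of `1 / (n + 1)`, capped at `T`. -/
def roundUp [Fact (0 ≤ T)] (n : ℕ) (t : Icc (0 : ℝ) T) : Icc (0 : ℝ) T :=
  projIcc 0 T Fact.out ((⌈(t : ℝ) * (n + 1)⌉₊ : ℝ) / (n + 1))

theorem le_roundUp [Fact (0 ≤ T)] (n : ℕ) (t : Icc (0 : ℝ) T) : t ≤ roundUp n t := by
  have h : (t : ℝ) ≤ (⌈(t : ℝ) * (n + 1)⌉₊ : ℝ) / (n + 1) := by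
    rw [le_div_iff₀ (by positivity)]
    exact Nat.le_ceil _
  have := monotone_projIcc (Fact.out : (0 : ℝ) ≤ T) h
  rwa [projIcc_val] at this

theorem roundUp_le [Fact (0 ≤ T)] (n : ℕ) (t : Icc (0 : ℝ) T) :
    (roundUp n t : ℝ) ≤ t + 1 / ((n : ℝ) + 1) := by
  have h0 : (0 : ℝ) ≤ t := t.2.1
  have h : (⌈(t : ℝ) * (n + 1)⌉₊ : ℝ) / (n + 1) ≤ t + 1 / ((n : ℝ) + 1) := by
    rw [div_le_iff₀ (by positivity), add_mul, one_div, inv_mul_cancel₀ (by positivity)]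
    exact (Nat.ceil_lt_add_one (by positivity)).le
  refine le_trans ?_ h
  rw [roundUp, coe_projIcc]
  exact max_le (by positivity) (min_le_right _ _)

theorem measurable_roundUp [Fact (0 ≤ T)] (n : ℕ) :
    Measurable (roundUp n : Icc (0 : ℝ) T → Icc (0 : ℝ) T) := by
  unfold roundUp
  refine continuous_projIcc.measurable.comp ?_
  refine Measurable.div_const ?_ _
  exact measurable_from_top.comp
    (Nat.measurable_ceil.comp (measurable_subtype_coe.mul_const _))

theorem finite_range_roundUp [Fact (0 ≤ T)] (n : ℕ) :
    (range (roundUp n : Icc (0 : ℝ) T → Icc (0 : ℝ) T)).Finite := by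
  refine ((finite_Iic ⌈T * (n + 1)⌉₊).image (fun k : ℕ =>
    projIcc 0 T Fact.out ((k : ℝ) / (n + 1)))).subset ?_
  rintro _ ⟨t, rfl⟩
  refine ⟨⌈(t : ℝ) * (n + 1)⌉₊, ?_, rfl⟩
  exact Nat.ceil_mono (mul_le_mul_of_nonneg_right t.2.2 (by positivity))

/-- Approximation from the right suits càdlàg paths. Rounding up also preserves adaptedness: the
times rounded to `r` all lie in `[0, r]`, so their `dA`-mass is known at time `r`. -/
theorem tendsto_roundUp [Fact (0 ≤ T)] (t : Icc (0 : ℝ) T) :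
    Tendsto (fun n => roundUp n t) atTop (𝓝[≥] t) := by
  refine tendsto_nhdsWithin_iff.2 ⟨?_, Eventually.of_forall fun n => le_roundUp n t⟩
  rw [tendsto_subtype_rng]
  refine tendsto_of_tendsto_of_tendsto_of_le_of_le tendsto_const_nhds ?_
    (fun n => le_roundUp n t) (fun n => roundUp_le n t)
  simpa using tendsto_const_nhds.add (tendsto_one_div_add_atTop_nhds_zero_nat (𝕜 := ℝ))

theorem IsCadlag.tendsto_comp_roundUp [Fact (0 ≤ T)] {y : Icc (0 : ℝ) T → ℝ} (hy : IsCadlag y)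
    (t : Icc (0 : ℝ) T) : Tendsto (fun n => y (roundUp n t)) atTop (𝓝 (y t)) :=
  (hy.right_continuous t).tendsto.comp (tendsto_roundUp t)

/-- A process sampled at rounded times is jointly measurable. -/
theorem measurable_comp_roundUp [Fact (0 ≤ T)] {Ω : Type*} [MeasurableSpace Ω]
    {Z : Icc (0 : ℝ) T → Ω → ℝ} (hZ : ∀ t, Measurable (Z t)) (n : ℕ) :
    Measurable (fun p : Ω × Icc (0 : ℝ) T => Z (roundUp n p.2) p.1) := by
  intro s hs
  have : (fun p : Ω × Icc (0 : ℝ) T => Z (roundUp n p.2) p.1) ⁻¹' s =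
      ⋃ r ∈ range (roundUp n : Icc (0 : ℝ) T → Icc (0 : ℝ) T),
        (Z r ⁻¹' s) ×ˢ (roundUp n ⁻¹' {r}) := by
    ext ⟨ω, t⟩
    simp only [mem_preimage, mem_iUnion, mem_prod, mem_singleton_iff, exists_prop]
    exact ⟨fun h => ⟨_, ⟨t, rfl⟩, h, rfl⟩, fun ⟨r, _, h, h'⟩ => h' ▸ h⟩
  rw [this]
  exact (finite_range_roundUp n).measurableSet_biUnion fun r _ =>
    (hZ r hs).prod (measurable_roundUp n (measurableSet_singleton r))

/-- A right-continuous process is the pointwise limit of its samples at rounded times, each of which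
takes only finitely many time values. -/
theorem measurable_uncurry_of_isCadlag [Fact (0 ≤ T)] {Ω : Type*} [MeasurableSpace Ω]
    {Z : Icc (0 : ℝ) T → Ω → ℝ} (hZ : ∀ t, Measurable (Z t))
    (hc : ∀ ω, IsCadlag (fun t => Z t ω)) :
    Measurable (fun p : Ω × Icc (0 : ℝ) T => Z p.2 p.1) :=
  measurable_of_tendsto_metrizable (fun n => measurable_comp_roundUp hZ n)
    (tendsto_pi_nhds.2 fun p => (hc p.1).tendsto_comp_roundUp p.2)

theorem IsCadlag.measurable [Fact (0 ≤ T)] {y : Icc (0 : ℝ) T → ℝ} (hy : IsCadlag y) :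
    Measurable y :=
  (measurable_uncurry_of_isCadlag (Ω := Unit) (Z := fun t _ => y t)
    (fun _ => measurable_const) (fun _ => hy)).comp 
    ((measurable_const (a := ())).prodMk measurable_id)

theorem IsCadlag.neg {y : Icc (0 : ℝ) T → ℝ} (hy : IsCadlag y) : IsCadlag (fun t => -y t) where
  right_continuous t := (hy.right_continuous t).neg
  left_limits t := let ⟨l, hl⟩ := hy.left_limits t; ⟨-l, hl.neg⟩

theorem IsCadlag.tendsto_leftLim {y : Icc (0 : ℝ) T → ℝ} (hy : IsCadlag y) (t : Icc (0 : ℝ) T) :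
    Tendsto y (𝓝[<] t) (𝓝 (Function.leftLim y t)) := by
  exact tendsto_leftLim_of_tendsto (hy.left_limits t)

theorem IsCadlag.leftLim_neg {y : Icc (0 : ℝ) T → ℝ} (hy : IsCadlag y) (t : Icc (0 : ℝ) T) :
    Function.leftLim (fun t => -y t) t = -Function.leftLim y t := by
  by_cases h : 𝓝[<] t = ⊥
  -- Without times to the left, `leftLim` is by convention the value itself.
  · rw [leftLim_eq_of_eq_bot _ h, leftLim_eq_of_eq_bot _ h]
  · have : (𝓝[<] t).NeBot := ⟨h⟩
    exact tendsto_nhds_unique (hy.neg.tendsto_leftLim t) (hy.tendsto_leftLim t).neg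

/-- A property of sets of times that holds near every left and right limit holds globally. -/
theorem induction_left_right {p : Set (Icc (0 : ℝ) T) → Prop}
    (he : p ∅) (hmono : ∀ ⦃s t⦄, s ⊆ t → p t → p s)
    (hunion : ∀ ⦃s t⦄, p s → p t → p (s ∪ t))
    (hl : ∀ t, ∃ s ∈ 𝓝[<] t, p s) (hr : ∀ t, ∃ s ∈ 𝓝[≥] t, p s) : p univ := by
  refine isCompact_univ.induction_on he hmono hunion fun t _ => ?_
  obtain ⟨s₁, hs₁, h₁⟩ := hl t
  obtain ⟨s₂, hs₂, h₂⟩ := hr t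
  refine ⟨s₁ ∪ s₂, ?_, hunion h₁ h₂⟩
  rw [nhdsWithin_univ, ← nhdsLT_sup_nhdsGE]
  exact union_mem_sup hs₁ hs₂

theorem IsCadlag.exists_abs_le {y : Icc (0 : ℝ) T → ℝ} (hy : IsCadlag y) :
    ∃ C, 0 ≤ C ∧ ∀ t, |y t| ≤ C := by
  have key : ∀ (l : ℝ) (F : Filter (Icc (0 : ℝ) T)), Tendsto y F (𝓝 l) →
      ∃ s ∈ F, ∃ C, 0 ≤ C ∧ ∀ t ∈ s, |y t| ≤ C := by
    intro l F h
    refine ⟨_, h.abs.eventually (gt_mem_nhds (lt_add_one _)), |l| + 1, by positivity, ?_⟩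
    intro t (ht : |y t| < |l| + 1)
    exact ht.le
  have := induction_left_right (p := fun s => ∃ C, 0 ≤ C ∧ ∀ t ∈ s, |y t| ≤ C)
    ⟨0, le_rfl, by simp⟩ (fun s t hst ⟨C, h0, hC⟩ => ⟨C, h0, fun u hu => hC u (hst hu)⟩)
    (fun s t ⟨C, h0, hC⟩ ⟨C', h0', hC'⟩ => ⟨max C C', h0.trans (le_max_left _ _), by
      rintro u (hu | hu)
      exacts [(hC u hu).trans (le_max_left _ _), (hC' u hu).trans (le_max_right _ _)]⟩)
    (fun t => key _ _ (hy.tendsto_leftLim t)) (fun t => key _ _ (hy.right_continuous t))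
  simpa using this

/-- A càdlàg function whose infimum is at most `c` has a value or a left limit at most `c`. -/
theorem IsCadlag.exists_le_of_forall_lt [Fact (0 ≤ T)] {y : Icc (0 : ℝ) T → ℝ} (hy : IsCadlag y)
    {c : ℝ} (h : ∀ ε > 0, ∃ t, y t < c + ε) :
    ∃ t, y t ≤ c ∨ (⊥ < t ∧ Function.leftLim y t ≤ c) := by
  by_contra! hcon
  have key : ∀ (l : ℝ) (F : Filter (Icc (0 : ℝ) T)), Tendsto y F (𝓝 l) → c < l →
      ∃ s ∈ F, ∃ ε > 0, ∀ t ∈ s, c + ε ≤ y t := by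
    intro l F h hl
    refine ⟨_, h.eventually (lt_mem_nhds (show c + (l - c) / 2 < l by linarith)),
      (l - c) / 2, by linarith, fun t ht => le_of_lt ht⟩
  obtain ⟨ε, hε, H⟩ := induction_left_right (p := fun s => ∃ ε > 0, ∀ t ∈ s, c + ε ≤ y t)
    ⟨1, one_pos, by simp⟩ (fun s t hst ⟨C, h0, hC⟩ => ⟨C, h0, fun u hu => hC u (hst hu)⟩)
    (fun s t ⟨C, h0, hC⟩ ⟨C', h0', hC'⟩ => ⟨min C C', lt_min h0 h0', by
      rintro u (hu | hu)
      · exact le_trans (by gcongr; exact min_le_left _ _) (hC u hu)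
      · exact le_trans (by gcongr; exact min_le_right _ _) (hC' u hu)⟩)
    (fun t => by
      rcases eq_or_lt_of_le (bot_le : ⊥ ≤ t) with rfl | ht
      -- Nothing lies to the left of `⊥`, so the empty set is a left neighbourhood there.
      · exact ⟨∅, by simp, 1, one_pos, by simp⟩
      · exact key _ _ (hy.tendsto_leftLim t) ((hcon t).2 ht))
    (fun t => key _ _ (hy.right_continuous t) (hcon t).1)
  obtain ⟨t, ht⟩ := h ε hε
  exact absurd (H t (mem_univ t)) (not_le.2 ht)

end

section

/-! ### The measure `dA` of an averaging path -/

variable {T : ℝ} [Fact (0 ≤ T)]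

/-- An averaging path as a Stieltjes function. -/
def AveragingPath.stieltjes (a : AveragingPath T) : StieltjesFunction (Icc (0 : ℝ) T) where
  toFun := a
  mono' := a.mono
  right_continuous' := a.cadlag.right_continuous

/-- The probability measure `dA` on `[0, T]`, with mass `A_0` at time `0`. -/
def AveragingPath.measure (a : AveragingPath T) : Measure (Icc (0 : ℝ) T) :=
  ENNReal.ofReal (a ⊥) • Measure.dirac ⊥ + a.stieltjes.measure

/-- The left limit at `⊥` is `a ⊥` itself, so the Stieltjes measure ignores the initial mass; this
is why `AveragingPath.measure` adds it as an atom. -/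
theorem AveragingPath.stieltjes_Iic (a : AveragingPath T) (t : Icc (0 : ℝ) T) :
    a.stieltjes.measure (Iic t) = ENNReal.ofReal (a t - a ⊥) := by
  rw [← Icc_bot, StieltjesFunction.measure_Icc, leftLim_eq_of_isBot isBot_bot]
  rfl

instance (a : AveragingPath T) : IsFiniteMeasure a.stieltjes.measure :=
  ⟨by rw [← Iic_top, a.stieltjes_Iic]; exact ENNReal.ofReal_lt_top⟩

theorem AveragingPath.measure_Iic (a : AveragingPath T) (t : Icc (0 : ℝ) T) :
    a.measure (Iic t) = ENNReal.ofReal (a t) := by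
  rw [AveragingPath.measure, Measure.add_apply, a.stieltjes_Iic, Measure.smul_apply,
    Measure.dirac_apply_of_mem (mem_Iic.2 bot_le), smul_eq_mul, mul_one,
    ← ENNReal.ofReal_add (a.nonneg _) (sub_nonneg.2 (a.mono bot_le))]
  congr 1
  ring

instance (a : AveragingPath T) : IsProbabilityMeasure a.measure :=
  ⟨by rw [← Iic_top, a.measure_Iic, a.top_eq_one, ENNReal.ofReal_one]⟩

theorem AveragingPath.boundedVariationOn (a : AveragingPath T) : BoundedVariationOn a univ := by
  have h := (a.mono.monotoneOn univ).eVariationOn_eq (mem_univ ⊥) (mem_univ ⊤)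
  have h2 : (univ ∩ Icc (⊥ : Icc (0 : ℝ) T) ⊤) = univ := by simp
  rw [h2] at h
  rw [BoundedVariationOn, h]
  exact ENNReal.ofReal_ne_top

/-- Both measures give `a t - a ⊥` to `Iic t`, and these sets form a generating π-system. Integrals
against `stieltjesMeasure` thereby become ordinary Lebesgue integrals. -/
theorem AveragingPath.stieltjesMeasure_eq (a : AveragingPath T) :
    stieltjesMeasure a = a.stieltjes.measure.toSignedMeasure := by
  rw [stieltjesMeasure, dif_pos a.boundedVariationOn]
  have hr : ∀ t, Function.rightLim a t = a t := a.stieltjes.rightLim_eq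
  have hIic : ∀ t : Icc (0 : ℝ) T, a.boundedVariationOn.vectorMeasure (Iic t) = a t - a ⊥ := by
    intro t
    rw [← Icc_bot, BoundedVariationOn.vectorMeasure_Icc _ bot_le, hr,
      leftLim_eq_of_isBot isBot_bot]
  have hIic' : ∀ t : Icc (0 : ℝ) T,
      a.stieltjes.measure.toSignedMeasure (Iic t) = a t - a ⊥ := by
    intro t
    rw [Measure.toSignedMeasure_apply_measurable measurableSet_Iic, measureReal_def,
      a.stieltjes_Iic, ENNReal.toReal_ofReal (sub_nonneg.2 (a.mono bot_le))]
  refine VectorMeasure.ext_of_generateFrom (range Iic) ?_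
    (borel_eq_generateFrom_Iic (Icc (0 : ℝ) T) ▸ BorelSpace.measurable_eq) isPiSystem_Iic ?_
  · rintro _ ⟨t, rfl⟩
    rw [hIic, hIic']
  · rw [← Iic_top, hIic, hIic']

theorem vectorMeasure_integral_toSignedMeasure {X : Type*} [MeasurableSpace X] (m : Measure X)
    [IsFiniteMeasure m] (g : X → ℝ) :
    ∫ᵛ x, g x ∂•m.toSignedMeasure = ∫ x, g x ∂m := by
  -- Real multiplication is symmetric, so the order of the two factors in the pairing is immaterial.
  have : (ContinuousLinearMap.lsmul ℝ ℝ : ℝ →L[ℝ] ℝ →L[ℝ] ℝ) =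
      (ContinuousLinearMap.lsmul ℝ ℝ : ℝ →L[ℝ] ℝ →L[ℝ] ℝ).flip := by
    ext
    simp
  rw [this]
  exact VectorMeasure.integral_toSignedMeasure

theorem AveragingPath.integrable_stieltjesMeasure (a : AveragingPath T)
    {g : Icc (0 : ℝ) T → ℝ} (hg : Integrable g a.measure) :
    (stieltjesMeasure a).Integrable g := by
  rw [a.stieltjesMeasure_eq, VectorMeasure.Integrable, Measure.variation_toSignedMeasure]
  exact hg.mono_measure (Measure.le_add_left le_rfl)

theorem AveragingPath.integral_stieltjesMeasure (a : AveragingPath T)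
    {g : Icc (0 : ℝ) T → ℝ} (hg : Integrable g a.measure) :
    a ⊥ * g ⊥ + ∫ᵛ t, g t ∂•(stieltjesMeasure a) = ∫ t, g t ∂a.measure := by
  rw [a.stieltjesMeasure_eq, vectorMeasure_integral_toSignedMeasure, AveragingPath.measure,
    integral_add_measure (hg.mono_measure (Measure.le_add_right le_rfl))
      (hg.mono_measure (Measure.le_add_left le_rfl)), integral_smul_measure, integral_dirac,
    ENNReal.toReal_ofReal (a.nonneg _), smul_eq_mul]

theorem average_eq (ω : CadlagPath T) (a : AveragingPath T) :
    average ω a = ∫ t, ω t ∂a.measure := by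
  obtain ⟨C, -, hC⟩ := ω.cadlag.exists_abs_le
  rw [← a.integral_stieltjesMeasure (Integrable.of_bound ω.cadlag.measurable.aestronglyMeasurable C
    (Eventually.of_forall hC)), average, mul_comm]

/-! ### Measurable dependence of `dA` on the path -/

/-- The mass given by `dA` to an event before time `s` is known at time `s`. -/
theorem AveragingProcess.measurable_measure_inter_Iic (A : AveragingProcess T)
    (s : Icc (0 : ℝ) T) {C : Set (Icc (0 : ℝ) T)} (hC : MeasurableSet C) :
    Measurable[pathFiltration T s] (fun ω => (A.path ω).measure (C ∩ Iic s)) := by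
  have key : ∀ t, Measurable[pathFiltration T s]
      (fun ω => ((A.path ω).measure.restrict (Iic s)) (Iic t)) := by
    intro t
    simp_rw [Measure.restrict_apply measurableSet_Iic, Iic_inter_Iic, AveragingPath.measure_Iic]
    exact ENNReal.measurable_ofReal.comp (A.adapted.measurable_le inf_le_right)
  have := @Measurable.measure_of_isPiSystem (CadlagPath T) (Icc (0 : ℝ) T) (pathFiltration T s) _
    (fun ω => (A.path ω).measure.restrict (Iic s)) _ (range Iic)
    (borel_eq_generateFrom_Iic (Icc (0 : ℝ) T) ▸ BorelSpace.measurable_eq) isPiSystem_Iic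
    (by rintro _ ⟨t, rfl⟩; exact key t) (by rw [← Iic_top]; exact key ⊤)
  have h2 := (Measure.measurable_coe hC).comp this
  have h3 : (fun ω => (A.path ω).measure (C ∩ Iic s)) =
      (fun m : Measure (Icc (0 : ℝ) T) => m C) ∘ fun ω => (A.path ω).measure.restrict (Iic s) :=
    funext fun ω => (Measure.restrict_apply hC).symm
  rwa [h3]

/-- `dA` as a Markov kernel. -/
def AveragingProcess.kernel (A : AveragingProcess T) : Kernel (CadlagPath T) (Icc (0 : ℝ) T) where
  toFun ω := (A.path ω).measure
  measurable' := by
    refine Measure.measurable_of_measurable_coe _ fun C hC => ?_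
    have := (A.measurable_measure_inter_Iic ⊤ hC).mono ((pathFiltration T).le ⊤) le_rfl
    simpa using this

theorem AveragingProcess.kernel_apply (A : AveragingProcess T) (ω : CadlagPath T) :
    A.kernel ω = (A.path ω).measure := rfl

instance (A : AveragingProcess T) : IsMarkovKernel A.kernel :=
  ⟨fun ω => by rw [A.kernel_apply]; infer_instance⟩

end

section

/-! ### The domain of an irreducible pair -/

theorem integrable_abs_sub {θ : Measure ℝ} [IsFiniteMeasure θ]
    (hθ : Integrable (fun x : ℝ => x) θ) (x : ℝ) : Integrable (fun y => |x - y|) θ :=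
  ((integrable_const x).sub hθ).abs

/-- The integrand is 1-Lipschitz in `x`, so the potential is Lipschitz with the total mass as
constant. -/
theorem continuous_potential {θ : Measure ℝ} [IsFiniteMeasure θ]
    (hθ : Integrable (fun x : ℝ => x) θ) : Continuous (potential θ) := by
  refine (LipschitzWith.of_dist_le_mul (K := (θ univ).toNNReal) fun x y => ?_).continuous
  rw [Real.dist_eq, Real.dist_eq, potential, potential,
    ← integral_sub (integrable_abs_sub hθ x) (integrable_abs_sub hθ y), ← Real.norm_eq_abs,
    mul_comm]
  refine norm_integral_le_of_norm_le_const (Eventually.of_forall fun z => ?_)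
  rw [Real.norm_eq_abs]
  refine (abs_abs_sub_abs_le _ _).trans (le_of_eq ?_)
  congr 1
  ring

variable {μ ν : Measure ℝ} [IsFiniteMeasure μ] [IsFiniteMeasure ν]

theorem IsIrreducible.isOpen_domI (h : IsIrreducible μ ν) : IsOpen (domI μ ν) :=
  isOpen_lt (continuous_potential h.convexOrder.1) (continuous_potential h.convexOrder.2.1)

theorem IsIrreducible.ordConnected_domI (h : IsIrreducible μ ν) : (domI μ ν).OrdConnected :=
  h.preconnected.ordConnected

/-- An affine function and its negative are both convex. -/
theorem ConvexOrder.integral_affine (h : ConvexOrder μ ν) (a b : ℝ) :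
    ∫ x, (a * x + b) ∂μ = ∫ x, (a * x + b) ∂ν := by
  have key : ∀ a b : ℝ, ∫ x, (a * x + b) ∂μ ≤ ∫ x, (a * x + b) ∂ν := fun a b =>
    (h.2.2 (fun x => a * x + b)
      ((((LinearMap.mulLeft ℝ a).convexOn convex_univ).add_const b))
      ((h.2.1.const_mul a).add (integrable_const b))).2
  refine le_antisymm (key a b) ?_
  have h2 := key (-a) (-b)
  have e : ∀ θ : Measure ℝ, ∫ x, (-a * x + -b) ∂θ = -∫ x, (a * x + b) ∂θ := fun θ => by
    rw [← integral_neg]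
    congr 1
    ext x
    ring
  rw [e, e] at h2
  linarith

theorem ConvexOrder.measure_univ_eq (h : ConvexOrder μ ν) : μ univ = ν univ := by
  have := h.integral_affine 0 1
  simp only [zero_mul, zero_add, integral_const, smul_eq_mul, mul_one] at this
  exact (measureReal_eq_measureReal_iff).1 this

theorem IsIrreducible.ae_mem_domI (h : IsIrreducible μ ν) : ∀ᵐ x ∂μ, x ∈ domI μ ν := by
  have := measure_compl h.isOpen_domI.measurableSet (measure_ne_top μ _)
  rw [h.concentrated, tsub_self] at this
  exact this

theorem IsIrreducible.measure_univ_ne_zero (h : IsIrreducible μ ν) (hI : (domI μ ν).Nonempty) :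
    μ univ ≠ 0 := by
  intro h0
  have hν := h.convexOrder.measure_univ_eq ▸ h0
  rw [Measure.measure_univ_eq_zero] at h0 hν
  obtain ⟨x, hx⟩ := hI
  simp [domI, potential, h0, hν] at hx

theorem IsIrreducible.notMem_of_upperBound (h : IsIrreducible μ ν) {r : ℝ}
    (hr : r ∈ upperBounds (domI μ ν)) : r ∉ domI μ ν := by
  intro hmem
  obtain ⟨x, hx, hrx⟩ := Filter.nonempty_of_mem (inter_mem
    (nhdsWithin_le_nhds (h.isOpen_domI.mem_nhds hmem)) (self_mem_nhdsWithin (s := Ioi r)))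
  exact absurd (hr hx) (not_le.2 hrx)

theorem IsIrreducible.notMem_of_lowerBound (h : IsIrreducible μ ν) {r : ℝ}
    (hr : r ∈ lowerBounds (domI μ ν)) : r ∉ domI μ ν := by
  intro hmem
  obtain ⟨x, hx, hrx⟩ := Filter.nonempty_of_mem (inter_mem
    (nhdsWithin_le_nhds (h.isOpen_domI.mem_nhds hmem)) (self_mem_nhdsWithin (s := Iio r)))
  exact absurd (hr hx) (not_le.2 hrx)

/-- Outside `I` the potentials agree, so an affine minorant of `|r - x|` that is exact on `I` is
exact `ν`-almost everywhere. -/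
theorem IsIrreducible.ae_abs_sub_eq (h : IsIrreducible μ ν) {r a b : ℝ} (hr : r ∉ domI μ ν)
    (hle : ∀ x, a * x + b ≤ |r - x|) (heq : ∀ x ∈ domI μ ν, |r - x| = a * x + b) :
    ∀ᵐ x ∂ν, |r - x| = a * x + b := by
  have h1 : potential ν r ≤ potential μ r := not_lt.1 hr
  have h2 : potential μ r = ∫ x, (a * x + b) ∂μ :=
    integral_congr_ae (h.ae_mem_domI.mono heq)
  rw [h2, h.convexOrder.integral_affine] at h1
  have hi : Integrable (fun x => a * x + b) ν :=
    (h.convexOrder.2.1.const_mul a).add (integrable_const b)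
  have hj := integrable_abs_sub h.convexOrder.2.1 r
  have h0 : 0 ≤ fun x => |r - x| - (a * x + b) := fun x => sub_nonneg.2 (hle x)
  have h3 : ∫ x, (|r - x| - (a * x + b)) ∂ν = 0 := by
    refine le_antisymm ?_ (integral_nonneg h0)
    rw [integral_sub hj hi]
    exact sub_nonpos.2 h1
  filter_upwards [(integral_eq_zero_iff_of_nonneg h0 (hj.sub hi)).1 h3] with x hx
  exact sub_eq_zero.1 hx

/-- To the left of `r` the function `|r - x|` is the affine function `r - x`; its exactness `ν`-a.e.
says that no mass lies beyond `r`. -/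
theorem IsIrreducible.ae_le_of_upperBound (h : IsIrreducible μ ν) {r : ℝ}
    (hr : r ∈ upperBounds (domI μ ν)) : ∀ᵐ x ∂ν, x ≤ r := by
  filter_upwards [h.ae_abs_sub_eq (a := -1) (b := r) (h.notMem_of_upperBound hr)
    (fun x => by linarith [le_abs_self (r - x)])
    (fun x hx => by rw [abs_of_nonneg (sub_nonneg.2 (hr hx))]; ring)] with x hx
  linarith [abs_nonneg (r - x)]

theorem IsIrreducible.ae_ge_of_lowerBound (h : IsIrreducible μ ν) {r : ℝ}
    (hr : r ∈ lowerBounds (domI μ ν)) : ∀ᵐ x ∂ν, r ≤ x := by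
  filter_upwards [h.ae_abs_sub_eq (a := 1) (b := -r) (h.notMem_of_lowerBound hr)
    (fun x => by linarith [neg_abs_le (r - x)])
    (fun x hx => by rw [abs_of_nonpos (sub_nonpos.2 (hr hx))]; ring)] with x hx
  linarith [abs_nonneg (r - x)]

theorem upperBound_or_lowerBound_of_notMem {I : Set ℝ} (hI : I.OrdConnected) {x : ℝ} (hx : x ∉ I) :
    x ∈ upperBounds I ∨ x ∈ lowerBounds I := by
  by_contra! h
  simp only [mem_upperBounds, mem_lowerBounds, not_forall, not_le] at h
  obtain ⟨⟨b, hb, hxb⟩, ⟨a, ha, hax⟩⟩ := h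
  exact hx (hI.out ha hb ⟨hax.le, hxb.le⟩)

/-- The endpoints of a set of reals. -/
def endpoints (I : Set ℝ) : Set ℝ := {x | IsLUB I x ∨ IsGLB I x}

theorem finite_endpoints (I : Set ℝ) : (endpoints I).Finite :=
  (show {x | IsLUB I x}.Subsingleton from fun _ hx _ hy => hx.unique hy).finite.union
    (show {x | IsGLB I x}.Subsingleton from fun _ hx _ hy => hx.unique hy).finite

theorem mem_endpoints_of_mem_closure {I : Set ℝ} (hI : I.OrdConnected) {x : ℝ} (hx : x ∈ closure I)
    (hx' : x ∉ I) : x ∈ endpoints I := by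
  rcases upperBound_or_lowerBound_of_notMem hI hx' with h | h
  · exact Or.inl (isLUB_of_mem_closure h hx)
  · exact Or.inr (isGLB_of_mem_closure h hx)

theorem Ioo_subset_of_mem_closure {I : Set ℝ} (hI : I.OrdConnected) {a b : ℝ} (ha : a ∈ closure I)
    (hb : b ∈ closure I) : Ioo a b ⊆ I := by
  intro x hx
  obtain ⟨a', ha', h1⟩ := mem_closure_iff_nhds.1 ha (Iio x) (Iio_mem_nhds hx.1)
  obtain ⟨b', hb', h2⟩ := mem_closure_iff_nhds.1 hb (Ioi x) (Ioi_mem_nhds hx.2)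
  exact hI.out h1 h2 ⟨le_of_lt ha', le_of_lt hb'⟩

theorem domI_subset_domJ : domI μ ν ⊆ domJ μ ν := subset_union_left

theorem domJ_subset_closure : domJ μ ν ⊆ closure (domI μ ν) :=
  union_subset subset_closure fun _ hx => frontier_subset_closure hx.1

theorem IsIrreducible.mem_endpoints_of_mem_domJ (h : IsIrreducible μ ν) {x : ℝ}
    (hx : x ∈ domJ μ ν) (hx' : x ∉ domI μ ν) : x ∈ endpoints (domI μ ν) :=
  mem_endpoints_of_mem_closure h.ordConnected_domI (domJ_subset_closure hx) hx'

theorem IsIrreducible.finite_domJ_diff (h : IsIrreducible μ ν) : (domJ μ ν \ domI μ ν).Finite :=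
  (finite_endpoints _).subset fun _ hx => h.mem_endpoints_of_mem_domJ hx.1 hx.2

theorem IsIrreducible.measurableSet_domJ (h : IsIrreducible μ ν) : MeasurableSet (domJ μ ν) := by
  rw [← union_sdiff_cancel (domI_subset_domJ (μ := μ) (ν := ν))]
  exact h.isOpen_domI.measurableSet.union h.finite_domJ_diff.measurableSet

theorem IsIrreducible.ordConnected_domJ (h : IsIrreducible μ ν) : (domJ μ ν).OrdConnected := by
  refine ⟨fun a ha b hb x hx => ?_⟩
  rcases hx.1.eq_or_lt with rfl | h1
  · exact ha
  rcases hx.2.eq_or_lt with rfl | h2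
  · exact hb
  exact domI_subset_domJ (Ioo_subset_of_mem_closure h.ordConnected_domI (domJ_subset_closure ha)
    (domJ_subset_closure hb) ⟨h1, h2⟩)

theorem IsIrreducible.mem_domJ_of_endpoint (h : IsIrreducible μ ν) (hI : (domI μ ν).Nonempty)
    {x : ℝ} (hx : x ∈ endpoints (domI μ ν)) (hν : ν {x} ≠ 0) : x ∈ domJ μ ν := by
  refine Or.inr ⟨?_, hν⟩
  rw [frontier, h.isOpen_domI.interior_eq]
  rcases hx with hx | hx
  · exact ⟨hx.mem_closure hI, h.notMem_of_upperBound hx.1⟩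
  · exact ⟨hx.mem_closure hI, h.notMem_of_lowerBound hx.1⟩

theorem measure_singleton_ne_zero_of_mem_domJ {x : ℝ}
    (hx : x ∈ domJ μ ν) (hx' : x ∉ domI μ ν) : ν {x} ≠ 0 := by
  rcases hx with hx | hx
  · exact absurd hx hx'
  · exact hx.2

/-- `J` lies between `I` and its closure, so an endpoint of `I` is a boundary point of `J` whether
or not it belongs to `J`. -/
theorem mem_frontier_domJ (hI : (domI μ ν).Nonempty) {x : ℝ}
    (hx : x ∈ endpoints (domI μ ν)) : x ∈ frontier (domJ μ ν) := by
  rcases hx with hx | hx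
  · refine ⟨closure_mono domI_subset_domJ (hx.mem_closure hI), fun hi => ?_⟩
    have h1 : domJ μ ν ⊆ Iic x := fun y hy =>
      closure_minimal (fun z hz => hx.1 hz) isClosed_Iic (domJ_subset_closure hy)
    have := interior_mono h1 hi
    rw [interior_Iic] at this
    exact lt_irrefl x this
  · refine ⟨closure_mono domI_subset_domJ (hx.mem_closure hI), fun hi => ?_⟩
    have h1 : domJ μ ν ⊆ Ici x := fun y hy =>
      closure_minimal (fun z hz => hx.1 hz) isClosed_Ici (domJ_subset_closure hy)
    have := interior_mono h1 hi
    rw [interior_Ici] at this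
    exact lt_irrefl x this

theorem IsIrreducible.mem_endpoints_of_mem_frontier (h : IsIrreducible μ ν) {x : ℝ}
    (hx : x ∈ frontier (domJ μ ν)) : x ∈ endpoints (domI μ ν) := by
  refine mem_endpoints_of_mem_closure h.ordConnected_domI
    (closure_minimal domJ_subset_closure isClosed_closure hx.1) fun hI => hx.2 ?_
  exact interior_mono domI_subset_domJ (h.isOpen_domI.interior_eq.symm ▸ hI)

/-- If `x` lies between the endpoints of `I`, and is not an endpoint unless it is an atom of `ν`,
then `x ∈ J`. -/
theorem IsIrreducible.mem_domJ_of_bounds (h : IsIrreducible μ ν) (hI : (domI μ ν).Nonempty) {x : ℝ}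
    (hu : ∀ r, IsLUB (domI μ ν) r → x ≤ r) (hl : ∀ r, IsGLB (domI μ ν) r → r ≤ x)
    (he : x ∈ endpoints (domI μ ν) → ν {x} ≠ 0) : x ∈ domJ μ ν := by
  by_cases hx : x ∈ domI μ ν
  · exact domI_subset_domJ hx
  have : x ∈ endpoints (domI μ ν) := by
    rcases upperBound_or_lowerBound_of_notMem h.ordConnected_domI hx with h' | h'
    · have := isLUB_csSup hI ⟨x, h'⟩
      rw [← le_antisymm (hu _ this) (this.2 h')] at this
      exact Or.inl this
    · have := isGLB_csInf hI ⟨x, h'⟩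
      rw [le_antisymm (hl _ this) (this.2 h')] at this
      exact Or.inr this
  exact h.mem_domJ_of_endpoint hI this (he this)

/-- There are at most two endpoints, so the non-atomic ones together form a null set. -/
theorem ae_atom_of_mem_endpoints :
    ∀ᵐ x ∂ν, x ∈ endpoints (domI μ ν) → ν {x} ≠ 0 := by
  have : ∀ᵐ x ∂ν, ∀ r ∈ endpoints (domI μ ν), ν {r} = 0 → x ≠ r := by
    rw [ae_ball_iff (finite_endpoints _).countable]
    intro r _
    by_cases h0 : ν {r} = 0
    · have : ∀ᵐ x ∂ν, x ≠ r := by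
        rw [ae_iff]
        simpa using h0
      filter_upwards [this] with x hx _ using hx
    · exact Eventually.of_forall fun x hx => absurd hx h0
  filter_upwards [this] with x hx hxe h0
  exact hx x hxe h0 rfl

/-- Equality of the potentials at the finite endpoints confines `ν` to the closed interval between
them; what is missing from `J` is then a set of non-atomic endpoints. -/
theorem IsIrreducible.ae_mem_domJ (h : IsIrreducible μ ν) : ∀ᵐ x ∂ν, x ∈ domJ μ ν := by
  -- If `I` is empty, then `μ` has no mass and hence neither has `ν`.
  rcases (domI μ ν).eq_empty_or_nonempty with hI | hI
  · have h1 := h.concentrated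
    rw [hI, measure_empty, h.convexOrder.measure_univ_eq] at h1
    rw [Measure.measure_univ_eq_zero.1 h1.symm]
    simp
  have hu : ∀ᵐ x ∂ν, ∀ r ∈ endpoints (domI μ ν), IsLUB (domI μ ν) r → x ≤ r := by
    rw [ae_ball_iff (finite_endpoints _).countable]
    intro r _
    by_cases hr : IsLUB (domI μ ν) r
    · filter_upwards [h.ae_le_of_upperBound hr.1] with x hx _ using hx
    · exact Eventually.of_forall fun x hx => absurd hx hr
  have hl : ∀ᵐ x ∂ν, ∀ r ∈ endpoints (domI μ ν), IsGLB (domI μ ν) r → r ≤ x := by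
    rw [ae_ball_iff (finite_endpoints _).countable]
    intro r _
    by_cases hr : IsGLB (domI μ ν) r
    · filter_upwards [h.ae_ge_of_lowerBound hr.1] with x hx _ using hx
    · exact Eventually.of_forall fun x hx => absurd hx hr
  filter_upwards [hu, hl, ae_atom_of_mem_endpoints (μ := μ) (ν := ν)] with x h1 h2 h3
  exact h.mem_domJ_of_bounds hI (fun r hr => h1 r (Or.inl hr) hr) (fun r hr => h2 r (Or.inr hr) hr)
    h3

theorem IsIrreducible.restrict_domJ_left (h : IsIrreducible μ ν) : μ.restrict (domJ μ ν) = μ :=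
  Measure.restrict_eq_self_of_ae_mem (h.ae_mem_domI.mono fun _ hx => domI_subset_domJ hx)

theorem IsIrreducible.restrict_domJ_right (h : IsIrreducible μ ν) : ν.restrict (domJ μ ν) = ν :=
  Measure.restrict_eq_self_of_ae_mem h.ae_mem_domJ

end

section

/-! ### Dual pairs are finite on `J` -/

section DualPair

variable {μ ν : Measure ℝ} [IsFiniteMeasure μ] [IsFiniteMeasure ν]
  {f φ ψ : ℝ → EReal} {φ' ψ' : ℝ → ℝ}

/-- The moderator makes `φ` finite at some point `x₀` of `I`, and the supporting line at `x₀` bounds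
`φ` above on all of `J`. The value `⊥` is impossible because `φ + ψ ≥ 0` and `⊥` absorbs in sums. -/
theorem IsAuxDualFeasible.finite_left (h : IsIrreducible μ ν) (hI : (domI μ ν).Nonempty)
    (hf : ∀ x, 0 ≤ f x) (hd : IsAuxDualFeasible μ ν f φ ψ)
    (hφ' : IsSuperderivative (domI μ ν) (domJ μ ν) φ φ') {x : ℝ} (hx : x ∈ domJ μ ν) :
    φ x ≠ ⊤ ∧ φ x ≠ ⊥ := by
  obtain ⟨χ, hχ, -⟩ := hd.mem_Lc.exists_moderator
  have h1 : ∀ᵐ x ∂μ.restrict (domJ μ ν), φ x - (χ x : EReal) ≠ ⊤ ∧ φ x - (χ x : EReal) ≠ ⊥ :=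
    hχ.left.1
  rw [h.restrict_domJ_left] at h1
  have : (ae μ).NeBot := ae_neBot.2 fun h0 =>
    h.measure_univ_ne_zero hI (Measure.measure_univ_eq_zero.2 h0)
  obtain ⟨x₀, hx₀, hx₀I⟩ := (h1.and h.ae_mem_domI).exists
  have h2 : φ x₀ ≠ ⊤ := by
    intro h0
    rw [h0] at hx₀
    exact hx₀.1 (EReal.top_sub_coe _)
  refine ⟨fun h0 => ?_, fun h0 => ?_⟩
  · have := hφ'.le x₀ hx₀I x hx
    rw [h0, top_le_iff] at this
    exact EReal.add_ne_top h2 (EReal.coe_ne_top _) this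
  · have := (hf x).trans (hd.le x hx)
    rw [h0, EReal.bot_add] at this
    exact absurd this (by simp)

/-- An infinite value at a point of `I` would spread to all of `J` through the subgradient
inequality at that point, contradicting finiteness `ν`-a.e. A point of `J \ I` is an atom of `ν`,
where an a.e. statement holds outright. -/
theorem IsAuxDualFeasible.finite_right (h : IsIrreducible μ ν) (hI : (domI μ ν).Nonempty)
    (hf : ∀ x, 0 ≤ f x) (hd : IsAuxDualFeasible μ ν f φ ψ)
    (hψ' : IsSubderivative (domI μ ν) (domJ μ ν) ψ ψ') {x : ℝ} (hx : x ∈ domJ μ ν) :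
    ψ x ≠ ⊤ ∧ ψ x ≠ ⊥ := by
  obtain ⟨χ, hχ, -⟩ := hd.mem_Lc.exists_moderator
  have h1 : ∀ᵐ x ∂ν.restrict (domJ μ ν), ψ x + (χ x : EReal) ≠ ⊤ ∧ ψ x + (χ x : EReal) ≠ ⊥ :=
    hχ.right.1
  rw [h.restrict_domJ_right] at h1
  have hbot : ψ x ≠ ⊥ := fun h0 => by
    have := (hf x).trans (hd.le x hx)
    rw [h0, EReal.add_bot] at this
    exact absurd this (by simp)
  refine ⟨fun h0 => ?_, hbot⟩
  by_cases hxI : x ∈ domI μ ν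
  · have : (ae ν).NeBot := ae_neBot.2 fun h0 =>
      h.measure_univ_ne_zero hI (h.convexOrder.measure_univ_eq.trans
        (Measure.measure_univ_eq_zero.2 h0))
    obtain ⟨x₀, hx₀, hx₀J⟩ := (h1.and h.ae_mem_domJ).exists
    have h2 : ψ x₀ = ⊤ := by
      have := hψ'.le x hxI x₀ hx₀J
      rw [h0, EReal.top_add_coe, top_le_iff] at this
      exact this
    rw [h2] at hx₀
    exact hx₀.1 (EReal.top_add_coe _)
  · have h3 := measure_singleton_ne_zero_of_mem_domJ hx hxI
    have h4 : ∃ᶠ y in ae ν, y = x :=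
      fun h5 => h3 (by simpa [ae_iff] using h5)
    obtain ⟨y, rfl, hy⟩ := (h4.and_eventually h1).exists
    rw [h0] at hy
    exact hy.1 (EReal.top_add_coe _)

end DualPair

/-! ### Relevant paths -/

section Paths

variable {T : ℝ} [Fact (0 ≤ T)] {μ ν : Measure ℝ} [IsFiniteMeasure μ] [IsFiniteMeasure ν]
  {ω : CadlagPath T}

theorem mem_domJ_of_mem_relevantPaths (hω : ω ∈ relevantPaths (T := T) μ ν) (t : Icc (0 : ℝ) T) :
    ω t ∈ domJ μ ν := by
  rcases eq_or_lt_of_le (bot_le : ⊥ ≤ t) with rfl | ht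
  · exact domI_subset_domJ hω.1
  · exact hω.2.1 t ht

theorem eq_of_mem_relevantPaths (h : IsIrreducible μ ν) (hω : ω ∈ relevantPaths (T := T) μ ν)
    {t : Icc (0 : ℝ) T} (ht : ω t ∉ domI μ ν) : ω ⊤ = ω t :=
  hω.2.2.2 t (mem_frontier_domJ ⟨_, hω.1⟩ (h.mem_endpoints_of_mem_domJ
    (mem_domJ_of_mem_relevantPaths hω t) ht)) ⊤ le_top

/-- A relevant path stays above some point of `I`, unless it is captured at the left endpoint. -/
theorem exists_le_of_mem_relevantPaths (hω : ω ∈ relevantPaths (T := T) μ ν) :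
    (∃ x ∈ domI μ ν, ∀ t, x ≤ ω t) ∨ ω ⊤ ∈ lowerBounds (domI μ ν) := by
  refine or_iff_not_imp_left.2 fun hcon => ?_
  push Not at hcon
  have hI : (domI μ ν).Nonempty := ⟨_, hω.1⟩
  obtain ⟨C, -, hC⟩ := ω.cadlag.exists_abs_le
  have hbdd : BddBelow (domI μ ν) := ⟨-C, fun x hx => by
    obtain ⟨t, ht⟩ := hcon x hx
    linarith [(abs_le.1 (hC t)).1]⟩
  have hl := isGLB_csInf hI hbdd
  set l := sInf (domI μ ν)
  have hge : ∀ t, l ≤ ω t := fun t => closure_minimal (fun z hz => hl.1 hz) isClosed_Ici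
    (domJ_subset_closure (mem_domJ_of_mem_relevantPaths hω t))
  have hfr := mem_frontier_domJ hI (Or.inr hl)
  have key : ω ⊤ = l := by
    -- The path comes arbitrarily close to the left endpoint `l`, so `l` is a value or a left limit
    -- of the path; in either case the path is captured there.
    obtain ⟨t, ht | ⟨ht0, ht⟩⟩ := ω.cadlag.exists_le_of_forall_lt (c := l) fun ε hε => by
      obtain ⟨x, hx, hxl⟩ := (isGLB_lt_iff hl).1 (show l < l + ε by linarith)
      obtain ⟨t, ht⟩ := hcon x hx
      exact ⟨t, ht.trans hxl⟩
    · have := le_antisymm ht (hge t)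
      rw [← this]
      exact hω.2.2.2 t (this ▸ hfr) ⊤ le_top
    · have : (𝓝[<] t).NeBot := nhdsLT_neBot_of_exists_lt ⟨⊥, ht0⟩
      have := le_antisymm ht (ge_of_tendsto' (ω.cadlag.tendsto_leftLim t) hge)
      rw [← this]
      exact hω.2.2.1 t ht0 (this ▸ hfr) ⊤ le_top
  exact key ▸ hl.1

/-- A relevant path stays below some point of `I`, unless it is captured at the right endpoint. -/
theorem exists_ge_of_mem_relevantPaths (hω : ω ∈ relevantPaths (T := T) μ ν) :
    (∃ x ∈ domI μ ν, ∀ t, ω t ≤ x) ∨ ω ⊤ ∈ upperBounds (domI μ ν) := by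
  refine or_iff_not_imp_left.2 fun hcon => ?_
  push Not at hcon
  have hI : (domI μ ν).Nonempty := ⟨_, hω.1⟩
  obtain ⟨C, -, hC⟩ := ω.cadlag.exists_abs_le
  have hbdd : BddAbove (domI μ ν) := ⟨C, fun x hx => by
    obtain ⟨t, ht⟩ := hcon x hx
    linarith [(abs_le.1 (hC t)).2]⟩
  have hl := isLUB_csSup hI hbdd
  set l := sSup (domI μ ν)
  have hge : ∀ t, ω t ≤ l := fun t => closure_minimal (fun z hz => hl.1 hz) isClosed_Iic
    (domJ_subset_closure (mem_domJ_of_mem_relevantPaths hω t))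
  have hfr := mem_frontier_domJ hI (Or.inl hl)
  have key : ω ⊤ = l := by
    -- The criterion for infima is applied to the reflected path.
    obtain ⟨t, ht | ⟨ht0, ht⟩⟩ := ω.cadlag.neg.exists_le_of_forall_lt (c := -l) fun ε hε => by
      obtain ⟨x, hx, hxl⟩ := (lt_isLUB_iff hl).1 (show l - ε < l by linarith)
      obtain ⟨t, ht⟩ := hcon x hx
      exact ⟨t, by linarith⟩
    · have := le_antisymm (hge t) (neg_le_neg_iff.1 ht)
      rw [← this]
      exact hω.2.2.2 t (this ▸ hfr) ⊤ le_top
    · have : (𝓝[<] t).NeBot := nhdsLT_neBot_of_exists_lt ⟨⊥, ht0⟩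
      rw [ω.cadlag.leftLim_neg] at ht
      have := le_antisymm (le_of_tendsto' (ω.cadlag.tendsto_leftLim t) hge) (neg_le_neg_iff.1 ht)
      rw [← this]
      exact hω.2.2.1 t ht0 (this ▸ hfr) ⊤ le_top
  exact key ▸ hl.1

variable {p q φ' ψ' : ℝ → ℝ}

/-- Adding the subgradient inequalities at two points gives `(ψ' y - ψ' x)(y - x) ≥ 0`. -/
theorem monotoneOn_of_subgradient {I : Set ℝ}
    (hsub : ∀ x₀ ∈ I, ∀ x ∈ I, q x₀ + ψ' x₀ * (x - x₀) ≤ q x) : MonotoneOn ψ' I := by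
  intro x hx y hy hxy
  rcases hxy.eq_or_lt with rfl | hlt
  · exact le_rfl
  · have h1 := hsub x hx y hy
    have h2 := hsub y hy x hx
    by_contra! hcon
    nlinarith

/-- Inside `I` this is the subgradient inequality at `ω t`, evaluated at `ω ⊤`. Outside `I` the path
has been captured, so `ω ⊤ = ω t` and the value assigned to `ψ'` there does not matter. -/
theorem le_sub_indicator_mul (h : IsIrreducible μ ν) (hω : ω ∈ relevantPaths (T := T) μ ν)
    (hsub : ∀ x₀ ∈ domI μ ν, ∀ x ∈ domJ μ ν, q x₀ + ψ' x₀ * (x - x₀) ≤ q x)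
    (t : Icc (0 : ℝ) T) :
    q (ω t) ≤ q (ω ⊤) - (domI μ ν).indicator ψ' (ω t) * (ω ⊤ - ω t) := by
  by_cases ht : ω t ∈ domI μ ν
  · rw [indicator_of_mem ht]
    linarith [hsub _ ht _ (mem_domJ_of_mem_relevantPaths hω ⊤)]
  · rw [indicator_of_notMem ht, eq_of_mem_relevantPaths h hω ht]
    simp

/-- Along a relevant path, `ψ'(X_t) (X_T - X_t)` is bounded. -/
theorem exists_abs_indicator_mul_le (h : IsIrreducible μ ν)
    (hω : ω ∈ relevantPaths (T := T) μ ν)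
    (hsub : ∀ x₀ ∈ domI μ ν, ∀ x ∈ domJ μ ν, q x₀ + ψ' x₀ * (x - x₀) ≤ q x) :
    ∃ C, ∀ t, |(domI μ ν).indicator ψ' (ω t) * (ω ⊤ - ω t)| ≤ C := by
  obtain ⟨C, hC0, hC⟩ := ω.cadlag.exists_abs_le
  have hdist : ∀ s t, |ω s - ω t| ≤ 2 * C := fun s t => by
    refine (abs_sub _ _).trans ?_
    linarith [hC s, hC t]
  have hmono : MonotoneOn ψ' (domI μ ν) :=
    monotoneOn_of_subgradient fun x₀ h₀ x hx => hsub x₀ h₀ x (domI_subset_domJ hx)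
  -- The product is at most `q (ω ⊤) - q (ω t)`, and `q (ω t)` is bounded below by the supporting
  -- line at `ω ⊥`.
  have hupper : ∀ t, (domI μ ν).indicator ψ' (ω t) * (ω ⊤ - ω t) ≤
      q (ω ⊤) - q (ω ⊥) + |ψ' (ω ⊥)| * (2 * C) := by
    intro t
    have h1 := le_sub_indicator_mul h hω hsub t
    have h2 := hsub _ hω.1 _ (mem_domJ_of_mem_relevantPaths hω t)
    have h3 : -(ψ' (ω ⊥) * (ω t - ω ⊥)) ≤ |ψ' (ω ⊥)| * (2 * C) := by
      refine (neg_le_abs _).trans ?_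
      rw [abs_mul]
      exact mul_le_mul_of_nonneg_left (hdist _ _) (abs_nonneg _)
    linarith
  have hlower : ∃ D, 0 ≤ D ∧ ∀ t, -D ≤ (domI μ ν).indicator ψ' (ω t) * (ω ⊤ - ω t) := by
    -- When `ω t < ω ⊤`, only very negative slopes are harmful. Monotonicity of `ψ'` excludes them
    -- if the path stays above a point of `I`; if the path ends at the left endpoint, the case does
    -- not arise.
    have h1 : ∃ D, 0 ≤ D ∧ ∀ t, ω t ∈ domI μ ν → ω t < ω ⊤ → -D ≤ ψ' (ω t) * (ω ⊤ - ω t) := by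
      rcases exists_le_of_mem_relevantPaths hω with ⟨x, hx, hxt⟩ | hlow
      · refine ⟨|ψ' x| * (2 * C), by positivity, fun t ht hlt => ?_⟩
        have h2 : ψ' x * (ω ⊤ - ω t) ≤ ψ' (ω t) * (ω ⊤ - ω t) :=
          mul_le_mul_of_nonneg_right (hmono hx ht (hxt t)) (by linarith)
        have h3 : |ψ' x * (ω ⊤ - ω t)| ≤ |ψ' x| * (2 * C) := by
          rw [abs_mul]
          exact mul_le_mul_of_nonneg_left (hdist _ _) (abs_nonneg _)
        linarith [(abs_le.1 h3).1]
      · exact ⟨0, le_rfl, fun t ht hlt => absurd (hlow ht) (not_le.2 hlt)⟩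
    have h2 : ∃ D, 0 ≤ D ∧ ∀ t, ω t ∈ domI μ ν → ω ⊤ < ω t → -D ≤ ψ' (ω t) * (ω ⊤ - ω t) := by
      rcases exists_ge_of_mem_relevantPaths hω with ⟨x, hx, hxt⟩ | hup
      · refine ⟨|ψ' x| * (2 * C), by positivity, fun t ht hlt => ?_⟩
        have h2 : ψ' x * (ω ⊤ - ω t) ≤ ψ' (ω t) * (ω ⊤ - ω t) :=
          mul_le_mul_of_nonpos_right (hmono ht hx (hxt t)) (by linarith)
        have h3 : |ψ' x * (ω ⊤ - ω t)| ≤ |ψ' x| * (2 * C) := by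
          rw [abs_mul]
          exact mul_le_mul_of_nonneg_left (hdist _ _) (abs_nonneg _)
        linarith [(abs_le.1 h3).1]
      · exact ⟨0, le_rfl, fun t ht hlt => absurd (hup ht) (not_le.2 hlt)⟩
    obtain ⟨D, hD0, hD⟩ := h1
    obtain ⟨E, hE0, hE⟩ := h2
    refine ⟨max D E, le_max_of_le_left hD0, fun t => ?_⟩
    by_cases ht : ω t ∈ domI μ ν
    · rw [indicator_of_mem ht]
      rcases lt_trichotomy (ω t) (ω ⊤) with h3 | h3 | h3
      · exact (neg_le_neg (le_max_left _ _)).trans (hD t ht h3)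
      · rw [h3]
        simp [hD0]
      · exact (neg_le_neg (le_max_right _ _)).trans (hE t ht h3)
    · rw [indicator_of_notMem ht, zero_mul]
      simp [hD0]
  obtain ⟨D, hD0, hD⟩ := hlower
  refine ⟨max D (q (ω ⊤) - q (ω ⊥) + |ψ' (ω ⊥)| * (2 * C)), fun t => abs_le.2 ⟨?_, ?_⟩⟩
  · exact (neg_le_neg (le_max_left _ _)).trans (hD t)
  · exact (hupper t).trans (le_max_right _ _)

end Paths

end

section

/-! ### The dynamic part of the strategy -/

variable {T : ℝ} [Fact (0 ≤ T)] {φ' ψ' : ℝ → ℝ} {I : Set ℝ}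

theorem measurable_indicator_of_domRestrict {β : Type*} [MeasurableSpace β] [Zero β] {g : ℝ → β}
    (hI : MeasurableSet I) (hg : Measurable (I.domRestrict g)) : Measurable (I.indicator g) := by
  refine measurable_of_restrict_of_restrict_compl hI ?_ ?_
  · convert hg using 1
    ext x
    exact indicator_of_mem x.2 g
  · have : Iᶜ.domRestrict (I.indicator g) = fun _ => 0 := by
      ext x
      exact indicator_of_notMem x.2 g
    rw [this]
    exact measurable_const

/-- Stated for a general map `F` so that it yields adaptedness both on the enlarged space and after
inserting an averaging process. -/
theorem measurable_dynamicPart_comp {α : Type*} [MeasurableSpace α]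
    (hφ : Measurable (I.indicator φ')) (hψ : Measurable (I.indicator ψ')) {t : Icc (0 : ℝ) T}
    {F : α → HatPath T} (h0 : Measurable fun x => (F x).1 ⊥) (ht : Measurable fun x => (F x).1 t)
    (hA : Measurable fun x => (F x).2 ⊥) : Measurable fun x => dynamicPart I φ' ψ' t (F x) := by
  unfold dynamicPart
  split_ifs
  · exact ((hφ.comp h0).mul (measurable_const.sub hA)).sub ((hψ.comp h0).mul hA)
  · exact (hφ.comp h0).neg.sub (hψ.comp ht)

theorem measurable_hatFiltration_fst {s t : Icc (0 : ℝ) T} (hst : s ≤ t) :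
    Measurable[hatFiltration T t] (fun x : HatPath T => x.1 s) :=
  measurable_iff_comap_le.2 (le_trans le_sup_left (le_iSup₂_of_le s hst le_rfl))

theorem measurable_hatFiltration_snd {s t : Icc (0 : ℝ) T} (hst : s ≤ t) :
    Measurable[hatFiltration T t] (fun x : HatPath T => x.2 s) :=
  measurable_iff_comap_le.2 (le_trans le_sup_right (le_iSup₂_of_le s hst le_rfl))

theorem measurable_pathFiltration {s t : Icc (0 : ℝ) T} (hst : s ≤ t) :
    Measurable[pathFiltration T t] (fun ω : CadlagPath T => ω s) :=
  measurable_iff_comap_le.2 (le_iSup₂_of_le (f := fun j (_ : j ≤ t) =>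
    MeasurableSpace.comap (fun ω : CadlagPath T => ω j) _) s hst le_rfl)

/-- The time-`t` rate `-φ'(X_0) - ψ'(X_t)`, where `φ'` and `ψ'` are set to `0` outside `I`. -/
def rate (I : Set ℝ) (φ' ψ' : ℝ → ℝ) (x y : ℝ) : ℝ := -I.indicator φ' x - I.indicator ψ' y

theorem measurable_rate (hφ : Measurable (I.indicator φ')) (hψ : Measurable (I.indicator ψ')) :
    Measurable (fun p : ℝ × ℝ => rate I φ' ψ' p.1 p.2) :=
  (hφ.comp measurable_fst).neg.sub (hψ.comp measurable_snd)

theorem AveragingPath.ae_stieltjes_ne_bot (a : AveragingPath T) :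
    ∀ᵐ t ∂a.stieltjes.measure, t ≠ ⊥ := by
  rw [ae_iff]
  have := a.stieltjes_Iic ⊥
  rw [sub_self, ENNReal.ofReal_zero, Iic_bot] at this
  simpa using this

theorem ae_dynamicPart_eq (a : AveragingPath T) (ω : CadlagPath T) :
    (fun t => (ω ⊤ - ω t) * dynamicPart I φ' ψ' t (ω, a)) =ᵐ[a.stieltjes.measure]
      fun t => (ω ⊤ - ω t) * rate I φ' ψ' (ω ⊥) (ω t) := by
  filter_upwards [a.ae_stieltjes_ne_bot] with t ht
  rw [dynamicPart, if_neg ht]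
  rfl

theorem integrable_dynamicPart (a : AveragingPath T) (ω : CadlagPath T)
    (hint : Integrable (fun t => (ω ⊤ - ω t) * rate I φ' ψ' (ω ⊥) (ω t)) a.measure) :
    (stieltjesMeasure a).Integrable (fun t => (ω ⊤ - ω t) * dynamicPart I φ' ψ' t (ω, a)) := by
  have := a.integrable_stieltjesMeasure hint
  rw [a.stieltjesMeasure_eq, VectorMeasure.Integrable, Measure.variation_toSignedMeasure] at this ⊢
  exact this.congr (ae_dynamicPart_eq a ω).symm

/-- The gains as an integral over `[0, T]` with respect to the probability measure `dA`. -/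
theorem gains_dynamicPart (A : AveragingProcess T) (ω : CadlagPath T)
    (hint : Integrable (fun t => (ω ⊤ - ω t) * rate I φ' ψ' (ω ⊥) (ω t)) (A.path ω).measure) :
    gains (pullback (dynamicPart I φ' ψ') A) (pullback (fun t x => x.2 t) A) ω =
      I.indicator φ' (ω ⊥) * (ω ⊤ - ω ⊥) +
        ∫ t, (ω ⊤ - ω t) * rate I φ' ψ' (ω ⊥) (ω t) ∂(A.path ω).measure := by
  have h1 := (A.path ω).integral_stieltjesMeasure hint
  have h2 : ∫ᵛ t, (ω ⊤ - ω t) * dynamicPart I φ' ψ' t (ω, A.path ω) ∂•(stieltjesMeasure (A.path ω))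
      = ∫ᵛ t, (ω ⊤ - ω t) * rate I φ' ψ' (ω ⊥) (ω t) ∂•(stieltjesMeasure (A.path ω)) := by
    rw [(A.path ω).stieltjesMeasure_eq, vectorMeasure_integral_toSignedMeasure,
      vectorMeasure_integral_toSignedMeasure]
    exact integral_congr_ae (ae_dynamicPart_eq _ _)
  simp only [gains, pullback]
  -- At time zero, `φ'(1 - A_0) - ψ' A_0 = φ' + A_0 (-φ' - ψ')`, with both slopes taken at `X_0`.
  -- The second summand is the contribution of the atom of `dA` at `0`.
  rw [h2, ← h1, dynamicPart, if_pos rfl, rate]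
  ring

theorem adapted_pullback_dynamicPart (hφ : Measurable (I.indicator φ'))
    (hψ : Measurable (I.indicator ψ')) (A : AveragingProcess T) :
    Adapted (pathFiltration T) (pullback (dynamicPart I φ' ψ') A) := fun t =>
  @measurable_dynamicPart_comp T _ φ' ψ' I _ (pathFiltration T t) hφ hψ t
    (fun ω => (ω, A.path ω)) (measurable_pathFiltration bot_le) (measurable_pathFiltration le_rfl)
    (A.adapted.measurable_le bot_le)

section Relevant

variable {μ ν : Measure ℝ} [IsFiniteMeasure μ] [IsFiniteMeasure ν] {ω : CadlagPath T}
  {p q : ℝ → ℝ}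

theorem exists_abs_rate_mul_le (h : IsIrreducible μ ν)
    (hω : ω ∈ relevantPaths (T := T) μ ν)
    (hsub : ∀ x₀ ∈ domI μ ν, ∀ x ∈ domJ μ ν, q x₀ + ψ' x₀ * (x - x₀) ≤ q x) :
    ∃ C, ∀ t, |(ω ⊤ - ω t) * rate (domI μ ν) φ' ψ' (ω ⊥) (ω t)| ≤ C := by
  obtain ⟨C, hC0, hC⟩ := ω.cadlag.exists_abs_le
  obtain ⟨D, hD⟩ := exists_abs_indicator_mul_le h hω hsub
  refine ⟨(C + C) * |(domI μ ν).indicator φ' (ω ⊥)| + D, fun t => ?_⟩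
  have : (ω ⊤ - ω t) * rate (domI μ ν) φ' ψ' (ω ⊥) (ω t) =
      -((ω ⊤ - ω t) * (domI μ ν).indicator φ' (ω ⊥)) -
        (domI μ ν).indicator ψ' (ω t) * (ω ⊤ - ω t) := by
    rw [rate]
    ring
  rw [this]
  refine (abs_sub _ _).trans (add_le_add ?_ (hD t))
  rw [abs_neg, abs_mul]
  exact mul_le_mul_of_nonneg_right ((abs_sub _ _).trans (add_le_add (hC _) (hC _))) (abs_nonneg _)

theorem integrable_rate_mul (h : IsIrreducible μ ν) (hω : ω ∈ relevantPaths (T := T) μ ν)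
    (hφ : Measurable ((domI μ ν).indicator φ')) (hψ : Measurable ((domI μ ν).indicator ψ'))
    (hsub : ∀ x₀ ∈ domI μ ν, ∀ x ∈ domJ μ ν, q x₀ + ψ' x₀ * (x - x₀) ≤ q x)
    (a : AveragingPath T) :
    Integrable (fun t => (ω ⊤ - ω t) * rate (domI μ ν) φ' ψ' (ω ⊥) (ω t)) a.measure := by
  obtain ⟨C, hC⟩ := exists_abs_rate_mul_le (φ' := φ') h hω hsub
  refine Integrable.of_bound (Measurable.aestronglyMeasurable ?_) C (Eventually.of_forall hC)
  exact (measurable_const.sub ω.cadlag.measurable).mul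
    ((measurable_rate hφ hψ).comp (measurable_const.prodMk ω.cadlag.measurable))

/-- The static part together with the gains at a single trading date dominates
`(φ + ψ)(X_t)`. -/
theorem add_le_single_date (h : IsIrreducible μ ν) (hω : ω ∈ relevantPaths (T := T) μ ν)
    (hsup : ∀ x₀ ∈ domI μ ν, ∀ x ∈ domJ μ ν, p x ≤ p x₀ + φ' x₀ * (x - x₀))
    (hsub : ∀ x₀ ∈ domI μ ν, ∀ x ∈ domJ μ ν, q x₀ + ψ' x₀ * (x - x₀) ≤ q x)
    (t : Icc (0 : ℝ) T) :
    p (ω t) + q (ω t) ≤ p (ω ⊥) + q (ω ⊤) + (domI μ ν).indicator φ' (ω ⊥) * (ω ⊤ - ω ⊥) +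
      (ω ⊤ - ω t) * rate (domI μ ν) φ' ψ' (ω ⊥) (ω t) := by
  have h1 := le_sub_indicator_mul h hω hsub t
  have h2 := hsup _ hω.1 _ (mem_domJ_of_mem_relevantPaths hω t)
  rw [rate, indicator_of_mem hω.1]
  linarith

/-- The superhedging inequality on relevant paths, in terms of the average of the path. -/
theorem add_average_le (h : IsIrreducible μ ν) (hω : ω ∈ relevantPaths (T := T) μ ν)
    (hφ : Measurable ((domI μ ν).indicator φ')) (hψ : Measurable ((domI μ ν).indicator ψ'))
    (hsup : ∀ x₀ ∈ domI μ ν, ∀ x ∈ domJ μ ν, p x ≤ p x₀ + φ' x₀ * (x - x₀))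
    (hsub : ∀ x₀ ∈ domI μ ν, ∀ x ∈ domJ μ ν, q x₀ + ψ' x₀ * (x - x₀) ≤ q x)
    (a : AveragingPath T) :
    average ω a ∈ domJ μ ν ∧ p (average ω a) + q (average ω a) ≤
      p (ω ⊥) + q (ω ⊤) + (domI μ ν).indicator φ' (ω ⊥) * (ω ⊤ - ω ⊥) +
        ∫ t, (ω ⊤ - ω t) * rate (domI μ ν) φ' ψ' (ω ⊥) (ω t) ∂a.measure := by
  obtain ⟨C, -, hC⟩ := ω.cadlag.exists_abs_le
  have hω_int : Integrable (fun t => ω t) a.measure :=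
    Integrable.of_bound ω.cadlag.measurable.aestronglyMeasurable C (Eventually.of_forall hC)
  have hr := integrable_rate_mul h hω hφ hψ hsub a
  set m := average ω a with hm
  rw [average_eq] at hm
  have hJ : ∀ t, ω t ∈ domJ μ ν := mem_domJ_of_mem_relevantPaths hω
  have hmJ : m ∈ domJ μ ν := by
    -- The average lies between two values of the path, and `J` is an interval.
    obtain ⟨s, hs⟩ := exists_le_integral hω_int
    obtain ⟨t, ht⟩ := exists_integral_le hω_int
    exact h.ordConnected_domJ.out (hJ s) (hJ t) ⟨hm ▸ hs, hm ▸ ht⟩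
  refine ⟨hmJ, ?_⟩
  -- This is the supporting line for Jensen's inequality. If `m` is an endpoint, no subderivative is
  -- available there; but then the path lies on one side of its own average, so it equals `m` almost
  -- everywhere for `dA`, and slope `0` works.
  have key : ∃ c : ℝ, ∀ᵐ t ∂a.measure, q m + c * (ω t - m) ≤ q (ω t) := by
    by_cases hmI : m ∈ domI μ ν
    · exact ⟨ψ' m, Eventually.of_forall fun t => hsub m hmI _ (hJ t)⟩
    · have hcl : ∀ t, ω t ∈ closure (domI μ ν) := fun t => domJ_subset_closure (hJ t)
      have : ∀ᵐ t ∂a.measure, ω t = m := by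
        rcases h.mem_endpoints_of_mem_domJ hmJ hmI with he | he
        · have h0 : 0 ≤ fun t => m - ω t := fun t => sub_nonneg.2
            (closure_minimal (fun z hz => he.1 hz) isClosed_Iic (hcl t))
          have h1 : ∫ t, (m - ω t) ∂a.measure = 0 := by
            rw [integral_sub (integrable_const _) hω_int, ← hm]
            simp
          filter_upwards [(integral_eq_zero_iff_of_nonneg h0
            ((integrable_const _).sub hω_int)).1 h1] with t ht
          exact (sub_eq_zero.1 ht).symm
        · have h0 : 0 ≤ fun t => ω t - m := fun t => sub_nonneg.2
            (closure_minimal (fun z hz => he.1 hz) isClosed_Ici (hcl t))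
          have h1 : ∫ t, (ω t - m) ∂a.measure = 0 := by
            rw [integral_sub hω_int (integrable_const _), ← hm]
            simp
          filter_upwards [(integral_eq_zero_iff_of_nonneg h0
            (hω_int.sub (integrable_const _))).1 h1] with t ht
          exact sub_eq_zero.1 ht
      exact ⟨0, this.mono fun t ht => by rw [ht]; simp⟩
  obtain ⟨c, hc⟩ := key
  have hpt : ∀ᵐ t ∂a.measure, p (ω ⊥) + φ' (ω ⊥) * (ω t - ω ⊥) + (q m + c * (ω t - m)) ≤
      p (ω ⊥) + q (ω ⊤) + (domI μ ν).indicator φ' (ω ⊥) * (ω ⊤ - ω ⊥) +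
        (ω ⊤ - ω t) * rate (domI μ ν) φ' ψ' (ω ⊥) (ω t) := by
    filter_upwards [hc] with t ht
    have h1 := le_sub_indicator_mul h hω hsub t
    rw [rate, indicator_of_mem hω.1]
    linarith
  have hL : Integrable (fun t => p (ω ⊥) + φ' (ω ⊥) * (ω t - ω ⊥) + (q m + c * (ω t - m)))
      a.measure :=
    ((integrable_const _).add ((hω_int.sub (integrable_const _)).const_mul _)).add
      ((integrable_const _).add ((hω_int.sub (integrable_const _)).const_mul _))
  have hint := integral_mono_ae hL ((integrable_const _).add hr) hpt
  have hLi : ∫ t, (p (ω ⊥) + φ' (ω ⊥) * (ω t - ω ⊥) + (q m + c * (ω t - m))) ∂a.measure =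
      p (ω ⊥) + φ' (ω ⊥) * (m - ω ⊥) + q m := by
    have e : (fun t => p (ω ⊥) + φ' (ω ⊥) * (ω t - ω ⊥) + (q m + c * (ω t - m))) =
        fun t => (φ' (ω ⊥) + c) * ω t + (p (ω ⊥) - φ' (ω ⊥) * ω ⊥ + q m - c * m) := by
      ext t
      ring
    rw [e, integral_add (hω_int.const_mul _) (integrable_const _), integral_const_mul, ← hm]
    simp only [integral_const, probReal_univ, smul_eq_mul, one_mul]
    ring
  rw [hLi] at hint
  have hRi : ∫ t, (p (ω ⊥) + q (ω ⊤) + (domI μ ν).indicator φ' (ω ⊥) * (ω ⊤ - ω ⊥) +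
        (ω ⊤ - ω t) * rate (domI μ ν) φ' ψ' (ω ⊥) (ω t)) ∂a.measure =
      p (ω ⊥) + q (ω ⊤) + (domI μ ν).indicator φ' (ω ⊥) * (ω ⊤ - ω ⊥) +
        ∫ t, (ω ⊤ - ω t) * rate (domI μ ν) φ' ψ' (ω ⊥) (ω t) ∂a.measure := by
    rw [integral_add (integrable_const _) hr]
    simp
  -- The supporting line of `p` is used only after averaging, at the point `m`; using it at each
  -- date would leave the average of `p (ω t)`, for which Jensen's inequality points the wrong way.
  have h3 := hsup _ hω.1 _ hmJ
  refine le_trans ?_ (hint.trans_eq hRi)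
  linarith

end Relevant

end

section

/-! ### Nonnegative martingales are absorbed at zero -/

section Absorption

variable {Ω ι : Type*} [LinearOrder ι] {m0 : MeasurableSpace Ω} {P : Measure Ω} [IsFiniteMeasure P]
  {𝓕 : Filtration ι m0} {M : ι → Ω → ℝ}

/-- A maximal inequality: split the event by the first `a ∈ S` with `M a < ε`. Each piece is known
at time `a`, so the martingale property replaces `M u` by `M a`, which is below `ε` there. Induction
on the maximum of `S` splits off the last piece `F`. -/
theorem setIntegral_exists_lt_le (hM : Martingale M 𝓕 P) {u : ι} (ε : ℝ) (S : Finset ι)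
    (hS : ∀ s ∈ S, s ≤ u) :
    ∫ ω in {ω | ∃ s ∈ S, M s ω < ε}, M u ω ∂P ≤ ε * P.real {ω | ∃ s ∈ S, M s ω < ε} := by
  have hmeas : ∀ (t : ι) (S : Finset ι), (∀ s ∈ S, s ≤ t) →
      MeasurableSet[𝓕 t] {ω | ∃ s ∈ S, M s ω < ε} := by
    intro t S hS
    have : {ω | ∃ s ∈ S, M s ω < ε} = ⋃ s ∈ S, {ω | M s ω < ε} := by
      ext ω
      simp
    rw [this]
    exact Finset.measurableSet_biUnion _ fun s hs =>
      ((hM.1 s).measurable.mono (𝓕.mono (hS s hs)) le_rfl) measurableSet_Iio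
  induction S using Finset.induction_on_max with
  | empty => simp
  | insert a S hlt ih =>
    have hSu : ∀ s ∈ S, s ≤ u := fun s hs => hS s (Finset.mem_insert_of_mem hs)
    have hau : a ≤ u := hS a (Finset.mem_insert_self _ _)
    set E := {ω | ∃ s ∈ S, M s ω < ε} with hE
    set F := Eᶜ ∩ {ω | M a ω < ε} with hF
    have hEm : MeasurableSet[𝓕 a] E := hmeas a S fun s hs => (hlt s hs).le
    have hFm : MeasurableSet[𝓕 a] F :=
      hEm.compl.inter ((hM.1 a).measurable measurableSet_Iio)
    have hun : {ω | ∃ s ∈ insert a S, M s ω < ε} = E ∪ F := by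
      ext ω
      simp only [Finset.mem_insert, exists_eq_or_imp, hE, hF, mem_ofPred_eq, mem_union, mem_inter_iff,
        mem_compl_iff]
      generalize (∃ a ∈ S, M a ω < ε) = A
      tauto
    have hdisj : Disjoint E F := disjoint_compl_right.mono_right inter_subset_left
    rw [hun, setIntegral_union hdisj (𝓕.le a _ hFm) (hM.integrable u).integrableOn
      (hM.integrable u).integrableOn, measureReal_union hdisj (𝓕.le a _ hFm), mul_add]
    refine add_le_add (ih hSu) ?_
    rw [← hM.setIntegral_eq hau hFm]
    calc ∫ ω in F, M a ω ∂P ≤ ∫ _ in F, ε ∂P :=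
          setIntegral_mono_on (hM.integrable a).integrableOn (integrable_const _).integrableOn
            (𝓕.le a _ hFm) fun ω hω => le_of_lt hω.2
      _ = ε * P.real F := by rw [setIntegral_const, smul_eq_mul, mul_comm]

/-- The maximal inequality extends from finite to countable sets of times by exhaustion. As `ε → 0`,
the nonnegative `M u` has zero integral over the event that the earlier values have infimum at most
zero. -/
theorem ae_eq_zero_of_forall_exists_lt (hM : Martingale M 𝓕 P) {u : ι} (h0 : ∀ᵐ ω ∂P, 0 ≤ M u ω)
    {D : Set ι} (hD : D.Countable) :
    ∀ᵐ ω ∂P, (∀ ε > 0, ∃ s ∈ D, s ≤ u ∧ M s ω < ε) → M u ω = 0 := by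
  have hmeas : ∀ ε : ℝ, MeasurableSet {ω | ∃ s ∈ D ∩ Iic u, M s ω < ε} := by
    intro ε
    have : {ω | ∃ s ∈ D ∩ Iic u, M s ω < ε} = ⋃ s ∈ D ∩ Iic u, {ω | M s ω < ε} := by
      ext ω
      simp
    rw [this]
    exact MeasurableSet.biUnion (hD.mono inter_subset_left) fun s _ =>
      ((hM.1 s).measurable.mono (𝓕.le s) le_rfl) measurableSet_Iio
  have hbound : ∀ ε : ℝ, 0 ≤ ε →
      ∫ ω in {ω | ∃ s ∈ D ∩ Iic u, M s ω < ε}, M u ω ∂P ≤ ε * P.real univ := by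
    intro ε hε
    rcases (D ∩ Iic u).eq_empty_or_nonempty with he | hne
    · rw [he]
      simp only [mem_empty_iff_false, false_and, exists_false, ofPred_false, Measure.restrict_empty,
        integral_zero_measure]
      positivity
    obtain ⟨s, hs⟩ := (hD.mono inter_subset_left).exists_eq_range hne
    classical
    have hE : {ω | ∃ s ∈ D ∩ Iic u, M s ω < ε} =
        ⋃ n : ℕ, {ω | ∃ t ∈ (Finset.range n).image s, M t ω < ε} := by
      ext ω
      simp only [hs, exists_range_iff, mem_ofPred_eq, mem_iUnion, Finset.exists_mem_image,
        Finset.mem_range]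
      exact ⟨fun ⟨k, hk⟩ => ⟨k + 1, k, Nat.lt_succ_self k, hk⟩, fun ⟨n, k, _, hk⟩ => ⟨k, hk⟩⟩
    have hSu : ∀ n, ∀ t ∈ (Finset.range n).image s, t ≤ u := by
      intro n t ht
      obtain ⟨k, -, rfl⟩ := Finset.mem_image.1 ht
      have : s k ∈ D ∩ Iic u := hs ▸ mem_range_self k
      exact this.2
    have hlim := tendsto_setIntegral_of_monotone (μ := P) (f := M u)
      (s := fun n : ℕ => {ω | ∃ t ∈ (Finset.range n).image s, M t ω < ε}) (fun n => by
        have : {ω | ∃ t ∈ (Finset.range n).image s, M t ω < ε} =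
          ⋃ t ∈ (Finset.range n).image s, {ω | M t ω < ε} := by
          ext ω
          simp
        rw [this]
        exact Finset.measurableSet_biUnion _ fun t _ =>
          ((hM.1 t).measurable.mono (𝓕.le t) le_rfl) measurableSet_Iio)
      (fun n k hnk ω ⟨t, ht, h⟩ => ⟨t, Finset.image_subset_image (Finset.range_mono hnk) ht, h⟩)
      (hM.integrable u).integrableOn
    rw [hE]
    refine le_of_tendsto' hlim fun n => ?_
    exact (setIntegral_exists_lt_le hM ε _ (hSu n)).trans
      (mul_le_mul_of_nonneg_left (measureReal_mono (subset_univ _)) hε)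
  set E₀ := ⋂ n : ℕ, {ω | ∃ s ∈ D ∩ Iic u, M s ω < 1 / ((n : ℝ) + 1)} with hE₀
  have hE₀m : MeasurableSet E₀ := MeasurableSet.iInter fun n => hmeas _
  have hz : ∫ ω in E₀, M u ω ∂P = 0 := by
    refine le_antisymm ?_ (setIntegral_nonneg_of_ae h0)
    -- Nonnegativity of `M u` allows enlarging `E₀` to its `n`-th constituent.
    have h1 : ∀ n : ℕ, ∫ ω in E₀, M u ω ∂P ≤ 1 / ((n : ℝ) + 1) * P.real univ := fun n =>
      (setIntegral_mono_set (hM.integrable u).integrableOn (ae_restrict_of_ae h0)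
        (iInter_subset _ n).eventuallyLE).trans (hbound _ (by positivity))
    have h2 := (tendsto_one_div_add_atTop_nhds_zero_nat (𝕜 := ℝ)).mul_const (P.real univ)
    rw [zero_mul] at h2
    exact ge_of_tendsto' h2 h1
  rw [setIntegral_eq_zero_iff_of_nonneg_ae (ae_restrict_of_ae h0) (hM.integrable u).integrableOn] at hz
  filter_upwards [(ae_restrict_iff' hE₀m).1 hz] with ω hω h
  refine hω (mem_iInter.2 fun n => ?_)
  obtain ⟨s, hs, hsu, hlt⟩ := h (1 / ((n : ℝ) + 1)) (by positivity)
  exact ⟨s, ⟨hs, hsu⟩, hlt⟩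

theorem ae_nonneg_of_ae_nonneg_top [OrderTop ι] (hM : Martingale M 𝓕 P) (h0 : ∀ᵐ ω ∂P, 0 ≤ M ⊤ ω)
    (u : ι) : ∀ᵐ ω ∂P, 0 ≤ M u ω := by
  filter_upwards [hM.2 u ⊤ le_top, condExp_nonneg (m := 𝓕 u) h0] with ω h1 h2
  rw [← h1]
  exact h2

end Absorption

/-! ### Absorption of càdlàg paths: from a countable dense set of times to all times -/

section Cadlag

variable {T : ℝ} [Fact (0 ≤ T)] {D : Set (Icc (0 : ℝ) T)}

theorem frequently_mem_nhdsGT (hD : Dense D) {t : Icc (0 : ℝ) T} (ht : t < ⊤) :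
    ∃ᶠ s in 𝓝[>] t, s ∈ D := by
  rw [frequently_iff]
  intro U hU
  obtain ⟨v, hv, hvU⟩ := (mem_nhdsGT_iff_exists_Ioo_subset' ht).1 hU
  obtain ⟨s, hs, hs'⟩ := hD.exists_between hv
  exact ⟨s, hvU hs', hs⟩

theorem frequently_mem_nhdsLT (hD : Dense D) {t : Icc (0 : ℝ) T} (ht : ⊥ < t) :
    ∃ᶠ s in 𝓝[<] t, s ∈ D := by
  rw [frequently_iff]
  intro U hU
  obtain ⟨v, hv, hvU⟩ := (mem_nhdsLT_iff_exists_Ioo_subset' ht).1 hU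
  obtain ⟨s, hs, hs'⟩ := hD.exists_between hv
  exact ⟨s, hvU hs', hs⟩

/-- A value before `T` is a limit along `D` from the right. The final time has no right neighbours,
so it must belong to `D`. -/
theorem IsCadlag.mem_of_forall_dense {y : Icc (0 : ℝ) T → ℝ} (hy : IsCadlag y) (hD : Dense D)
    (htop : ⊤ ∈ D) {K : Set ℝ} (hK : IsClosed K) {t : Icc (0 : ℝ) T}
    (h : ∀ d ∈ D, t ≤ d → y d ∈ K) {u : Icc (0 : ℝ) T} (hu : t ≤ u) : y u ∈ K := by
  rcases eq_or_lt_of_le (le_top : u ≤ ⊤) with rfl | hlt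
  · exact h _ htop hu
  · refine hK.mem_of_frequently_of_tendsto ?_
      ((hy.right_continuous u).mono Ioi_subset_Ici_self).tendsto
    exact ((frequently_mem_nhdsGT hD hlt).and_eventually self_mem_nhdsWithin).mono
      fun s hs => h s hs.1 (hu.trans (le_of_lt hs.2))

/-- A càdlàg function that is nonnegative and absorbed at zero along a dense set of times is
nonnegative and absorbed at zero, also by its left limits. -/
theorem IsCadlag.absorbed {y : Icc (0 : ℝ) T → ℝ} (hy : IsCadlag y) (hD : Dense D) (htop : ⊤ ∈ D)
    (h0 : ∀ u ∈ D, 0 ≤ y u)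
    (habs : ∀ u ∈ D, (∀ ε > 0, ∃ s ∈ D, s ≤ u ∧ y s < ε) → y u = 0) :
    (∀ t, 0 ≤ y t) ∧ (∀ t, y t = 0 → ∀ u, t ≤ u → y u = 0) ∧
      ∀ t, ⊥ < t → Function.leftLim y t = 0 → ∀ u, t ≤ u → y u = 0 := by
  refine ⟨fun t => hy.mem_of_forall_dense hD htop isClosed_Ici (fun d hd _ => h0 d hd) le_rfl,
    fun t ht u hu => ?_, fun t htb ht u hu => ?_⟩
  · refine hy.mem_of_forall_dense hD htop isClosed_singleton (fun d hd htd => ?_) hu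
    rcases htd.eq_or_lt with rfl | hlt
    · exact ht
    refine habs d hd fun ε hε => ?_
    have h1 : ∀ᶠ s in 𝓝[>] t, y s < ε :=
      ((hy.right_continuous t).mono Ioi_subset_Ici_self).tendsto.eventually
        (gt_mem_nhds (ht.symm ▸ hε))
    have h2 : ∀ᶠ s in 𝓝[>] t, s ∈ Ioo t d := Ioo_mem_nhdsGT hlt
    obtain ⟨s, hs, hs1, hs2⟩ :=
      ((frequently_mem_nhdsGT hD (hlt.trans_le le_top)).and_eventually (h1.and h2)).exists
    exact ⟨s, hs, hs2.2.le, hs1⟩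
  · refine hy.mem_of_forall_dense hD htop isClosed_singleton (fun d hd htd => ?_) hu
    refine habs d hd fun ε hε => ?_
    have h1 : ∀ᶠ s in 𝓝[<] t, y s < ε :=
      (hy.tendsto_leftLim t).eventually (gt_mem_nhds (ht.symm ▸ hε))
    obtain ⟨s, hs, hs1, hs2⟩ :=
      ((frequently_mem_nhdsLT hD htb).and_eventually (h1.and self_mem_nhdsWithin)).exists
    exact ⟨s, hs, (le_of_lt hs2).trans htd, hs1⟩

/-- A càdlàg martingale with nonnegative terminal value is nonnegative and absorbed at zero. -/
theorem ae_absorbed {Ω : Type*} {m0 : MeasurableSpace Ω} {P : Measure Ω} [IsFiniteMeasure P]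
    {𝓕 : Filtration (Icc (0 : ℝ) T) m0} {M : Icc (0 : ℝ) T → Ω → ℝ} (hM : Martingale M 𝓕 P)
    (hc : ∀ ω, IsCadlag fun t => M t ω) (h0 : ∀ᵐ ω ∂P, 0 ≤ M ⊤ ω) :
    ∀ᵐ ω ∂P, (∀ t, 0 ≤ M t ω) ∧ (∀ t, M t ω = 0 → ∀ u, t ≤ u → M u ω = 0) ∧
      ∀ t, ⊥ < t → Function.leftLim (fun t => M t ω) t = 0 → ∀ u, t ≤ u → M u ω = 0 := by
  obtain ⟨D, hDc, hD⟩ := TopologicalSpace.exists_countable_dense (Icc (0 : ℝ) T)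
  have hDc' := hDc.insert ⊤
  have hD' := hD.mono (subset_insert ⊤ D)
  have h1 : ∀ᵐ ω ∂P, ∀ u ∈ insert ⊤ D, 0 ≤ M u ω :=
    (ae_ball_iff hDc').2 fun u _ => ae_nonneg_of_ae_nonneg_top hM h0 u
  have h2 := (ae_ball_iff hDc').2 fun u _ =>
    ae_eq_zero_of_forall_exists_lt hM (ae_nonneg_of_ae_nonneg_top hM h0 u) hDc'
  filter_upwards [h1, h2] with ω hω1 hω2
  exact (hc ω).absorbed hD' (mem_insert _ _) hω1 hω2

end Cadlag

/-! ### Martingale couplings are concentrated on relevant paths -/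

section Coupling

variable {T : ℝ} [Fact (0 ≤ T)] {μ ν : Measure ℝ} [IsFiniteMeasure μ] [IsFiniteMeasure ν]
  {P : Measure (CadlagPath T)}

theorem IsMartingaleCoupling.ae_zero (hP : IsMartingaleCoupling μ ν P) {p : ℝ → Prop}
    (h : ∀ᵐ x ∂μ, p x) : ∀ᵐ ω ∂P, p (ω ⊥) :=
  ae_of_ae_map (measurable_eval ⊥).aemeasurable (hP.map_zero.symm ▸ h)

theorem IsMartingaleCoupling.ae_top (hP : IsMartingaleCoupling μ ν P) {p : ℝ → Prop}
    (h : ∀ᵐ x ∂ν, p x) : ∀ᵐ ω ∂P, p (ω ⊤) :=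
  ae_of_ae_map (measurable_eval ⊤).aemeasurable (hP.map_top.symm ▸ h)

/-- If `r` is the right endpoint of `I`, then `r - X` is a martingale with nonnegative terminal
value, so it stays nonnegative and is absorbed at zero, also through left limits; `X - r` serves for
the left endpoint. -/
theorem IsMartingaleCoupling.ae_mem_relevantPaths (h : IsIrreducible μ ν)
    (hP : IsMartingaleCoupling μ ν P) : ∀ᵐ ω ∂P, ω ∈ relevantPaths (T := T) μ ν := by
  have := hP.finite
  rcases (domI μ ν).eq_empty_or_nonempty with hI | hI
  · filter_upwards [hP.ae_zero h.ae_mem_domI] with ω hω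
    simp [hI] at hω
  have hupper : ∀ᵐ (ω : CadlagPath T) ∂P, ∀ r, IsLUB (domI μ ν) r →
      (∀ t, ω t ≤ r) ∧ (∀ t, ω t = r → ∀ u, t ≤ u → ω u = r) ∧
        ∀ t, ⊥ < t → Function.leftLim ω t = r → ∀ u, t ≤ u → ω u = r := by
    by_cases hr : ∃ r, IsLUB (domI μ ν) r
    · obtain ⟨r, hr⟩ := hr
      have hM : Martingale (fun t (ω : CadlagPath T) => r - ω t) (pathFiltration T) P :=
        (martingale_const (pathFiltration T) P r).sub hP.martingale
      have hc : ∀ ω : CadlagPath T, IsCadlag fun t => r - ω t := fun ω =>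
        ⟨fun t => continuousWithinAt_const.sub (ω.cadlag.right_continuous t),
          fun t => ⟨_, tendsto_const_nhds.sub (ω.cadlag.tendsto_leftLim t)⟩⟩
      have hlim : ∀ (ω : CadlagPath T) t, ⊥ < t →
          Function.leftLim (fun t => r - ω t) t = r - Function.leftLim ω t := fun ω t ht => by
        have : (𝓝[<] t).NeBot := nhdsLT_neBot_of_exists_lt ⟨⊥, ht⟩
        exact tendsto_nhds_unique ((hc ω).tendsto_leftLim t)
          (tendsto_const_nhds.sub (ω.cadlag.tendsto_leftLim t))
      have h0 : ∀ᵐ ω ∂P, 0 ≤ r - ω ⊤ :=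
        (hP.ae_top (h.ae_le_of_upperBound hr.1)).mono fun ω hω => sub_nonneg.2 hω
      filter_upwards [ae_absorbed hM hc h0] with ω hω r' hr'
      rw [hr'.unique hr]
      refine ⟨fun t => sub_nonneg.1 (hω.1 t), fun t ht u hu => ?_, fun t htb ht u hu => ?_⟩
      · linarith [hω.2.1 t (by linarith) u hu]
      · linarith [hω.2.2 t htb (by rw [hlim ω t htb]; linarith) u hu]
    · exact Eventually.of_forall fun ω r hr' => absurd ⟨r, hr'⟩ hr
  have hlower : ∀ᵐ (ω : CadlagPath T) ∂P, ∀ r, IsGLB (domI μ ν) r →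
      (∀ t, r ≤ ω t) ∧ (∀ t, ω t = r → ∀ u, t ≤ u → ω u = r) ∧
        ∀ t, ⊥ < t → Function.leftLim ω t = r → ∀ u, t ≤ u → ω u = r := by
    by_cases hr : ∃ r, IsGLB (domI μ ν) r
    · obtain ⟨r, hr⟩ := hr
      have hM : Martingale (fun t (ω : CadlagPath T) => ω t - r) (pathFiltration T) P :=
        hP.martingale.sub (martingale_const (pathFiltration T) P r)
      have hc : ∀ ω : CadlagPath T, IsCadlag fun t => ω t - r := fun ω =>
        ⟨fun t => (ω.cadlag.right_continuous t).sub continuousWithinAt_const,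
          fun t => ⟨_, (ω.cadlag.tendsto_leftLim t).sub tendsto_const_nhds⟩⟩
      have hlim : ∀ (ω : CadlagPath T) t, ⊥ < t →
          Function.leftLim (fun t => ω t - r) t = Function.leftLim ω t - r := fun ω t ht => by
        have : (𝓝[<] t).NeBot := nhdsLT_neBot_of_exists_lt ⟨⊥, ht⟩
        exact tendsto_nhds_unique ((hc ω).tendsto_leftLim t)
          ((ω.cadlag.tendsto_leftLim t).sub tendsto_const_nhds)
      have h0 : ∀ᵐ ω ∂P, 0 ≤ ω ⊤ - r :=
        (hP.ae_top (h.ae_ge_of_lowerBound hr.1)).mono fun ω hω => sub_nonneg.2 hω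
      filter_upwards [ae_absorbed hM hc h0] with ω hω r' hr'
      rw [hr'.unique hr]
      refine ⟨fun t => sub_nonneg.1 (hω.1 t), fun t ht u hu => ?_, fun t htb ht u hu => ?_⟩
      · linarith [hω.2.1 t (by linarith) u hu]
      · linarith [hω.2.2 t htb (by rw [hlim ω t htb]; linarith) u hu]
    · exact Eventually.of_forall fun ω r hr' => absurd ⟨r, hr'⟩ hr
  filter_upwards [hupper, hlower, hP.ae_zero h.ae_mem_domI,
    hP.ae_top (ae_atom_of_mem_endpoints (μ := μ) (ν := ν))] with ω hu hl h0 ha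
  have hcap : ∀ t, ω t ∈ endpoints (domI μ ν) → ∀ u, t ≤ u → ω u = ω t := by
    rintro t (ht | ht) u htu
    · exact (hu _ ht).2.1 t rfl u htu
    · exact (hl _ ht).2.1 t rfl u htu
  refine ⟨h0, fun t _ => ?_, fun t htb ht u htu => ?_, fun t ht u htu => ?_⟩
  · refine h.mem_domJ_of_bounds hI (fun r hr => (hu r hr).1 t) (fun r hr => (hl r hr).1 t)
      fun he => ?_
    -- A path at an endpoint at time `t` is still there at time `T`, where almost surely only
    -- endpoints that are atoms of `ν` are reached.
    have := hcap t he ⊤ le_top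
    exact this ▸ ha (this ▸ he)
  · rcases h.mem_endpoints_of_mem_frontier ht with he | he
    · exact (hu _ he).2.2 t htb rfl u htu
    · exact (hl _ he).2.2 t htb rfl u htu
  · exact hcap t (h.mem_endpoints_of_mem_frontier ht) u htu

end Coupling

end

section

/-! ### Averaging a martingale increment against an adapted measure -/

/-- A continuous cutoff: `1` on `[-N, N]` and `0` outside `[-N - 1, N + 1]`. -/
def cutoff (N : ℕ) (y : ℝ) : ℝ := max 0 (min 1 ((N : ℝ) + 1 - |y|))

theorem continuous_cutoff (N : ℕ) : Continuous (cutoff N) := by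
  unfold cutoff
  fun_prop

theorem cutoff_nonneg (N : ℕ) (y : ℝ) : 0 ≤ cutoff N y := le_max_left _ _

theorem cutoff_le_one (N : ℕ) (y : ℝ) : cutoff N y ≤ 1 := max_le zero_le_one (min_le_left _ _)

theorem cutoff_eq_one {N : ℕ} {y : ℝ} (h : |y| ≤ N) : cutoff N y = 1 := by
  rw [cutoff, min_eq_left (by linarith), max_eq_right zero_le_one]

/-- The supremum of `|X_t|` need not be integrable; with the cutoff, increments to time `T` are
dominated by an integrable bound that does not depend on the date. -/
theorem cutoff_mul_abs_sub_le (N : ℕ) (x y : ℝ) :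
    |cutoff N y * (x - y)| ≤ |x| + ((N : ℝ) + 1) := by
  by_cases h : |y| ≤ N + 1
  · rw [abs_mul, abs_of_nonneg (cutoff_nonneg N y)]
    calc cutoff N y * |x - y| ≤ 1 * |x - y| :=
          mul_le_mul_of_nonneg_right (cutoff_le_one N y) (abs_nonneg _)
      _ ≤ |x| + ((N : ℝ) + 1) := by
          rw [one_mul]
          exact (abs_sub _ _).trans (by linarith)
  · rw [cutoff, max_eq_left ((min_le_right _ _).trans (by linarith)), zero_mul, abs_zero]
    positivity

section

variable {T : ℝ} [Fact (0 ≤ T)] {P : Measure (CadlagPath T)} [IsFiniteMeasure P]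

theorem integral_mul_sub_eq_zero {Ω ι : Type*} [Preorder ι] {m0 : MeasurableSpace Ω}
    {P : Measure Ω} [IsFiniteMeasure P] {𝓕 : Filtration ι m0} {M : ι → Ω → ℝ}
    (hM : Martingale M 𝓕 P) {s t : ι} (hst : s ≤ t) {Y : Ω → ℝ} (hY : Measurable[𝓕 s] Y) {C : ℝ}
    (hC : ∀ ω, |Y ω| ≤ C) :
    Integrable (fun ω => Y ω * (M t ω - M s ω)) P ∧ ∫ ω, Y ω * (M t ω - M s ω) ∂P = 0 := by
  have hd := (hM.integrable t).sub (hM.integrable s)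
  refine ⟨hd.bdd_mul ((hY.mono (𝓕.le s) le_rfl).aestronglyMeasurable)
    (Eventually.of_forall hC), ?_⟩
  have h1 := condExp_stronglyMeasurable_mul_of_bound (𝓕.le s) hY.stronglyMeasurable hd C
    (Eventually.of_forall hC)
  have h2 := condExp_sub (hM.integrable t) (hM.integrable s) (𝓕 s)
  have h3 : P[Y * (M t - M s) | 𝓕 s] =ᵐ[P] 0 := by
    filter_upwards [h1, h2, hM.2 s t hst, hM.2 s s le_rfl] with ω h1 h2 h3 h4
    rw [h1, Pi.mul_apply, h2, Pi.sub_apply, h3, h4, sub_self, mul_zero]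
    rfl
  calc ∫ ω, Y ω * (M t ω - M s ω) ∂P = ∫ ω, (P[Y * (M t - M s) | 𝓕 s]) ω ∂P :=
        (integral_condExp (𝓕.le s)).symm
    _ = 0 := by rw [integral_congr_ae h3]; simp

theorem measurable_eval_uncurry :
    Measurable (fun z : CadlagPath T × Icc (0 : ℝ) T => z.1 z.2) :=
  measurable_uncurry_of_isCadlag (Z := fun t (ω : CadlagPath T) => ω t) measurable_eval
    fun ω => ω.cadlag

theorem AveragingProcess.integrable_comp_fst (A : AveragingProcess T) {g : CadlagPath T → ℝ}
    (hg : Integrable g P) : Integrable (fun z : CadlagPath T × Icc (0 : ℝ) T => g z.1)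
      (P ⊗ₘ A.kernel) := by
  have h1 : (P ⊗ₘ A.kernel).map Prod.fst = P := Measure.fst_compProd P A.kernel
  have h2 : Integrable g ((P ⊗ₘ A.kernel).map Prod.fst) := h1.symm ▸ hg
  exact h2.comp_measurable measurable_fst

variable (A : AveragingProcess T)
  (hM : Martingale (fun t (ω : CadlagPath T) => ω t) (pathFiltration T) P)

include hM

theorem AveragingProcess.integrable_cutoff (N : ℕ) {g : ℝ × ℝ → ℝ} (hg : Measurable g) {C : ℝ}
    (hC : ∀ z, |g z| ≤ C) {r : Icc (0 : ℝ) T → Icc (0 : ℝ) T} (hr : Measurable r) :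
    Integrable (fun z : CadlagPath T × Icc (0 : ℝ) T =>
      g (z.1 ⊥, z.1 (r z.2)) * (cutoff N (z.1 (r z.2)) * (z.1 ⊤ - z.1 (r z.2))))
      (P ⊗ₘ A.kernel) := by
  have hr' : Measurable (fun z : CadlagPath T × Icc (0 : ℝ) T => z.1 (r z.2)) :=
    measurable_eval_uncurry.comp (measurable_fst.prodMk (hr.comp measurable_snd))
  have h0 : 0 ≤ C := (abs_nonneg _).trans (hC (0, 0))
  refine Integrable.mono' (((A.integrable_comp_fst (hM.integrable ⊤)).abs.add
    (integrable_const ((N : ℝ) + 1))).const_mul C) ?_ (Eventually.of_forall fun z => ?_)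
  · exact ((hg.comp (((measurable_eval ⊥).comp measurable_fst).prodMk hr')).mul
      (((continuous_cutoff N).measurable.comp hr').mul
        (((measurable_eval ⊤).comp measurable_fst).sub hr'))).aestronglyMeasurable
  · rw [norm_mul]
    exact mul_le_mul (hC _) (cutoff_mul_abs_sub_le N _ _) (norm_nonneg _) h0

/-- At rounded times the `dA`-integral is a finite sum over grid dates `r`. The weight of `r` is the
`dA`-mass of the times rounded up to `r`, which is known at time `r`; each summand is therefore a
bounded factor known at `r` times `X_T - X_r`. -/
theorem AveragingProcess.integral_cutoff_roundUp (N n : ℕ) {g : ℝ × ℝ → ℝ} (hg : Measurable g)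
    {C : ℝ} (hC : ∀ z, |g z| ≤ C) :
    ∫ z, g (z.1 ⊥, z.1 (roundUp n z.2)) * (cutoff N (z.1 (roundUp n z.2)) *
      (z.1 ⊤ - z.1 (roundUp n z.2))) ∂(P ⊗ₘ A.kernel) = 0 := by
  rw [Measure.integral_compProd (A.integrable_cutoff hM N hg hC (measurable_roundUp n))]
  set R := (finite_range_roundUp (T := T) n).toFinset
  have hmem : ∀ t : Icc (0 : ℝ) T, roundUp n t ∈ R := fun t => by simp [R]
  have hsub : ∀ r : Icc (0 : ℝ) T, roundUp n ⁻¹' {r} ∩ Iic r = roundUp n ⁻¹' {r} := fun r =>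
    inter_eq_left.2 fun t (ht : roundUp n t = r) => ht ▸ le_roundUp n t
  have hinner : ∀ ω : CadlagPath T, ∫ t, g (ω ⊥, ω (roundUp n t)) * (cutoff N (ω (roundUp n t)) *
      (ω ⊤ - ω (roundUp n t))) ∂(A.kernel ω) =
      ∑ r ∈ R, (g (ω ⊥, ω r) * cutoff N (ω r) * (A.path ω).measure.real (roundUp n ⁻¹' {r})) *
        (ω ⊤ - ω r) := by
    intro ω
    have h1 : (fun t => g (ω ⊥, ω (roundUp n t)) * (cutoff N (ω (roundUp n t)) *
        (ω ⊤ - ω (roundUp n t)))) = fun t => ∑ r ∈ R, (roundUp n ⁻¹' {r}).indicator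
          (fun _ => g (ω ⊥, ω r) * (cutoff N (ω r) * (ω ⊤ - ω r))) t := by
      ext t
      rw [Finset.sum_eq_single (roundUp n t)]
      · rw [indicator_of_mem (s := roundUp n ⁻¹' {roundUp n t}) (a := t) (mem_singleton _)]
      · intro r _ hr
        exact indicator_of_notMem (s := roundUp n ⁻¹' {r}) (fun h => hr (mem_singleton_iff.1 h).symm) _
      · exact fun h => absurd (hmem t) h
    have hms : ∀ r : Icc (0 : ℝ) T, MeasurableSet (roundUp n ⁻¹' {r}) := fun r =>
      measurable_roundUp n (measurableSet_singleton r)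
    rw [h1, integral_finsetSum _ fun r _ => (integrable_const _).indicator (hms r)]
    refine Finset.sum_congr rfl fun r _ => ?_
    rw [integral_indicator (hms r), setIntegral_const, A.kernel_apply, smul_eq_mul]
    ring
  simp_rw [hinner]
  have hterm : ∀ r ∈ R, Integrable (fun ω : CadlagPath T => (g (ω ⊥, ω r) * cutoff N (ω r) *
      (A.path ω).measure.real (roundUp n ⁻¹' {r})) * (ω ⊤ - ω r)) P ∧
      ∫ ω : CadlagPath T, (g (ω ⊥, ω r) * cutoff N (ω r) *
      (A.path ω).measure.real (roundUp n ⁻¹' {r})) * (ω ⊤ - ω r) ∂P = 0 := by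
    intro r _
    refine integral_mul_sub_eq_zero hM (le_top : r ≤ ⊤) (C := C) ?_ fun ω => ?_
    · refine Measurable.mul (Measurable.mul ?_ ?_) ?_
      · exact hg.comp ((measurable_pathFiltration bot_le).prodMk (measurable_pathFiltration le_rfl))
      · exact (continuous_cutoff N).measurable.comp (measurable_pathFiltration le_rfl)
      · have := A.measurable_measure_inter_Iic r (C := roundUp n ⁻¹' {r})
          (measurable_roundUp n (measurableSet_singleton r))
        rw [hsub] at this
        exact this.ennreal_toReal
    · rw [abs_mul, abs_mul, abs_of_nonneg (cutoff_nonneg N _), abs_of_nonneg measureReal_nonneg]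
      have h0 : 0 ≤ C := (abs_nonneg _).trans (hC (0, 0))
      calc |g (ω ⊥, ω r)| * cutoff N (ω r) * (A.path ω).measure.real (roundUp n ⁻¹' {r})
          ≤ C * 1 * 1 := by
            refine mul_le_mul (mul_le_mul (hC _) (cutoff_le_one N _) (cutoff_nonneg N _) h0)
              measureReal_le_one measureReal_nonneg (by positivity)
        _ = C := by ring
  rw [integral_finsetSum _ fun r hr => (hterm r hr).1]
  exact Finset.sum_eq_zero fun r hr => (hterm r hr).2

/-- Dominated convergence as the grid is refined; continuity of `g` carries the right-continuity of
the path over to the integrand. -/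
theorem AveragingProcess.integral_cutoff_of_continuous (N : ℕ) {g : ℝ × ℝ → ℝ} (hg : Continuous g)
    {C : ℝ} (hC : ∀ z, |g z| ≤ C) :
    ∫ z, g (z.1 ⊥, z.1 z.2) * (cutoff N (z.1 z.2) * (z.1 ⊤ - z.1 z.2)) ∂(P ⊗ₘ A.kernel) = 0 := by
  have h0 : 0 ≤ C := (abs_nonneg _).trans (hC (0, 0))
  have hlim := tendsto_integral_of_dominated_convergence (μ := P ⊗ₘ A.kernel)
    (F := fun n z => g (z.1 ⊥, z.1 (roundUp n z.2)) * (cutoff N (z.1 (roundUp n z.2)) *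
      (z.1 ⊤ - z.1 (roundUp n z.2))))
    (f := fun z => g (z.1 ⊥, z.1 z.2) * (cutoff N (z.1 z.2) * (z.1 ⊤ - z.1 z.2)))
    (fun z => C * (|z.1 ⊤| + ((N : ℝ) + 1)))
    (fun n => (A.integrable_cutoff hM N hg.measurable hC
      (measurable_roundUp n)).aestronglyMeasurable)
    (((A.integrable_comp_fst (hM.integrable ⊤)).abs.add (integrable_const _)).const_mul C)
    (fun n => Eventually.of_forall fun z => by
      rw [norm_mul]
      exact mul_le_mul (hC _) (cutoff_mul_abs_sub_le N _ _) (norm_nonneg _) h0)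
    (Eventually.of_forall fun z => by
      have h1 := z.1.cadlag.tendsto_comp_roundUp z.2
      exact ((hg.tendsto _).comp (tendsto_const_nhds.prodMk_nhds h1)).mul
        ((((continuous_cutoff N).tendsto _).comp h1).mul (tendsto_const_nhds.sub h1)))
  simp_rw [A.integral_cutoff_roundUp hM N _ hg.measurable hC] at hlim
  exact tendsto_nhds_unique hlim tendsto_const_nhds

/-- Trading at a bounded rate `g(X_0, X_t)`, restricted to bounded values of `X_t`, against `dA`
has zero expected gains. -/
theorem AveragingProcess.integral_cutoff (N : ℕ) {g : ℝ × ℝ → ℝ} (hg : Measurable g)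
    {C : ℝ} (hC : ∀ z, |g z| ≤ C) :
    ∫ z, g (z.1 ⊥, z.1 z.2) * (cutoff N (z.1 z.2) * (z.1 ⊤ - z.1 z.2)) ∂(P ⊗ₘ A.kernel) = 0 := by
  set m := P ⊗ₘ A.kernel
  set k : CadlagPath T × Icc (0 : ℝ) T → ℝ := fun z =>
    cutoff N (z.1 z.2) * (z.1 ⊤ - z.1 z.2) with hk
  set Z : CadlagPath T × Icc (0 : ℝ) T → ℝ × ℝ := fun z => (z.1 ⊥, z.1 z.2) with hZ
  have hZm : Measurable Z := ((measurable_eval ⊥).comp measurable_fst).prodMk measurable_eval_uncurry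
  have hkm : Measurable k := ((continuous_cutoff N).measurable.comp measurable_eval_uncurry).mul
    (((measurable_eval ⊤).comp measurable_fst).sub measurable_eval_uncurry)
  have hkm' : Measurable fun z => -k z := hkm.neg
  have hki : Integrable k m := by
    have := A.integrable_cutoff hM N (g := fun _ => 1) measurable_const (C := 1) (by simp)
      measurable_id
    simpa using this
  -- To pass from continuous to measurable `g`, the positive and negative parts of `k` are used as
  -- densities and pushed forward under `(X_0, X_t)`. The two finite measures agree on bounded
  -- continuous functions, hence coincide.
  have hfin1 : IsFiniteMeasure (m.withDensity fun z => ENNReal.ofReal (k z)) :=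
    isFiniteMeasure_withDensity_ofReal hki.2
  have hfin2 : IsFiniteMeasure (m.withDensity fun z => ENNReal.ofReal (-k z)) :=
    isFiniteMeasure_withDensity_ofReal hki.neg.2
  have hdiff : ∀ {g : ℝ × ℝ → ℝ} (_ : Measurable g) {C : ℝ} (_ : ∀ z, |g z| ≤ C),
      ∫ x, g x ∂((m.withDensity fun z => ENNReal.ofReal (k z)).map Z) -
        ∫ x, g x ∂((m.withDensity fun z => ENNReal.ofReal (-k z)).map Z) =
      ∫ z, g (Z z) * k z ∂m := by
    intro g hg C hC
    have hgm : AEStronglyMeasurable (fun z => g (Z z)) m := (hg.comp hZm).aestronglyMeasurable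
    rw [integral_map hZm.aemeasurable hg.aestronglyMeasurable,
      integral_map hZm.aemeasurable hg.aestronglyMeasurable,
      integral_withDensity_eq_integral_toReal_smul hkm.ennreal_ofReal
        (Eventually.of_forall fun _ => ENNReal.ofReal_lt_top),
      integral_withDensity_eq_integral_toReal_smul hkm'.ennreal_ofReal
        (Eventually.of_forall fun _ => ENNReal.ofReal_lt_top)]
    simp only [ENNReal.toReal_ofReal', smul_eq_mul]
    rw [← integral_sub]
    · congr 1
      ext z
      rw [← sub_mul, max_zero_sub_max_neg_zero_eq_self, mul_comm]
    · exact hki.pos_part.mul_bdd hgm (Eventually.of_forall fun z => hC _)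
    · exact hki.neg_part.mul_bdd hgm (Eventually.of_forall fun z => hC _)
  have heq : (m.withDensity fun z => ENNReal.ofReal (k z)).map Z =
      (m.withDensity fun z => ENNReal.ofReal (-k z)).map Z := by
    refine ext_of_forall_integral_eq_of_IsFiniteMeasure fun g => ?_
    have h1 := hdiff g.continuous.measurable (C := ‖g‖) fun z => g.norm_coe_le_norm z
    rw [A.integral_cutoff_of_continuous hM N g.continuous (C := ‖g‖)
      fun z => g.norm_coe_le_norm z] at h1
    exact sub_eq_zero.1 h1
  have h2 := hdiff hg hC
  rw [heq, sub_self] at h2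
  exact h2.symm

end

end

section

/-! ### Taylor's formula for convex functions -/

section Taylor

variable {I : Set ℝ} {g : ℝ → ℝ}

/-- The right derivative. -/
def rightDeriv (g : ℝ → ℝ) (x : ℝ) : ℝ := derivWithin g (Ioi x) x

theorem monotoneOn_rightDeriv (ho : IsOpen I) (hg : ConvexOn ℝ I g) :
    MonotoneOn (rightDeriv g) I := by
  have := hg.monotoneOn_rightDeriv
  rwa [ho.interior_eq] at this

theorem hasDerivWithinAt_rightDeriv (ho : IsOpen I) (hg : ConvexOn ℝ I g) {x : ℝ} (hx : x ∈ I) :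
    HasDerivWithinAt g (rightDeriv g x) (Ioi x) x :=
  hg.hasDerivWithinAt_rightDeriv_of_mem_interior (ho.interior_eq.symm ▸ hx)

theorem rightDeriv_mul_le (ho : IsOpen I) (hg : ConvexOn ℝ I g) {x y : ℝ} (hx : x ∈ I)
    (hy : y ∈ I) : g x + rightDeriv g x * (y - x) ≤ g y := by
  have hxi : x ∈ interior I := ho.interior_eq.symm ▸ hx
  rcases lt_trichotomy x y with h | rfl | h
  · have := hg.rightDeriv_le_slope_of_mem_interior hxi hy h
    rw [slope_def_field, le_div_iff₀ (sub_pos.2 h)] at this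
    change rightDeriv g x * _ ≤ _ at this
    linarith
  · simp
  · have h1 := hg.slope_le_leftDeriv_of_mem_interior hy hxi h
    have h2 := h1.trans (hg.leftDeriv_le_rightDeriv_of_mem_interior hxi)
    rw [slope_def_field, div_le_iff₀ (sub_pos.2 h)] at h2
    change _ ≤ rightDeriv g x * _ at h2
    linarith

/-- The right derivative of a convex function is right-continuous. -/
theorem le_rightDeriv_of_forall_le (ho : IsOpen I) (hg : ConvexOn ℝ I g) {x c : ℝ} (hx : x ∈ I)
    (hc : ∀ y ∈ I, x < y → c ≤ rightDeriv g y) : c ≤ rightDeriv g x := by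
  have hI : ∀ᶠ y in 𝓝[>] x, y ∈ I := nhdsWithin_le_nhds (ho.mem_nhds hx)
  -- The supporting lines at `y ∈ (x, z)` give `c (z - y) ≤ g z - g y`; let `y` decrease to `x`.
  have h1 : ∀ z ∈ I, x < z → c * (z - x) ≤ g z - g x := by
    intro z hz hxz
    have hcont : ContinuousAt g x := (hg.continuousOn ho).continuousAt (ho.mem_nhds hx)
    have hl : Tendsto (fun y => c * (z - y)) (𝓝[>] x) (𝓝 (c * (z - x))) :=
      (tendsto_const_nhds.mul (tendsto_const_nhds.sub tendsto_id)).mono_left nhdsWithin_le_nhds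
    have hr : Tendsto (fun y => g z - g y) (𝓝[>] x) (𝓝 (g z - g x)) :=
      (tendsto_const_nhds.sub hcont.tendsto).mono_left nhdsWithin_le_nhds
    refine le_of_tendsto_of_tendsto hl hr ?_
    filter_upwards [hI, Ioo_mem_nhdsGT hxz] with y hy hyz
    have h2 := rightDeriv_mul_le ho hg hy hz
    have h3 := mul_le_mul_of_nonneg_right (hc y hy hyz.1) (sub_nonneg.2 hyz.2.le)
    linarith
  have h2 := (hasDerivWithinAt_iff_tendsto_slope' self_notMem_Ioi).1
    (hasDerivWithinAt_rightDeriv ho hg hx)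
  refine ge_of_tendsto h2 ?_
  filter_upwards [hI, self_mem_nhdsWithin] with z hz hxz
  rw [slope_def_field, le_div_iff₀ (sub_pos.2 hxz)]
  exact h1 z hz hxz

/-- The Stieltjes function is built from right limits, which return the right derivative itself by
its right-continuity. -/
theorem secondDerivMeasure_Ioc (ho : IsOpen I) (hI : I.OrdConnected) (hg : ConvexOn ℝ I g)
    (a b : I) : secondDerivMeasure I g (Ioc a b) =
      ENNReal.ofReal (rightDeriv g b - rightDeriv g a) := by
  have hm : Monotone (fun x : I => derivWithin g (Ioi (x : ℝ)) (x : ℝ)) := fun x y hxy =>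
    monotoneOn_rightDeriv ho hg x.2 y.2 hxy
  have : CompactIccSpace I := compactIccSpace_of_ordConnected hI
  have hlim : ∀ x : I, Function.rightLim (fun x : I => derivWithin g (Ioi (x : ℝ)) (x : ℝ)) x =
      rightDeriv g x := by
    intro x
    refine le_antisymm ?_ (hm.le_rightLim le_rfl)
    exact le_rightDeriv_of_forall_le ho hg x.2 fun y hy hxy =>
      hm.rightLim_le (show x < ⟨y, hy⟩ from hxy)
  rw [secondDerivMeasure, dif_pos ⟨hI, hm⟩, StieltjesFunction.measure_Ioc,
    hm.stieltjesFunction_eq, hm.stieltjesFunction_eq, hlim, hlim]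

theorem sFinite_secondDerivMeasure : SFinite (secondDerivMeasure I g) := by
  unfold secondDerivMeasure
  split_ifs with h
  · have := h.1
    have : CompactIccSpace I := compactIccSpace_of_ordConnected h.1
    infer_instance
  · infer_instance

theorem integral_rightDeriv (ho : IsOpen I) (hI : I.OrdConnected) (hg : ConvexOn ℝ I g) {x z : ℝ}
    (hx : x ∈ I) (hz : z ∈ I) (hxz : x ≤ z) :
    IntervalIntegrable (rightDeriv g) volume x z ∧ ∫ y in x..z, rightDeriv g y = g z - g x := by
  have hsub : Icc x z ⊆ I := hI.out hx hz
  have hint : IntervalIntegrable (rightDeriv g) volume x z :=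
    ((monotoneOn_rightDeriv ho hg).mono (by rwa [uIcc_of_le hxz])).intervalIntegrable
  exact ⟨hint, intervalIntegral.integral_eq_sub_of_hasDeriv_right_of_le hxz
    ((hg.continuousOn ho).mono hsub)
    (fun y hy => hasDerivWithinAt_rightDeriv ho hg (hsub (Ioo_subset_Icc_self hy))) hint⟩

/-- The kernel of Taylor's formula, `½ (|z - s| - |x - s| - sgn(x - s) (z - x))`. -/
def taylorKernel (s x z : ℝ) : ℝ≥0∞ :=
  if s ≤ x then ENNReal.ofReal (s - z) else ENNReal.ofReal (z - s)

/-- For `s > x` the kernel is the length of `[s, z)`. Exchanging the integrals over `s` and `y`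
leaves the integral of `g'(y) - g'(x)` over `(x, z)`. -/
theorem lintegral_taylorKernel_of_le (ho : IsOpen I) (hI : I.OrdConnected) (hg : ConvexOn ℝ I g)
    {x z : ℝ} (hx : x ∈ I) (hz : z ∈ I) (hxz : x ≤ z) :
    ∫⁻ s : I, taylorKernel s x z ∂(secondDerivMeasure I g) =
      ENNReal.ofReal (g z - g x - rightDeriv g x * (z - x)) := by
  have := sFinite_secondDerivMeasure (I := I) (g := g)
  obtain ⟨hint, hval⟩ := integral_rightDeriv ho hI hg hx hz hxz
  -- The strict and weak inequalities make the section in `s` exactly `(x, y]`, the form evaluated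
  -- by `secondDerivMeasure_Ioc`.
  set A : Set (I × ℝ) := {p | x < p.1 ∧ (p.1 : ℝ) ≤ p.2 ∧ p.2 < z} with hA
  have hAm : MeasurableSet A := by
    have h1 : Measurable fun p : I × ℝ => (p.1 : ℝ) := measurable_subtype_coe.comp measurable_fst
    exact (measurableSet_lt measurable_const h1).inter
      ((measurableSet_le h1 measurable_snd).inter (measurableSet_lt measurable_snd measurable_const))
  have h1 : ∀ s : I, taylorKernel s x z = ∫⁻ y, A.indicator 1 (s, y) := by
    intro s
    have hs : (fun y => A.indicator (1 : I × ℝ → ℝ≥0∞) (s, y)) =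
        (if (s : ℝ) ≤ x then ∅ else Ico (s : ℝ) z).indicator 1 := by
      ext y
      split_ifs with h
      · simp [hA, indicator, not_lt.2 h]
      · simp [hA, indicator, not_le.1 h]
    rw [hs, taylorKernel]
    split_ifs with h
    · simp [ENNReal.ofReal_eq_zero, h.trans hxz]
    · rw [lintegral_indicator_one measurableSet_Ico, Real.volume_Ico]
  have h2 : ∀ y, ∫⁻ s : I, A.indicator 1 (s, y) ∂(secondDerivMeasure I g) =
      (Ioo x z).indicator (fun y => ENNReal.ofReal (rightDeriv g y - rightDeriv g x)) y := by
    intro y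
    by_cases hy : y ∈ Ioo x z
    · have hyI : y ∈ I := hI.out hx hz (Ioo_subset_Icc_self hy)
      rw [indicator_of_mem hy, ← secondDerivMeasure_Ioc ho hI hg ⟨x, hx⟩ ⟨y, hyI⟩,
        ← lintegral_indicator_one measurableSet_Ioc]
      congr 1
      ext s
      simp only [indicator, hA, mem_ofPred_eq, hy.2, and_true, mem_Ioc, Pi.one_apply]
      rfl
    · rw [indicator_of_notMem hy]
      have : ∀ s : I, A.indicator (1 : I × ℝ → ℝ≥0∞) (s, y) = 0 := fun s =>
        indicator_of_notMem (fun h => hy ⟨h.1.trans_le h.2.1, h.2.2⟩) _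
      simp [this]
  simp_rw [h1]
  rw [lintegral_lintegral_swap (f := fun (s : I) (y : ℝ) => A.indicator 1 (s, y))
    (measurable_one.indicator hAm).aemeasurable]
  simp_rw [h2]
  rw [lintegral_indicator measurableSet_Ioo, Measure.restrict_congr_set Ioo_ae_eq_Ioc,
    ← ofReal_integral_eq_lintegral_ofReal]
  · rw [← intervalIntegral.integral_of_le hxz, intervalIntegral.integral_sub hint (by simp), hval]
    simp
    ring_nf
  · exact (hint.sub (by simp)).1
  · rw [EventuallyLE, ae_restrict_iff' measurableSet_Ioc]
    refine Eventually.of_forall fun y hy => sub_nonneg.2 ?_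
    exact monotoneOn_rightDeriv ho hg hx (hI.out hx hz (Ioc_subset_Icc_self hy)) hy.1.le

theorem lintegral_taylorKernel_of_ge (ho : IsOpen I) (hI : I.OrdConnected) (hg : ConvexOn ℝ I g)
    {x z : ℝ} (hx : x ∈ I) (hz : z ∈ I) (hxz : z ≤ x) :
    ∫⁻ s : I, taylorKernel s x z ∂(secondDerivMeasure I g) =
      ENNReal.ofReal (g z - g x - rightDeriv g x * (z - x)) := by
  have := sFinite_secondDerivMeasure (I := I) (g := g)
  obtain ⟨hint, hval⟩ := integral_rightDeriv ho hI hg hz hx hxz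
  -- Here the section in `s` is `(y, x]`; an atom of the second derivative at `x` is counted on this
  -- side, consistently with the use of the right derivative.
  set A : Set (I × ℝ) := {p | z < p.2 ∧ p.2 < p.1 ∧ (p.1 : ℝ) ≤ x} with hA
  have hAm : MeasurableSet A := by
    have h1 : Measurable fun p : I × ℝ => (p.1 : ℝ) := measurable_subtype_coe.comp measurable_fst
    exact (measurableSet_lt measurable_const measurable_snd).inter
      ((measurableSet_lt measurable_snd h1).inter (measurableSet_le h1 measurable_const))
  have h1 : ∀ s : I, taylorKernel s x z = ∫⁻ y, A.indicator 1 (s, y) := by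
    intro s
    have hs : (fun y => A.indicator (1 : I × ℝ → ℝ≥0∞) (s, y)) =
        (if (s : ℝ) ≤ x then Ioo z (s : ℝ) else ∅).indicator 1 := by
      ext y
      split_ifs with h
      · simp [hA, indicator, h]
      · simp [hA, indicator, h]
    rw [hs, taylorKernel]
    split_ifs with h
    · rw [lintegral_indicator_one measurableSet_Ioo, Real.volume_Ioo]
    · simp [ENNReal.ofReal_eq_zero, hxz.trans (not_le.1 h).le]
  have h2 : ∀ y, ∫⁻ s : I, A.indicator 1 (s, y) ∂(secondDerivMeasure I g) =
      (Ioo z x).indicator (fun y => ENNReal.ofReal (rightDeriv g x - rightDeriv g y)) y := by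
    intro y
    by_cases hy : y ∈ Ioo z x
    · have hyI : y ∈ I := hI.out hz hx (Ioo_subset_Icc_self hy)
      rw [indicator_of_mem hy, ← secondDerivMeasure_Ioc ho hI hg ⟨y, hyI⟩ ⟨x, hx⟩,
        ← lintegral_indicator_one measurableSet_Ioc]
      congr 1
      ext s
      simp only [indicator, hA, mem_ofPred_eq, hy.1, true_and, mem_Ioc, Pi.one_apply]
      rfl
    · rw [indicator_of_notMem hy]
      have : ∀ s : I, A.indicator (1 : I × ℝ → ℝ≥0∞) (s, y) = 0 := fun s =>
        indicator_of_notMem (fun h => hy ⟨h.1, h.2.1.trans_le h.2.2⟩) _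
      simp [this]
  simp_rw [h1]
  rw [lintegral_lintegral_swap (f := fun (s : I) (y : ℝ) => A.indicator 1 (s, y))
    (measurable_one.indicator hAm).aemeasurable]
  simp_rw [h2]
  rw [lintegral_indicator measurableSet_Ioo, Measure.restrict_congr_set Ioo_ae_eq_Ioc,
    ← ofReal_integral_eq_lintegral_ofReal]
  · rw [← intervalIntegral.integral_of_le hxz, intervalIntegral.integral_sub (by simp) hint, hval]
    simp
    ring_nf
  · exact (IntervalIntegrable.sub (by simp) hint).1
  · rw [EventuallyLE, ae_restrict_iff' measurableSet_Ioc]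
    refine Eventually.of_forall fun y hy => sub_nonneg.2 ?_
    exact monotoneOn_rightDeriv ho hg (hI.out hz hx (Ioc_subset_Icc_self hy)) hx hy.2

theorem lintegral_taylorKernel (ho : IsOpen I) (hI : I.OrdConnected) (hg : ConvexOn ℝ I g)
    {x z : ℝ} (hx : x ∈ I) (hz : z ∈ I) :
    ∫⁻ s : I, taylorKernel s x z ∂(secondDerivMeasure I g) =
      ENNReal.ofReal (g z - g x - rightDeriv g x * (z - x)) := by
  rcases le_total x z with h | h
  · exact lintegral_taylorKernel_of_le ho hI hg hx hz h
  · exact lintegral_taylorKernel_of_ge ho hI hg hx hz h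

end Taylor

end

section

/-! ### The concave integral dominates the concavity gap -/

section Gap

variable {I : Set ℝ} {g : ℝ → ℝ}

theorem taylorKernel_mono {s x y z : ℝ} (h : x < y ∧ y < z ∨ z < y ∧ y < x) :
    taylorKernel s x y ≤ taylorKernel s x z := by
  unfold taylorKernel
  split_ifs with hs
  · rcases h with h | h
    · rw [ENNReal.ofReal_of_nonpos (by linarith)]
      exact zero_le
    · exact ENNReal.ofReal_le_ofReal (by linarith)
  · rcases h with h | h
    · exact ENNReal.ofReal_le_ofReal (by linarith)
    · rw [ENNReal.ofReal_of_nonpos (by linarith)]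
      exact zero_le

/-- The distance of a convex function to a tangent increases away from the point of tangency. -/
theorem sub_tangent_mono (ho : IsOpen I) (hg : ConvexOn ℝ I g) {x y z : ℝ} (hx : x ∈ I)
    (hy : y ∈ I) (hz : z ∈ I) (h : x < y ∧ y ≤ z ∨ z ≤ y ∧ y < x) :
    g y - rightDeriv g x * y ≤ g z - rightDeriv g x * z := by
  have h1 := rightDeriv_mul_le ho hg hy hz
  have hm := monotoneOn_rightDeriv ho hg
  rcases h with h | h
  · nlinarith [hm hx hy h.1.le]
  · nlinarith [hm hy hx h.2.le]

/-- After subtracting the tangent at `x`, the function increases towards the endpoint `z` and is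
bounded by `c`, so it has a limit. Taylor's formula passes to this limit as an inequality because
the kernel grows as `y` moves towards `z`. -/
theorem exists_tendsto_of_mem_closure (ho : IsOpen I) (hI : I.OrdConnected) (hg : ConvexOn ℝ I g)
    {x z c : ℝ} (hx : x ∈ I) (hz : z ∈ closure I) (hzI : z ∉ I)
    (hc : ∀ y ∈ I, x < y ∧ y < z ∨ z < y ∧ y < x → g y - rightDeriv g x * y ≤ c) :
    ∃ L, Tendsto g (𝓝[I] z) (𝓝 L) ∧ ENNReal.ofReal (L - g x - rightDeriv g x * (z - x)) ≤
      ∫⁻ s : I, taylorKernel s x z ∂(secondDerivMeasure I g) := by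
  have hne : (𝓝[I] z).NeBot := mem_closure_iff_nhdsWithin_neBot.1 hz
  set k : ℝ → ℝ := fun y => g y - rightDeriv g x * y with hk
  have hbetween : ∀ᶠ y in 𝓝[I] z, y ∈ I ∧ (x < y ∧ y < z ∨ z < y ∧ y < x) := by
    rcases lt_trichotomy x z with h | rfl | h
    · filter_upwards [self_mem_nhdsWithin, mem_nhdsWithin_of_mem_nhds (Ioi_mem_nhds h)] with y hy hxy
      exact ⟨hy, Or.inl ⟨hxy, lt_of_not_ge fun hzy => hzI (hI.out hx hy ⟨h.le, hzy⟩)⟩⟩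
    · exact absurd hx hzI
    · filter_upwards [self_mem_nhdsWithin, mem_nhdsWithin_of_mem_nhds (Iio_mem_nhds h)] with y hy hxy
      exact ⟨hy, Or.inr ⟨lt_of_not_ge fun hzy => hzI (hI.out hy hx ⟨hzy, h.le⟩), hxy⟩⟩
  have hlim : ∃ L, Tendsto k (𝓝[I] z) (𝓝 L) := by
    rcases lt_trichotomy x z with h | rfl | h
    · have hsub : Ioo x z ⊆ I := Ioo_subset_of_mem_closure hI (subset_closure hx) hz
      refine ⟨_, (MonotoneOn.tendsto_nhdsWithin_Ioo_left (nonempty_Ioo.2 h) (f := k)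
        (fun y hy w hw hyw => ?_) ⟨c, ?_⟩).mono_left (nhdsWithin_mono _ fun y hy =>
          lt_of_not_ge fun hzy => hzI (hI.out hx hy ⟨h.le, hzy⟩))⟩
      · exact sub_tangent_mono ho hg hx (hsub hy) (hsub hw) (Or.inl ⟨hy.1, hyw⟩)
      · rintro _ ⟨y, hy, rfl⟩
        exact hc y (hsub hy) (Or.inl hy)
    · exact absurd hx hzI
    · have hsub : Ioo z x ⊆ I := Ioo_subset_of_mem_closure hI hz (subset_closure hx)
      refine ⟨_, (AntitoneOn.tendsto_nhdsWithin_Ioo_right (nonempty_Ioo.2 h) (f := k)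
        (fun y hy w hw hyw => ?_) ⟨c, ?_⟩).mono_left (nhdsWithin_mono _ fun y hy =>
          lt_of_not_ge fun hzy => hzI (hI.out hy hx ⟨hzy, h.le⟩))⟩
      · exact sub_tangent_mono ho hg hx (hsub hw) (hsub hy) (Or.inr ⟨hyw, hw.2⟩)
      · rintro _ ⟨y, hy, rfl⟩
        exact hc y (hsub hy) (Or.inr hy)
  obtain ⟨L, hL⟩ := hlim
  have hid : Tendsto (fun y : ℝ => rightDeriv g x * y) (𝓝[I] z) (𝓝 (rightDeriv g x * z)) :=
    (tendsto_const_nhds.mul tendsto_id).mono_left nhdsWithin_le_nhds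
  have hgL : Tendsto g (𝓝[I] z) (𝓝 (L + rightDeriv g x * z)) :=
    (hL.add hid).congr fun y => by simp [hk]
  refine ⟨_, hgL, le_of_tendsto (f := fun y => ENNReal.ofReal
    (g y - g x - rightDeriv g x * (y - x))) (x := 𝓝[I] z) ?_ ?_⟩
  · refine ENNReal.tendsto_ofReal ((hgL.sub_const (g x)).sub ?_)
    exact (tendsto_const_nhds.mul (tendsto_id.sub_const x)).mono_left nhdsWithin_le_nhds
  · filter_upwards [hbetween] with y hy
    rw [← lintegral_taylorKernel ho hI hg hx hy.1]
    exact lintegral_mono fun s => taylorKernel_mono hy.2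

/-- Inside `I` this is Taylor's formula for `-χ`. At an endpoint the formula sees only the limit of
`χ` from within `I`, and the jump term pays for the difference. -/
theorem ofReal_gap_le {J : Set ℝ} {χ : ℝ → ℝ} (ho : IsOpen I) (hI : I.OrdConnected)
    (hIJ : I ⊆ J) (hJ : J ⊆ closure I) (hχ : ConcaveOn ℝ J χ) {x z : ℝ} (hx : x ∈ I) (hz : z ∈ J) :
    ENNReal.ofReal (χ x - χ z - rightDeriv (fun y => -χ y) x * (z - x)) ≤
      (∫⁻ s : I, taylorKernel s x z ∂(secondDerivMeasure I fun y => -χ y)) +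
        (J \ I).indicator (fun y => ENNReal.ofReal |jumpAt I χ y|) z := by
  set g : ℝ → ℝ := fun y => -χ y with hg_def
  have hgJ : ConvexOn ℝ J g := hχ.neg
  have hg : ConvexOn ℝ I g := hgJ.subset hIJ hI.convex
  by_cases hzI : z ∈ I
  · rw [lintegral_taylorKernel ho hI hg hx hzI]
    refine le_add_right (le_of_eq ?_)
    simp only [hg_def]
    ring_nf
  rw [indicator_of_mem (show z ∈ J \ I from ⟨hz, hzI⟩)]
  -- On a segment, a convex function is bounded by its larger end value; since `z ∈ J`, this value
  -- at `z` is finite.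
  have hc : ∀ y ∈ I, x < y ∧ y < z ∨ z < y ∧ y < x → g y - rightDeriv g x * y ≤
      max (g x - rightDeriv g x * x) (g z - rightDeriv g x * z) := by
    intro y hy h
    have hconv : ConvexOn ℝ J (fun y => g y - rightDeriv g x * y) :=
      hgJ.sub ((LinearMap.mulLeft ℝ (rightDeriv g x)).concaveOn hgJ.1)
    refine hconv.le_on_segment (hIJ hx) hz ?_
    rw [segment_eq_uIcc]
    rcases h with h | h
    · exact Icc_subset_uIcc ⟨h.1.le, h.2.le⟩
    · exact Icc_subset_uIcc' ⟨h.1.le, h.2.le⟩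
  obtain ⟨L, hL, hle⟩ := exists_tendsto_of_mem_closure ho hI hg hx (hJ hz) hzI hc
  have hne : (𝓝[I] z).NeBot := mem_closure_iff_nhdsWithin_neBot.1 (hJ hz)
  have hjump : jumpAt I χ z = χ z + L := by
    have h1 : Tendsto χ (𝓝[I] z) (𝓝 (-L)) := by simpa [hg_def] using hL.neg
    rw [jumpAt, h1.limUnder_eq, sub_neg_eq_add]
  calc _ ≤ ENNReal.ofReal ((L - g x - rightDeriv g x * (z - x)) + |jumpAt I χ z|) := by
        refine ENNReal.ofReal_le_ofReal ?_
        have := neg_abs_le (jumpAt I χ z)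
        rw [hjump] at this ⊢
        have hgx : g x = -χ x := rfl
        change _ ≤ L - g x - rightDeriv g x * (z - x) + _
        linarith
    _ ≤ _ := ENNReal.ofReal_add_le.trans (add_le_add hle le_rfl)

end Gap

/-! ### The expected concavity gap under a martingale coupling -/

section Coupling

variable {T : ℝ} [Fact (0 ≤ T)] {μ ν : Measure ℝ} [IsFiniteMeasure μ] [IsFiniteMeasure ν]
  {P : Measure (CadlagPath T)}

theorem taylorKernel_eq (s x z : ℝ) : taylorKernel s x z = ENNReal.ofReal
    (2⁻¹ * (|s - z| - |s - x| - (if s ≤ x then 1 else -1) * (z - x))) ∧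
    0 ≤ 2⁻¹ * (|s - z| - |s - x| - (if s ≤ x then 1 else -1) * (z - x)) := by
  unfold taylorKernel
  split_ifs with h
  · rw [abs_of_nonpos (sub_nonpos.2 h)]
    rcases le_total s z with h' | h'
    · rw [abs_of_nonpos (sub_nonpos.2 h'), ENNReal.ofReal_of_nonpos (sub_nonpos.2 h'), eq_comm,
        ENNReal.ofReal_eq_zero]
      constructor <;> linarith
    · rw [abs_of_nonneg (sub_nonneg.2 h')]
      refine ⟨?_, by linarith⟩
      congr 1
      ring
  · rw [abs_of_nonneg (sub_nonneg.2 (not_le.1 h).le)]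
    rcases le_total s z with h' | h'
    · rw [abs_of_nonpos (sub_nonpos.2 h')]
      refine ⟨?_, by linarith⟩
      congr 1
      ring
    · rw [abs_of_nonneg (sub_nonneg.2 h'), ENNReal.ofReal_of_nonpos (sub_nonpos.2 h'), eq_comm,
        ENNReal.ofReal_eq_zero]
      constructor <;> linarith

theorem IsMartingaleCoupling.integrable_zero (hP : IsMartingaleCoupling μ ν P) {k : ℝ → ℝ}
    (hk : Integrable k μ) : Integrable (fun ω => k (ω ⊥)) P := by
  rw [← hP.map_zero] at hk
  exact hk.comp_measurable (measurable_eval ⊥)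

theorem IsMartingaleCoupling.integral_zero (hP : IsMartingaleCoupling μ ν P) {k : ℝ → ℝ}
    (hk : AEStronglyMeasurable k μ) : ∫ ω, k (ω ⊥) ∂P = ∫ x, k x ∂μ := by
  have h := integral_map (measurable_eval (T := T) ⊥).aemeasurable (hP.map_zero.symm ▸ hk)
  rw [hP.map_zero] at h
  exact h.symm

theorem IsMartingaleCoupling.integrable_top (hP : IsMartingaleCoupling μ ν P) {k : ℝ → ℝ}
    (hk : Integrable k ν) : Integrable (fun ω => k (ω ⊤)) P := by
  rw [← hP.map_top] at hk
  exact hk.comp_measurable (measurable_eval ⊤)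

theorem IsMartingaleCoupling.integral_top (hP : IsMartingaleCoupling μ ν P) {k : ℝ → ℝ}
    (hk : AEStronglyMeasurable k ν) : ∫ ω, k (ω ⊤) ∂P = ∫ x, k x ∂ν := by
  have h := integral_map (measurable_eval (T := T) ⊤).aemeasurable (hP.map_top.symm ▸ hk)
  rw [hP.map_top] at h
  exact h.symm

theorem IsMartingaleCoupling.integral_zero_mul (hP : IsMartingaleCoupling μ ν P) {k : ℝ → ℝ}
    (hk : Measurable k) {C : ℝ} (hC : ∀ x, |k x| ≤ C) :
    Integrable (fun ω => k (ω ⊥) * (ω ⊤ - ω ⊥)) P ∧ ∫ ω, k (ω ⊥) * (ω ⊤ - ω ⊥) ∂P = 0 := by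
  have := hP.finite
  exact integral_mul_sub_eq_zero hP.martingale (bot_le : (⊥ : Icc (0 : ℝ) T) ≤ ⊤)
    (Y := fun ω => k (ω ⊥)) (hk.comp (measurable_pathFiltration le_rfl)) fun ω => hC _

/-- The absolute values in the kernel integrate to the potentials. The remaining term is a bounded
function of `X_0` times `X_T - X_0`, which has mean zero. -/
theorem IsMartingaleCoupling.lintegral_taylorKernel (h : IsIrreducible μ ν)
    (hP : IsMartingaleCoupling μ ν P) (s : ℝ) : ∫⁻ ω, taylorKernel s (ω ⊥) (ω ⊤) ∂P =
      2⁻¹ * ENNReal.ofReal (potential ν s - potential μ s) := by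
  have hν := integrable_abs_sub h.convexOrder.2.1 s
  have hμ := integrable_abs_sub h.convexOrder.1 s
  have hσ : Measurable fun x : ℝ => if s ≤ x then (1 : ℝ) else -1 :=
    Measurable.ite measurableSet_Ici measurable_const measurable_const
  obtain ⟨h1, h2⟩ := hP.integral_zero_mul hσ (C := 1) fun x => by split_ifs <;> simp
  have h3 := hP.integrable_top hν
  have h4 := hP.integrable_zero hμ
  have h5 : Integrable (fun ω : CadlagPath T => 2⁻¹ * (|s - ω ⊤| - |s - ω ⊥| -
      (if s ≤ ω ⊥ then 1 else -1) * (ω ⊤ - ω ⊥))) P := ((h3.sub h4).sub h1).const_mul _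
  simp_rw [(taylorKernel_eq s _ _).1]
  rw [← ofReal_integral_eq_lintegral_ofReal h5
    (Eventually.of_forall fun ω => (taylorKernel_eq s _ _).2), integral_const_mul,
    integral_sub (f := fun ω : CadlagPath T => |s - ω ⊤| - |s - ω ⊥|) (h3.sub h4) h1, h2, integral_sub h3 h4,
    hP.integral_top hν.aestronglyMeasurable (k := fun z => |s - z|),
    hP.integral_zero hμ.aestronglyMeasurable (k := fun z => |s - z|), sub_zero,
    ENNReal.ofReal_mul (by norm_num), ENNReal.ofReal_inv_of_pos two_pos, ENNReal.ofReal_ofNat]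
  rfl

/-- Take expectations in `ofReal_gap_le` and exchange them with the integral against `-χ''`. The
subtracted `μ`-part of the jump term vanishes because `μ` lives on `I`. -/
theorem IsMartingaleCoupling.lintegral_gap_le (h : IsIrreducible μ ν)
    (hP : IsMartingaleCoupling μ ν P) {χ : ℝ → ℝ} (hχ : ConcaveOn ℝ (domJ μ ν) χ) :
    ∫⁻ ω, ENNReal.ofReal (χ (ω ⊥) - χ (ω ⊤) - rightDeriv (fun y => -χ y) (ω ⊥) * (ω ⊤ - ω ⊥)) ∂P ≤
      concaveIntegral (domI μ ν) (domJ μ ν) μ ν χ := by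
  have := hP.finite
  set m := secondDerivMeasure (domI μ ν) fun y => -χ y with hm
  have hmfin : SFinite m := sFinite_secondDerivMeasure
  set F : ℝ → ℝ≥0∞ := (domJ μ ν \ domI μ ν).indicator
    (fun y => ENNReal.ofReal |jumpAt (domI μ ν) χ y|) with hF
  have hFm : Measurable F := by
    have := h.finite_domJ_diff.to_subtype
    exact measurable_indicator_of_domRestrict h.finite_domJ_diff.measurableSet
      (measurable_of_finite _)
  have hK : Measurable fun p : CadlagPath T × domI μ ν => taylorKernel p.2 (p.1 ⊥) (p.1 ⊤) := by
    have h0 : Measurable fun p : CadlagPath T × domI μ ν => p.1 ⊥ :=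
      (measurable_eval ⊥).comp measurable_fst
    have h1 : Measurable fun p : CadlagPath T × domI μ ν => p.1 ⊤ :=
      (measurable_eval ⊤).comp measurable_fst
    have h2 : Measurable fun p : CadlagPath T × domI μ ν => (p.2 : ℝ) :=
      measurable_subtype_coe.comp measurable_snd
    exact Measurable.ite (measurableSet_le h2 h0) (h2.sub h1).ennreal_ofReal
      (h1.sub h2).ennreal_ofReal
  have hle : ∫⁻ ω, ENNReal.ofReal (χ (ω ⊥) - χ (ω ⊤) -
      rightDeriv (fun y => -χ y) (ω ⊥) * (ω ⊤ - ω ⊥)) ∂P ≤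
      ∫⁻ ω, ((∫⁻ s : domI μ ν, taylorKernel s (ω ⊥) (ω ⊤) ∂m) + F (ω ⊤)) ∂P := by
    refine lintegral_mono_ae ?_
    filter_upwards [hP.ae_mem_relevantPaths h] with ω hω
    exact ofReal_gap_le h.isOpen_domI h.ordConnected_domI domI_subset_domJ domJ_subset_closure hχ
      hω.1 (mem_domJ_of_mem_relevantPaths hω ⊤)
  have hzero : ∫⁻ x in domJ μ ν \ domI μ ν, ENNReal.ofReal |jumpAt (domI μ ν) χ x| ∂μ = 0 := by
    have h0 : μ (domJ μ ν \ domI μ ν) = 0 :=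
      measure_mono_null (fun x hx => hx.2) h.ae_mem_domI
    rw [Measure.restrict_eq_zero.2 h0, lintegral_zero_measure]
  have hFν : ∫⁻ x, F x ∂ν = ∫⁻ ω : CadlagPath T, F (ω ⊤) ∂P := by
    rw [← lintegral_map hFm (measurable_eval ⊤), hP.map_top]
  refine hle.trans (le_of_eq ?_)
  rw [lintegral_add_left hK.lintegral_prod_right', lintegral_lintegral_swap hK.aemeasurable]
  simp_rw [hP.lintegral_taylorKernel h]
  rw [concaveIntegral, hzero, tsub_zero, ← lintegral_indicator h.finite_domJ_diff.measurableSet,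
    ← hF, lintegral_const_mul' _ _ (by norm_num), hFν]

end Coupling

end

section

/-! ### Expectation bounds -/

/-- Fatou's lemma, in the form used to remove truncations. -/
theorem lintegral_le_of_tendsto {Ω : Type*} {m0 : MeasurableSpace Ω} {P : Measure Ω}
    {f : ℕ → Ω → ℝ≥0∞} {F : Ω → ℝ≥0∞} {c : ℕ → ℝ≥0∞} {C : ℝ≥0∞} (hf : ∀ n, AEMeasurable (f n) P)
    (hF : ∀ᵐ ω ∂P, Tendsto (fun n => f n ω) atTop (𝓝 (F ω))) (hc : ∀ n, ∫⁻ ω, f n ω ∂P ≤ c n)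
    (hC : Tendsto c atTop (𝓝 C)) : ∫⁻ ω, F ω ∂P ≤ C := by
  calc ∫⁻ ω, F ω ∂P = ∫⁻ ω, liminf (fun n => f n ω) atTop ∂P :=
        lintegral_congr_ae (hF.mono fun ω hω => hω.liminf_eq.symm)
    _ ≤ liminf (fun n => ∫⁻ ω, f n ω ∂P) atTop := lintegral_liminf_le' hf
    _ ≤ liminf c atTop := liminf_le_liminf (Eventually.of_forall hc)
    _ = C := hC.liminf_eq

section Expectation

variable {T : ℝ} [Fact (0 ≤ T)] {μ ν : Measure ℝ} [IsFiniteMeasure μ] [IsFiniteMeasure ν]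
  {P : Measure (CadlagPath T)} {p q φ' ψ' : ℝ → ℝ}

/-- The value `p(X_0) + q(X_T) + φ'(X_0) (X_T - X_0)`, where `φ'` is set to `0` outside `I`. -/
def baseValue (I : Set ℝ) (p q φ' : ℝ → ℝ) (ω : CadlagPath T) : ℝ :=
  p (ω ⊥) + q (ω ⊤) + I.indicator φ' (ω ⊥) * (ω ⊤ - ω ⊥)

theorem measurable_baseValue {I : Set ℝ} (hp : Measurable p) (hq : Measurable q)
    (hφ : Measurable (I.indicator φ')) : Measurable (baseValue (T := T) I p q φ') :=
  ((hp.comp (measurable_eval ⊥)).add (hq.comp (measurable_eval ⊤))).add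
    ((hφ.comp (measurable_eval ⊥)).mul ((measurable_eval ⊤).sub (measurable_eval ⊥)))

theorem measurable_indicator_rightDeriv (h : IsIrreducible μ ν) {g : ℝ → ℝ}
    (hg : ConvexOn ℝ (domI μ ν) g) : Measurable ((domI μ ν).indicator (rightDeriv g)) := by
  have := h.ordConnected_domI
  refine measurable_indicator_of_domRestrict h.isOpen_domI.measurableSet ?_
  exact Monotone.measurable fun x y hxy => monotoneOn_rightDeriv h.isOpen_domI hg x.2 y.2 hxy

/-- Write `B = S + D + w(X_0)(X_T - X_0)` with `S` integrable and `D` the concavity gap of `χ`. On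
`{|w(X_0)| ≤ n}` the last term has mean zero; since `B ≥ 0`, Fatou's lemma lets `n → ∞`. -/
theorem IsMartingaleCoupling.lintegral_baseValue_le (h : IsIrreducible μ ν)
    (hP : IsMartingaleCoupling μ ν P) (hp : Measurable p) (hq : Measurable q)
    (hφ : Measurable ((domI μ ν).indicator φ'))
    (h0 : ∀ᵐ ω ∂P, 0 ≤ baseValue (domI μ ν) p q φ' ω) {χ : ℝ → ℝ}
    (hχ : ConcaveOn ℝ (domJ μ ν) χ) (hu : Integrable (fun x => p x - χ x) μ)
    (hv : Integrable (fun x => q x + χ x) ν) :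
    ((∫⁻ ω, ENNReal.ofReal (baseValue (domI μ ν) p q φ' ω) ∂P : ℝ≥0∞) : EReal) ≤
      (((∫ x, p x - χ x ∂μ) + ∫ x, q x + χ x ∂ν : ℝ) : EReal) +
        (concaveIntegral (domI μ ν) (domJ μ ν) μ ν χ : EReal) := by
  have := hP.finite
  set B := baseValue (T := T) (domI μ ν) p q φ' with hB
  have hBm : Measurable B := measurable_baseValue hp hq hφ
  by_cases htop : concaveIntegral (domI μ ν) (domJ μ ν) μ ν χ = ⊤
  · rw [htop, EReal.coe_ennreal_top, EReal.coe_add_top]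
    exact le_top
  set r : ℝ → ℝ := (domI μ ν).indicator (rightDeriv fun y => -χ y) with hr
  have hgI : ConvexOn ℝ (domI μ ν) (fun y => -χ y) :=
    hχ.neg.subset domI_subset_domJ h.ordConnected_domI.convex
  have hrm : Measurable r := measurable_indicator_rightDeriv h hgI
  set w : ℝ → ℝ := fun x => (domI μ ν).indicator φ' x + r x with hw
  have hwm : Measurable w := hφ.add hrm
  set D : CadlagPath T → ℝ := fun ω => χ (ω ⊥) - χ (ω ⊤) - r (ω ⊥) * (ω ⊤ - ω ⊥) with hD
  set S : CadlagPath T → ℝ := fun ω => (p (ω ⊥) - χ (ω ⊥)) + (q (ω ⊤) + χ (ω ⊤)) with hS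
  have hSint : Integrable S P := (hP.integrable_zero hu).add (hP.integrable_top hv)
  have hdecomp : ∀ ω, B ω = S ω + D ω + w (ω ⊥) * (ω ⊤ - ω ⊥) := fun ω => by
    simp only [hB, hS, hD, hw, baseValue]
    ring
  -- Since `χ` is arbitrary outside `J`, measurability is read off from the other terms of the
  -- decomposition.
  have hDm : AEMeasurable D P := by
    have : D = fun ω => B ω - S ω - w (ω ⊥) * (ω ⊤ - ω ⊥) := by
      ext ω
      rw [hdecomp]
      ring
    rw [this]
    exact (hBm.aemeasurable.sub hSint.aemeasurable).sub ((hwm.comp (measurable_eval ⊥)).mul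
      ((measurable_eval ⊤).sub (measurable_eval ⊥))).aemeasurable
  have hDle : ∫⁻ ω, ENNReal.ofReal (D ω) ∂P ≤ concaveIntegral (domI μ ν) (domJ μ ν) μ ν χ := by
    refine le_trans (le_of_eq (lintegral_congr_ae ?_)) (hP.lintegral_gap_le h hχ)
    filter_upwards [hP.ae_zero h.ae_mem_domI] with ω hω
    simp only [hD, hr, indicator_of_mem hω]
  have hDtop : ∫⁻ ω, ENNReal.ofReal (D ω) ∂P ≠ ⊤ := ne_top_of_le_ne_top htop hDle
  -- The positive part of `D` suffices for an upper bound, and it is integrable once the concave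
  -- integral is finite.
  set d : CadlagPath T → ℝ := fun ω => (ENNReal.ofReal (D ω)).toReal with hd
  have hdint : Integrable d P := integrable_toReal_of_lintegral_ne_top hDm.ennreal_ofReal hDtop
  have hdle : ∀ ω, D ω ≤ d ω := fun ω => by
    change _ ≤ (ENNReal.ofReal (D ω)).toReal
    rw [ENNReal.toReal_ofReal']
    exact le_max_left _ _
  have hdval : ∫ ω, d ω ∂P = (∫⁻ ω, ENNReal.ofReal (D ω) ∂P).toReal :=
    integral_toReal hDm.ennreal_ofReal (Eventually.of_forall fun ω => ENNReal.ofReal_lt_top)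
  set E : ℕ → Set ℝ := fun n => {x | |w x| ≤ n} with hE
  have hEm : ∀ n, MeasurableSet (E n) := fun n => measurableSet_le hwm.abs measurable_const
  have hEm' : ∀ n, MeasurableSet {ω : CadlagPath T | ω ⊥ ∈ E n} := fun n => measurable_eval ⊥ (hEm n)
  have hEev : ∀ ω : CadlagPath T, ∀ᶠ n in atTop, ω ⊥ ∈ E n := fun ω => by
    obtain ⟨N, hN⟩ := exists_nat_ge |w (ω ⊥)|
    filter_upwards [eventually_ge_atTop N] with n hn
    exact hN.trans (Nat.cast_le.2 hn)
  set c : ℕ → ℝ := fun n => (∫ ω, {ω | ω ⊥ ∈ E n}.indicator S ω ∂P) + ∫ ω, d ω ∂P with hc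
  have hclim : Tendsto c atTop (𝓝 ((∫ ω, S ω ∂P) + ∫ ω, d ω ∂P)) := by
    refine Tendsto.add_const _ (tendsto_integral_of_dominated_convergence (fun ω => |S ω|)
      (fun n => (hSint.indicator (hEm' n)).aestronglyMeasurable) hSint.abs
      (fun n => Eventually.of_forall fun ω => norm_indicator_le_norm_self _ _)
      (Eventually.of_forall fun ω => ?_))
    refine tendsto_const_nhds.congr' ?_
    filter_upwards [hEev ω] with n hn
    rw [indicator_of_mem (show ω ∈ {ω | ω ⊥ ∈ E n} from hn)]
  have hbound : ∀ n, ∫⁻ ω, ENNReal.ofReal ({ω | ω ⊥ ∈ E n}.indicator B ω) ∂P ≤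
      ENNReal.ofReal (c n) ∧ 0 ≤ c n := by
    intro n
    obtain ⟨h1, h2⟩ := hP.integral_zero_mul (k := (E n).indicator w) (hwm.indicator (hEm n))
      (C := n) fun x => by
        by_cases hx : x ∈ E n
        · rw [indicator_of_mem hx]
          exact hx
        · rw [indicator_of_notMem hx]
          simp
    have hSn := hSint.indicator (hEm' n)
    have hle : ∀ ω, {ω | ω ⊥ ∈ E n}.indicator B ω ≤ {ω | ω ⊥ ∈ E n}.indicator S ω +
        (E n).indicator w (ω ⊥) * (ω ⊤ - ω ⊥) + d ω := by
      intro ω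
      by_cases hω : ω ⊥ ∈ E n
      · rw [indicator_of_mem (show ω ∈ {ω | ω ⊥ ∈ E n} from hω),
          indicator_of_mem (show ω ∈ {ω | ω ⊥ ∈ E n} from hω), indicator_of_mem hω, hdecomp]
        linarith [hdle ω]
      · rw [indicator_of_notMem (show ω ∉ {ω | ω ⊥ ∈ E n} from hω),
          indicator_of_notMem (show ω ∉ {ω | ω ⊥ ∈ E n} from hω), indicator_of_notMem hω]
        have : 0 ≤ d ω := ENNReal.toReal_nonneg
        linarith
    have hnn : ∀ᵐ ω ∂P, 0 ≤ {ω | ω ⊥ ∈ E n}.indicator S ω +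
        (E n).indicator w (ω ⊥) * (ω ⊤ - ω ⊥) + d ω := by
      filter_upwards [h0] with ω hω
      refine le_trans ?_ (hle ω)
      by_cases hω' : ω ∈ {ω : CadlagPath T | ω ⊥ ∈ E n}
      · rwa [indicator_of_mem hω']
      · rw [indicator_of_notMem hω']
    have hint1 : Integrable (fun ω => {ω | ω ⊥ ∈ E n}.indicator S ω +
        (E n).indicator w (ω ⊥) * (ω ⊤ - ω ⊥)) P := hSn.add h1
    have hint : Integrable (fun ω => {ω | ω ⊥ ∈ E n}.indicator S ω +
        (E n).indicator w (ω ⊥) * (ω ⊤ - ω ⊥) + d ω) P := hint1.add hdint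
    have hval : ∫ ω, ({ω | ω ⊥ ∈ E n}.indicator S ω +
        (E n).indicator w (ω ⊥) * (ω ⊤ - ω ⊥) + d ω) ∂P = c n := by
      rw [integral_add hint1 hdint, integral_add hSn h1, h2, add_zero]
    rw [← hval]
    refine ⟨?_, integral_nonneg_of_ae hnn⟩
    rw [ofReal_integral_eq_lintegral_ofReal hint hnn]
    exact lintegral_mono fun ω => ENNReal.ofReal_le_ofReal (hle ω)
  have hfin : ∫⁻ ω, ENNReal.ofReal (B ω) ∂P ≤
      ENNReal.ofReal ((∫ ω, S ω ∂P) + ∫ ω, d ω ∂P) := by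
    refine lintegral_le_of_tendsto (fun n => (hBm.indicator (hEm' n)).ennreal_ofReal.aemeasurable)
      (Eventually.of_forall fun ω => ?_) (fun n => (hbound n).1) (ENNReal.tendsto_ofReal hclim)
    refine tendsto_const_nhds.congr' ?_
    filter_upwards [hEev ω] with n hn
    rw [indicator_of_mem (show ω ∈ {ω | ω ⊥ ∈ E n} from hn)]
  have hnonneg : 0 ≤ (∫ ω, S ω ∂P) + ∫ ω, d ω ∂P := ge_of_tendsto' hclim fun n => (hbound n).2
  calc ((∫⁻ ω, ENNReal.ofReal (B ω) ∂P : ℝ≥0∞) : EReal)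
      ≤ (((∫ ω, S ω ∂P) + ∫ ω, d ω ∂P : ℝ) : EReal) := by
        rw [← max_eq_left hnonneg, ← EReal.coe_ennreal_ofReal]
        exact EReal.coe_ennreal_le_coe_ennreal_iff.2 hfin
    _ ≤ _ := by
        rw [EReal.coe_add, integral_add (hP.integrable_zero hu) (hP.integrable_top hv),
          hP.integral_zero (k := fun x => p x - χ x) hu.aestronglyMeasurable,
          hP.integral_top (k := fun x => q x + χ x) hv.aestronglyMeasurable, hdval]
        refine add_le_add le_rfl ?_
        rw [EReal.coe_ennreal_toReal hDtop]
        exact EReal.coe_ennreal_le_coe_ennreal_iff.2 hDle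

end Expectation

end

section

/-! ### Expected value of the full portfolio: removing the gains by truncation -/

section Portfolio

variable {T : ℝ} [Fact (0 ≤ T)] {μ ν : Measure ℝ} [IsFiniteMeasure μ] [IsFiniteMeasure ν]
  {P : Measure (CadlagPath T)} {p q φ' ψ' : ℝ → ℝ}

/-- The pairs of points at which neither of the two slopes exceeds `n`. -/
def boundedSlopes (I : Set ℝ) (φ' ψ' : ℝ → ℝ) (n : ℕ) : Set (ℝ × ℝ) :=
  {z | |I.indicator φ' z.1| ≤ n ∧ |I.indicator ψ' z.2| ≤ n}

/-- The rate, set to `0` where one of the two slopes exceeds `n`. -/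
def truncatedRate (I : Set ℝ) (φ' ψ' : ℝ → ℝ) (n : ℕ) : ℝ × ℝ → ℝ :=
  (boundedSlopes I φ' ψ' n).indicator (fun z => rate I φ' ψ' z.1 z.2)

theorem measurable_truncatedRate {I : Set ℝ} (hφ : Measurable (I.indicator φ'))
    (hψ : Measurable (I.indicator ψ')) (n : ℕ) : Measurable (truncatedRate I φ' ψ' n) :=
  (measurable_rate hφ hψ).indicator
    ((measurableSet_le (hφ.comp measurable_fst).abs measurable_const).inter
      (measurableSet_le (hψ.comp measurable_snd).abs measurable_const))

theorem abs_truncatedRate_le (I : Set ℝ) (φ' ψ' : ℝ → ℝ) (n : ℕ) (z : ℝ × ℝ) :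
    |truncatedRate I φ' ψ' n z| ≤ n + n := by
  unfold truncatedRate
  by_cases hz : z ∈ boundedSlopes I φ' ψ' n
  · rw [indicator_of_mem hz, rate]
    refine (abs_sub _ _).trans ?_
    rw [abs_neg]
    exact add_le_add hz.1 hz.2
  · rw [indicator_of_notMem hz, abs_zero]
    positivity

/-- Truncation only scales the gain by some `θ ∈ [0, 1]`. Positivity survives this: if `B` and `B +
G` are nonnegative, so is `B + θ G = (1 - θ) B + θ (B + G)`. -/
theorem exists_truncatedRate_mul_eq (I : Set ℝ) (φ' ψ' : ℝ → ℝ) (n : ℕ) (x y d : ℝ) :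
    ∃ θ : ℝ, 0 ≤ θ ∧ θ ≤ 1 ∧
      truncatedRate I φ' ψ' n (x, y) * (cutoff n y * d) = θ * (d * rate I φ' ψ' x y) := by
  unfold truncatedRate
  by_cases hz : (x, y) ∈ boundedSlopes I φ' ψ' n
  · refine ⟨cutoff n y, cutoff_nonneg _ _, cutoff_le_one _ _, ?_⟩
    rw [indicator_of_mem hz]
    ring
  · refine ⟨0, le_rfl, zero_le_one, ?_⟩
    rw [indicator_of_notMem hz]
    ring

theorem eventually_truncatedRate_mul_eq (I : Set ℝ) (φ' ψ' : ℝ → ℝ) (x y d : ℝ) :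
    ∀ᶠ n : ℕ in atTop,
      truncatedRate I φ' ψ' n (x, y) * (cutoff n y * d) = d * rate I φ' ψ' x y := by
  obtain ⟨N, hN⟩ := exists_nat_ge (max (max |I.indicator φ' x| |I.indicator ψ' y|) |y|)
  filter_upwards [eventually_ge_atTop N] with n hn
  have h := hN.trans (Nat.cast_le.2 hn)
  rw [max_le_iff, max_le_iff] at h
  rw [truncatedRate, indicator_of_mem (show (x, y) ∈ boundedSlopes I φ' ψ' n from h.1), cutoff_eq_one h.2]
  ring

theorem AveragingProcess.measurable_integral (A : AveragingProcess T) {k : ℝ × ℝ × ℝ → ℝ}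
    (hk : Measurable k) :
    Measurable fun ω => ∫ t, k (ω ⊥, ω ⊤, ω t) ∂(A.path ω).measure := by
  have h0 : Measurable fun z : CadlagPath T × Icc (0 : ℝ) T => (z.1 ⊥, z.1 ⊤, z.1 z.2) :=
    ((measurable_eval ⊥).comp measurable_fst).prodMk
      (((measurable_eval ⊤).comp measurable_fst).prodMk measurable_eval_uncurry)
  exact ((hk.comp h0).stronglyMeasurable.integral_kernel_prod_right' (κ := A.kernel)).measurable

theorem AveragingProcess.integral_integral_cutoff [IsFiniteMeasure P]
    (A : AveragingProcess T) (hM : Martingale (fun t (ω : CadlagPath T) => ω t) (pathFiltration T) P)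
    (N : ℕ) {g : ℝ × ℝ → ℝ} (hg : Measurable g) {C : ℝ} (hC : ∀ z, |g z| ≤ C) :
    Integrable (fun ω => ∫ t, g (ω ⊥, ω t) * (cutoff N (ω t) * (ω ⊤ - ω t)) ∂(A.path ω).measure) P ∧
    ∫ ω, ∫ t, g (ω ⊥, ω t) * (cutoff N (ω t) * (ω ⊤ - ω t)) ∂(A.path ω).measure ∂P = 0 := by
  have hint : Integrable (fun z : CadlagPath T × Icc (0 : ℝ) T =>
      g (z.1 ⊥, z.1 z.2) * (cutoff N (z.1 z.2) * (z.1 ⊤ - z.1 z.2))) (P ⊗ₘ A.kernel) :=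
    A.integrable_cutoff hM N hg hC (r := fun t => t) measurable_id
  have hzero := A.integral_cutoff hM N hg hC
  rw [Measure.integral_compProd hint] at hzero
  refine ⟨?_, hzero⟩
  rw [Measure.compProd] at hint
  exact hint.integral_compProd

/-- The terminal value of the portfolio, for real-valued static positions. -/
def realPortfolio (I : Set ℝ) (p q φ' ψ' : ℝ → ℝ) (A : AveragingProcess T) (ω : CadlagPath T) : ℝ :=
  baseValue I p q φ' ω + ∫ t, (ω ⊤ - ω t) * rate I φ' ψ' (ω ⊥) (ω t) ∂(A.path ω).measure

theorem measurable_realPortfolio {I : Set ℝ} (hp : Measurable p) (hq : Measurable q)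
    (hφ : Measurable (I.indicator φ')) (hψ : Measurable (I.indicator ψ')) (A : AveragingProcess T) :
    Measurable (realPortfolio I p q φ' ψ' A) := by
  refine (measurable_baseValue hp hq hφ).add (A.measurable_integral
    (k := fun z => (z.2.1 - z.2.2) * rate I φ' ψ' z.1 z.2.2) ?_)
  exact ((measurable_fst.comp measurable_snd).sub (measurable_snd.comp measurable_snd)).mul
    ((measurable_rate hφ hψ).comp (measurable_fst.prodMk (measurable_snd.comp measurable_snd)))

/-- Truncated gains have mean zero and keep the total nonnegative, so Fatou's lemma bounds the
expectation of the limit by that of the base value. -/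
theorem IsMartingaleCoupling.lintegral_realPortfolio_le (h : IsIrreducible μ ν)
    (hP : IsMartingaleCoupling μ ν P) (hp : Measurable p) (hq : Measurable q)
    (hφ : Measurable ((domI μ ν).indicator φ')) (hψ : Measurable ((domI μ ν).indicator ψ'))
    (hsup : ∀ x₀ ∈ domI μ ν, ∀ x ∈ domJ μ ν, p x ≤ p x₀ + φ' x₀ * (x - x₀))
    (hsub : ∀ x₀ ∈ domI μ ν, ∀ x ∈ domJ μ ν, q x₀ + ψ' x₀ * (x - x₀) ≤ q x)
    (h0 : ∀ x ∈ domJ μ ν, 0 ≤ p x + q x) (A : AveragingProcess T) :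
    ∫⁻ ω, ENNReal.ofReal (realPortfolio (domI μ ν) p q φ' ψ' A ω) ∂P ≤
      ∫⁻ ω, ENNReal.ofReal (baseValue (domI μ ν) p q φ' ω) ∂P := by
  have := hP.finite
  set I := domI μ ν with hI
  set B := baseValue (T := T) I p q φ' with hB
  have hBm : Measurable B := measurable_baseValue hp hq hφ
  have hrel := hP.ae_mem_relevantPaths h
  have hdate : ∀ ω ∈ relevantPaths (T := T) μ ν, ∀ t,
      0 ≤ B ω + (ω ⊤ - ω t) * rate I φ' ψ' (ω ⊥) (ω t) := fun ω hω t =>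
    (h0 _ (mem_domJ_of_mem_relevantPaths hω t)).trans (add_le_single_date h hω hsup hsub t)
  -- A trade at the final date earns nothing.
  have hB0 : ∀ ω ∈ relevantPaths (T := T) μ ν, 0 ≤ B ω := fun ω hω => by
    simpa using hdate ω hω ⊤
  by_cases htop : ∫⁻ ω, ENNReal.ofReal (B ω) ∂P = ⊤
  · rw [htop]
    exact le_top
  have hBint : Integrable B P :=
    ⟨hBm.aestronglyMeasurable, by
      rw [hasFiniteIntegral_iff_ofReal (hrel.mono hB0)]
      exact lt_top_iff_ne_top.2 htop⟩
  set k : ℕ → CadlagPath T → Icc (0 : ℝ) T → ℝ := fun n ω t =>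
    truncatedRate I φ' ψ' n (ω ⊥, ω t) * (cutoff n (ω t) * (ω ⊤ - ω t)) with hk
  have hkint' : ∀ n, Integrable (fun ω => ∫ t, k n ω t ∂(A.path ω).measure) P := fun n =>
    (A.integral_integral_cutoff hP.martingale n (measurable_truncatedRate hφ hψ n)
      (abs_truncatedRate_le I φ' ψ' n)).1
  have hkzero : ∀ n, ∫ ω, ∫ t, k n ω t ∂(A.path ω).measure ∂P = 0 := fun n =>
    (A.integral_integral_cutoff hP.martingale n (measurable_truncatedRate hφ hψ n)
      (abs_truncatedRate_le I φ' ψ' n)).2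
  have hkmeas : ∀ n ω, Measurable (k n ω) := fun n ω =>
    ((measurable_truncatedRate hφ hψ n).comp (measurable_const.prodMk ω.cadlag.measurable)).mul
      (((continuous_cutoff n).measurable.comp ω.cadlag.measurable).mul
        (measurable_const.sub ω.cadlag.measurable))
  have hkbound : ∀ n ω t, |k n ω t| ≤ |(ω ⊤ - ω t) * rate I φ' ψ' (ω ⊥) (ω t)| := by
    intro n ω t
    obtain ⟨θ, h1, h2, h3⟩ := exists_truncatedRate_mul_eq I φ' ψ' n (ω ⊥) (ω t) (ω ⊤ - ω t)
    simp only [hk]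
    rw [h3, abs_mul, abs_of_nonneg h1]
    exact mul_le_of_le_one_left (abs_nonneg _) h2
  have hnonneg : ∀ n, ∀ ω ∈ relevantPaths (T := T) μ ν,
      0 ≤ B ω + ∫ t, k n ω t ∂(A.path ω).measure := by
    intro n ω hω
    obtain ⟨C, hC⟩ := exists_abs_rate_mul_le (φ' := φ') h hω hsub
    have hint : Integrable (k n ω) (A.path ω).measure :=
      Integrable.of_bound (hkmeas n ω).aestronglyMeasurable C
        (Eventually.of_forall fun t => (hkbound n ω t).trans (hC t))
    have h1 : ∫ _t, -B ω ∂(A.path ω).measure ≤ ∫ t, k n ω t ∂(A.path ω).measure := by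
      refine integral_mono (integrable_const _) hint fun t => ?_
      obtain ⟨θ, h1, h2, h3⟩ := exists_truncatedRate_mul_eq I φ' ψ' n (ω ⊥) (ω t) (ω ⊤ - ω t)
      simp only [hk]
      rw [h3]
      -- The convex combination of the two nonnegative quantities with weights `1 - θ` and `θ`.
      nlinarith [hdate ω hω t, hB0 ω hω]
    simp only [integral_const, probReal_univ, one_smul] at h1
    linarith
  refine lintegral_le_of_tendsto
    (f := fun n ω => ENNReal.ofReal (B ω + ∫ t, k n ω t ∂(A.path ω).measure))
    (fun n => (hBint.add (hkint' n)).aemeasurable.ennreal_ofReal) ?_ (fun n => ?_)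
    (tendsto_const_nhds)
  · filter_upwards [hrel] with ω hω
    obtain ⟨C, hC⟩ := exists_abs_rate_mul_le (φ' := φ') h hω hsub
    refine ENNReal.tendsto_ofReal (Tendsto.const_add _ ?_)
    refine tendsto_integral_of_dominated_convergence (fun _ => C)
      (fun n => (hkmeas n ω).aestronglyMeasurable) (integrable_const _)
      (fun n => Eventually.of_forall fun t => (hkbound n ω t).trans (hC t))
      (Eventually.of_forall fun t => tendsto_const_nhds.congr' ?_)
    filter_upwards [eventually_truncatedRate_mul_eq I φ' ψ' (ω ⊥) (ω t) (ω ⊤ - ω t)] with n hn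
    exact hn.symm
  · have hint : Integrable (fun ω => B ω + ∫ t, k n ω t ∂(A.path ω).measure) P :=
      hBint.add (hkint' n)
    rw [← ofReal_integral_eq_lintegral_ofReal hint (hrel.mono fun ω hω => hnonneg n ω hω),
      ← ofReal_integral_eq_lintegral_ofReal hBint (hrel.mono hB0),
      integral_add hBint (hkint' n), hkzero, add_zero]

end Portfolio

end

section

/-! ### Return to extended real static positions; the superhedge -/

section Superhedge

variable {T : ℝ} [Fact (0 ≤ T)] {μ ν : Measure ℝ} [IsFiniteMeasure μ] [IsFiniteMeasure ν]
  {f φ ψ : ℝ → EReal} {φ' ψ' : ℝ → ℝ}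

/-- The real part on `J` of an extended real function. -/
def realPart (J : Set ℝ) (φ : ℝ → EReal) (x : ℝ) : ℝ := (J.indicator φ x).toReal

theorem measurable_realPart {J : Set ℝ} (hJ : MeasurableSet J) (hφ : Measurable (J.domRestrict φ)) :
    Measurable (realPart J φ) :=
  (measurable_indicator_of_domRestrict hJ hφ).ereal_toReal

theorem realPart_of_mem {J : Set ℝ} {x : ℝ} (hx : x ∈ J) : realPart J φ x = (φ x).toReal := by
  rw [realPart, indicator_of_mem hx]

theorem IsAuxDualFeasible.coe_realPart_left (h : IsIrreducible μ ν) (hf : ∀ x, 0 ≤ f x)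
    (hd : IsAuxDualFeasible μ ν f φ ψ) (hφ' : IsSuperderivative (domI μ ν) (domJ μ ν) φ φ') {x : ℝ}
    (hx : x ∈ domJ μ ν) : (realPart (domJ μ ν) φ x : EReal) = φ x := by
  have hI : (domI μ ν).Nonempty := closure_nonempty_iff.1 ⟨x, domJ_subset_closure hx⟩
  have := hd.finite_left h hI hf hφ' hx
  rw [realPart_of_mem hx, EReal.coe_toReal this.1 this.2]

theorem IsAuxDualFeasible.coe_realPart_right (h : IsIrreducible μ ν) (hf : ∀ x, 0 ≤ f x)
    (hd : IsAuxDualFeasible μ ν f φ ψ) (hψ' : IsSubderivative (domI μ ν) (domJ μ ν) ψ ψ') {x : ℝ}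
    (hx : x ∈ domJ μ ν) : (realPart (domJ μ ν) ψ x : EReal) = ψ x := by
  have hI : (domI μ ν).Nonempty := closure_nonempty_iff.1 ⟨x, domJ_subset_closure hx⟩
  have := hd.finite_right h hI hf hψ' hx
  rw [realPart_of_mem hx, EReal.coe_toReal this.1 this.2]

theorem IsAuxDualFeasible.realPart_left_le (h : IsIrreducible μ ν) (hf : ∀ x, 0 ≤ f x)
    (hd : IsAuxDualFeasible μ ν f φ ψ) (hφ' : IsSuperderivative (domI μ ν) (domJ μ ν) φ φ') :
    ∀ x₀ ∈ domI μ ν, ∀ x ∈ domJ μ ν,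
      realPart (domJ μ ν) φ x ≤ realPart (domJ μ ν) φ x₀ + φ' x₀ * (x - x₀) := by
  intro x₀ hx₀ x hx
  have := hφ'.le x₀ hx₀ x hx
  rw [← hd.coe_realPart_left h hf hφ' hx,
    ← hd.coe_realPart_left h hf hφ' (domI_subset_domJ hx₀)] at this
  exact_mod_cast this

theorem IsAuxDualFeasible.le_realPart_right (h : IsIrreducible μ ν) (hf : ∀ x, 0 ≤ f x)
    (hd : IsAuxDualFeasible μ ν f φ ψ) (hψ' : IsSubderivative (domI μ ν) (domJ μ ν) ψ ψ') :
    ∀ x₀ ∈ domI μ ν, ∀ x ∈ domJ μ ν,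
      realPart (domJ μ ν) ψ x₀ + ψ' x₀ * (x - x₀) ≤ realPart (domJ μ ν) ψ x := by
  intro x₀ hx₀ x hx
  have := hψ'.le x₀ hx₀ x hx
  rw [← hd.coe_realPart_right h hf hψ' hx,
    ← hd.coe_realPart_right h hf hψ' (domI_subset_domJ hx₀)] at this
  exact_mod_cast this

theorem IsAuxDualFeasible.le_realPart_add (h : IsIrreducible μ ν) (hf : ∀ x, 0 ≤ f x)
    (hd : IsAuxDualFeasible μ ν f φ ψ) (hφ' : IsSuperderivative (domI μ ν) (domJ μ ν) φ φ')
    (hψ' : IsSubderivative (domI μ ν) (domJ μ ν) ψ ψ') {x : ℝ} (hx : x ∈ domJ μ ν) :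
    f x ≤ ((realPart (domJ μ ν) φ x + realPart (domJ μ ν) ψ x : ℝ) : EReal) := by
  rw [EReal.coe_add, hd.coe_realPart_left h hf hφ' hx, hd.coe_realPart_right h hf hψ' hx]
  exact hd.le x hx

theorem IsAuxDualFeasible.portfolioValue_eq (h : IsIrreducible μ ν) (hf : ∀ x, 0 ≤ f x)
    (hd : IsAuxDualFeasible μ ν f φ ψ) (hφ' : IsSuperderivative (domI μ ν) (domJ μ ν) φ φ')
    (hψ' : IsSubderivative (domI μ ν) (domJ μ ν) ψ ψ') (A : AveragingProcess T)
    {ω : CadlagPath T} (hω : ω ∈ relevantPaths (T := T) μ ν) :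
    portfolioValue φ ψ (dynamicPart (domI μ ν) φ' ψ') (fun t x => x.2 t) A ω =
      (realPortfolio (domI μ ν) (realPart (domJ μ ν) φ) (realPart (domJ μ ν) ψ) φ' ψ' A ω : EReal) := by
  have hφm := measurable_indicator_of_domRestrict h.isOpen_domI.measurableSet hφ'.measurable
  have hψm := measurable_indicator_of_domRestrict h.isOpen_domI.measurableSet hψ'.measurable
  rw [portfolioValue, gains_dynamicPart A ω (integrable_rate_mul h hω hφm hψm
      (hd.le_realPart_right h hf hψ') _),
    ← hd.coe_realPart_left h hf hφ' (mem_domJ_of_mem_relevantPaths hω ⊥),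
    ← hd.coe_realPart_right h hf hψ' (mem_domJ_of_mem_relevantPaths hω ⊤), realPortfolio, baseValue,
    ← EReal.coe_add, ← EReal.coe_add]
  congr 1
  ring

theorem IsAuxDualFeasible.le_realPortfolio (h : IsIrreducible μ ν) (hf : ∀ x, 0 ≤ f x)
    (hd : IsAuxDualFeasible μ ν f φ ψ) (hφ' : IsSuperderivative (domI μ ν) (domJ μ ν) φ φ')
    (hψ' : IsSubderivative (domI μ ν) (domJ μ ν) ψ ψ') (A : AveragingProcess T)
    {ω : CadlagPath T} (hω : ω ∈ relevantPaths (T := T) μ ν) :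
    f (average ω (A.path ω)) ≤
      (realPortfolio (domI μ ν) (realPart (domJ μ ν) φ) (realPart (domJ μ ν) ψ) φ' ψ' A ω : EReal) := by
  have hφm := measurable_indicator_of_domRestrict h.isOpen_domI.measurableSet hφ'.measurable
  have hψm := measurable_indicator_of_domRestrict h.isOpen_domI.measurableSet hψ'.measurable
  obtain ⟨h1, h2⟩ := add_average_le h hω hφm hψm (hd.realPart_left_le h hf hφ')
    (hd.le_realPart_right h hf hψ') (A.path ω)
  exact (hd.le_realPart_add h hf hφ' hψ' h1).trans (EReal.coe_le_coe_iff.2 h2)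

theorem IsAuxDualFeasible.isSemiStaticStrategy (h : IsIrreducible μ ν) (hf : ∀ x, 0 ≤ f x)
    (hd : IsAuxDualFeasible μ ν f φ ψ) (hφ' : IsSuperderivative (domI μ ν) (domJ μ ν) φ φ')
    (hψ' : IsSubderivative (domI μ ν) (domJ μ ν) ψ ψ') :
    IsSemiStaticStrategy (T := T) μ ν φ ψ (dynamicPart (domI μ ν) φ' ψ') (fun t x => x.2 t) := by
  have hφm := measurable_indicator_of_domRestrict h.isOpen_domI.measurableSet hφ'.measurable
  have hψm := measurable_indicator_of_domRestrict h.isOpen_domI.measurableSet hψ'.measurable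
  refine ⟨hd.mem_Lc, fun t => ?_, fun t => measurable_hatFiltration_snd le_rfl, fun A => ?_⟩
  · exact @measurable_dynamicPart_comp T _ φ' ψ' _ _ (hatFiltration T t) hφm hψm t (fun x => x)
      (measurable_hatFiltration_fst bot_le) (measurable_hatFiltration_fst le_rfl)
      (measurable_hatFiltration_snd bot_le)
  · exact
      { adapted_h := adapted_pullback_dynamicPart hφm hψm A
        adapted_Y := A.adapted
        cadlag := fun ω => (A.path ω).cadlag
        finite_variation := fun ω => (A.path ω).boundedVariationOn
        integrable := fun ω hω => integrable_dynamicPart (A.path ω) ω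
          (integrable_rate_mul h hω hφm hψm (hd.le_realPart_right h hf hψ') _) }

/-- Valid for every concave moderator, so the bound passes to the infimum defining
`generalizedIntegral` without knowing that the value is independent of the moderator. -/
theorem IsAuxDualFeasible.lintegral_baseValue_le_moderatedValue (h : IsIrreducible μ ν)
    (hf : ∀ x, 0 ≤ f x) (hd : IsAuxDualFeasible μ ν f φ ψ)
    (hφ' : IsSuperderivative (domI μ ν) (domJ μ ν) φ φ')
    (hψ' : IsSubderivative (domI μ ν) (domJ μ ν) ψ ψ') {P : Measure (CadlagPath T)}
    (hP : IsMartingaleCoupling μ ν P) {χ : ℝ → ℝ}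
    (hχ : IsConcaveModerator (domJ μ ν) μ ν φ ψ χ) :
    ((∫⁻ ω, ENNReal.ofReal (baseValue (domI μ ν) (realPart (domJ μ ν) φ) (realPart (domJ μ ν) ψ)
      φ' ω) ∂P : ℝ≥0∞) : EReal) ≤ moderatedValue (domI μ ν) (domJ μ ν) μ ν φ ψ χ := by
  have hJm := h.measurableSet_domJ
  have hφm := measurable_indicator_of_domRestrict h.isOpen_domI.measurableSet hφ'.measurable
  have hu : (fun x => (φ x - (χ x : EReal)).toReal) =ᵐ[μ]
      fun x => realPart (domJ μ ν) φ x - χ x := by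
    filter_upwards [h.ae_mem_domI] with x hx
    rw [← hd.coe_realPart_left h hf hφ' (domI_subset_domJ hx), ← EReal.coe_sub, EReal.toReal_coe]
  have hv : (fun x => (ψ x + (χ x : EReal)).toReal) =ᵐ[ν]
      fun x => realPart (domJ μ ν) ψ x + χ x := by
    filter_upwards [h.ae_mem_domJ] with x hx
    rw [← hd.coe_realPart_right h hf hψ' hx, ← EReal.coe_add, EReal.toReal_coe]
  have h1 := hχ.left.2
  have h2 := hχ.right.2
  rw [IntegrableOn, h.restrict_domJ_left] at h1
  rw [IntegrableOn, h.restrict_domJ_right] at h2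
  rw [moderatedValue, h.restrict_domJ_left, h.restrict_domJ_right, integral_congr_ae hu,
    integral_congr_ae hv]
  refine hP.lintegral_baseValue_le h (measurable_realPart hJm hd.mem_Lc.measurable_left)
    (measurable_realPart hJm hd.mem_Lc.measurable_right) hφm ?_ hχ.concave (h1.congr hu)
    (h2.congr hv)
  filter_upwards [hP.ae_mem_relevantPaths h] with ω hω
  have h3 := add_le_single_date h hω (hd.realPart_left_le h hf hφ')
    (hd.le_realPart_right h hf hψ') ⊤
  have h4 := (hf _).trans (hd.le_realPart_add h hf hφ' hψ' (mem_domJ_of_mem_relevantPaths hω ⊤))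
  rw [sub_self, zero_mul, add_zero] at h3
  exact (EReal.coe_nonneg.1 h4).trans h3

/-- The superhedging inequality with `f ≥ 0` makes the portfolio nonnegative almost surely, so its
expectation is well defined and only the positive part has to be estimated. -/
theorem IsAuxDualFeasible.expectationLE (h : IsIrreducible μ ν) (hf : ∀ x, 0 ≤ f x)
    (hd : IsAuxDualFeasible μ ν f φ ψ) (hφ' : IsSuperderivative (domI μ ν) (domJ μ ν) φ φ')
    (hψ' : IsSubderivative (domI μ ν) (domJ μ ν) ψ ψ') (A : AveragingProcess T)
    {P : Measure (CadlagPath T)} (hP : IsMartingaleCoupling μ ν P) :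
    ExpectationLE P (portfolioValue φ ψ (dynamicPart (domI μ ν) φ' ψ') (fun t x => x.2 t) A)
      (generalizedIntegral (domI μ ν) (domJ μ ν) μ ν φ ψ) := by
  have hJm := h.measurableSet_domJ
  have hφm := measurable_indicator_of_domRestrict h.isOpen_domI.measurableSet hφ'.measurable
  have hψm := measurable_indicator_of_domRestrict h.isOpen_domI.measurableSet hψ'.measurable
  have hpm := measurable_realPart hJm hd.mem_Lc.measurable_left
  have hqm := measurable_realPart hJm hd.mem_Lc.measurable_right
  set R := realPortfolio (T := T) (domI μ ν) (realPart (domJ μ ν) φ) (realPart (domJ μ ν) ψ) φ' ψ' A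
    with hR
  have hrel := hP.ae_mem_relevantPaths h
  have heq : portfolioValue φ ψ (dynamicPart (domI μ ν) φ' ψ') (fun t x => x.2 t) A =ᵐ[P]
      fun ω => (R ω : EReal) := hrel.mono fun ω hω => hd.portfolioValue_eq h hf hφ' hψ' A hω
  have hneg : ∫⁻ ω, (-portfolioValue φ ψ (dynamicPart (domI μ ν) φ' ψ')
      (fun t x => x.2 t) A ω).toENNReal ∂P = 0 := by
    rw [← lintegral_zero (μ := P)]
    refine lintegral_congr_ae ?_
    filter_upwards [heq, hrel] with ω hω hω'
    rw [hω]
    exact EReal.toENNReal_of_nonpos (EReal.neg_le_zero.2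
      ((hf _).trans (hd.le_realPortfolio h hf hφ' hψ' A hω')))
  have hpos : ∫⁻ ω, (portfolioValue φ ψ (dynamicPart (domI μ ν) φ' ψ')
      (fun t x => x.2 t) A ω).toENNReal ∂P = ∫⁻ ω, ENNReal.ofReal (R ω) ∂P := by
    refine lintegral_congr_ae ?_
    filter_upwards [heq] with ω hω
    rw [hω, EReal.real_coe_toENNReal]
  refine ⟨?_, by rw [hneg]; exact ENNReal.zero_ne_top, ?_⟩
  · exact ((measurable_realPortfolio hpm hqm hφm hψm A).coe_real_ereal.aemeasurable).congr heq.symm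
  · rw [hneg, hpos, EReal.coe_ennreal_zero, sub_zero]
    refine le_iInf₂ fun χ hχ => le_trans ?_
      (hd.lintegral_baseValue_le_moderatedValue h hf hφ' hψ' hP hχ)
    refine EReal.coe_ennreal_le_coe_ennreal_iff.2 ?_
    refine hP.lintegral_realPortfolio_le h hpm hqm hφm hψm (hd.realPart_left_le h hf hφ')
      (hd.le_realPart_right h hf hψ') (fun x hx => EReal.coe_nonneg.1 ?_) A
    exact (hf x).trans (hd.le_realPart_add h hf hφ' hψ' hx)

end Superhedge

end

end

end SemiStatic

theorem mainTheorem3 (T : ℝ) [Fact (0 ≤ T)] (μ ν : Measure ℝ) [IsFiniteMeasure μ]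
    [IsFiniteMeasure ν] (hμν : SemiStatic.IsIrreducible μ ν)
    (f : ℝ → ℝ≥0∞) (hf : Measurable f) (φ ψ : ℝ → EReal)
    (hφψ : SemiStatic.IsAuxDualFeasible μ ν (fun x => (f x : EReal)) φ ψ)
    (φ' ψ' : ℝ → ℝ)
    (hφ' : SemiStatic.IsSuperderivative (SemiStatic.domI μ ν) (SemiStatic.domJ μ ν) φ φ')
    (hψ' : SemiStatic.IsSubderivative (SemiStatic.domI μ ν) (SemiStatic.domJ μ ν) ψ ψ')
    (𝒜 : Set (SemiStatic.AveragingProcess T)) :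
    SemiStatic.IsSemiStaticSuperhedge μ ν (fun x => (f x : EReal)) 𝒜 φ ψ
      (SemiStatic.dynamicPart (SemiStatic.domI μ ν) φ' ψ') (fun t x => x.2 t) := by
  have hf0 : ∀ x, 0 ≤ (f x : EReal) := fun x => EReal.coe_ennreal_nonneg _
  refine ⟨hφψ.isSemiStaticStrategy hμν hf0 hφ' hψ', fun A _ ω hω => ?_, fun A _ P hP =>
    hφψ.expectationLE hμν hf0 hφ' hψ' A hP⟩
  rw [hφψ.portfolioValue_eq hμν hf0 hφ' hψ' A hω]
  exact hφψ.le_realPortfolio hμν hf0 hφ' hψ' A hω
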